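/- Let $K,G,Q:\mathbb R\to\mathbb R$ be $C^\infty$ and $2\pi$-periodic, with $K>0$ and $G>0$ everywhere. Consider the periodic Sturm–Liouville eigenvalue problem $$-(K u')'+Q u=\lambda\, G\, u\ \text{ in }\mathbb R,\qquad u\ \text{ real-valued and } 2\pi\text{-periodic},$$ equivalently viewed on the circle $\mathbb S^1=\mathbb R/2\pi\mathbb Z$. There are a nondecreasing sequence of real numbers $\lambda_1\le\lambda_2\le\lambda_3\le\cdots$ and an orthonormal basis $(V_i)_{i\ge1}$ of $L^2(\mathbb S^1,G\,dt)$ such that each $V_i$ is a (classical) solution of the problem with $\lambda=\lambda_i$ (so that $(\lambda_i)$ is the list of the eigenvalues repeated according to multiplicity). Moreover, each eigenvalue has multiplicity at most $2$, and for every such pair of sequences $(\lambda_i)$, $(V_i)$ the following hold. 1. $\lambda_1<\lambda_2\le\lambda_3<\lambda_4\le\lambda_5<\cdots$, that is, $\lambda_1<\lambda_2$ and $\lambda_{2k}\le\lambda_{2k+1}<\lambda_{2k+2}$ for all $k\ge1$. 2. $V_1$ does not vanish on $\mathbb S^1$, and for every $j\ge1$ each of the functions $V_{2j}$ and $V_{2j+1}$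 has exactly $2j$ zeros in $\mathbb S^1$, all of them simple. 3. For all integers $1\le m\le n$ and all real constants $a_m,\dots,a_n$ with $a_m a_n\neq0$, the function $Y=\sum_{j=m}^n a_jV_j$ (a) has at most as many zeros in $\mathbb S^1$, counted with multiplicities, as $V_n$; (b) changes sign at least as many times in $\mathbb S^1$ as $V_m$. Here the multiplicity of a zero is its order of vanishing, and the number of sign changes of a function on $\mathbb S^1$ is the number of points of $\mathbb S^1$ at which it has opposite strict signs immediately to the left and immediately to the right. -/

import Mathlib

open Real Set Filter Topology MeasureTheory
open scoped ContDiff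

namespace PeriodicSturmLiouville

noncomputable section

/-- `u` is a classical `2π`-periodic solution on `ℝ` of `-(K u')' + Q u = μ G u`
(the zero function is allowed here). -/
def IsSolution (K G Q : ℝ → ℝ) (μ : ℝ) (u : ℝ → ℝ) : Prop :=
  ContDiff ℝ 2 u ∧ Function.Periodic u (2 * π) ∧
    ∀ t, -deriv (fun s => K s * deriv u s) t + Q t * u t = μ * G t * u t

theorem differentiableAt_flux {K u : ℝ → ℝ} (hK : ContDiff ℝ ∞ K) (hu : ContDiff ℝ 2 u) (t : ℝ) :
    DifferentiableAt ℝ (fun s => K s * deriv u s) t := by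
  have h1 : DifferentiableAt ℝ K t := (hK.differentiable (by simp)) t
  have h2 : DifferentiableAt ℝ (deriv u) t := by
    have h : ContDiff ℝ (1 + 1) u := by simpa [one_add_one_eq_two] using hu
    exact ((contDiff_succ_iff_deriv.1 h).2.2.differentiable (by simp)) t
  exact h1.mul h2

/-- The space of `2π`-periodic solutions of `-(K u')' + Q u = μ G u`. The number `μ` is an
eigenvalue if this space is nonzero, and its dimension is the multiplicity of `μ`. -/
def eigenspace (K G Q : ℝ → ℝ) (hK : ContDiff ℝ ∞ K) (μ : ℝ) : Submodule ℝ (ℝ → ℝ) where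
  carrier := {u | IsSolution K G Q μ u}
  zero_mem' := by
    refine ⟨contDiff_const, fun t => rfl, fun t => ?_⟩
    have : deriv (0 : ℝ → ℝ) = 0 := by funext s; simp
    simp [this]
  add_mem' := by
    rintro u v ⟨hu, pu, eu⟩ ⟨hv, pv, ev⟩
    refine ⟨hu.add hv, pu.add pv, fun t => ?_⟩
    have h : (fun s => K s * deriv (u + v) s) =
        (fun s => K s * deriv u s) + fun s => K s * deriv v s := by
      funext s
      rw [deriv_add ((hu.differentiable (by simp)) s) ((hv.differentiable (by simp)) s)]
      simp [mul_add]
    rw [h, deriv_add (differentiableAt_flux hK hu t) (differentiableAt_flux hK hv t)]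
    simp only [Pi.add_apply]
    linear_combination eu t + ev t
  smul_mem' := by
    rintro c u ⟨hu, pu, eu⟩
    refine ⟨contDiff_const.smul hu, pu.smul c, fun t => ?_⟩
    have h : (fun s => K s * deriv (c • u) s) = c • fun s => K s * deriv u s := by
      funext s
      rw [deriv_const_smul c ((hu.differentiable (by simp)) s)]
      simp only [Pi.smul_apply, smul_eq_mul]
      ring
    rw [h, deriv_const_smul c (differentiableAt_flux hK hu t)]
    simp only [Pi.smul_apply, smul_eq_mul]
    linear_combination c * eu t

/-- The measure `G dt` on the circle `ℝ / 2πℤ`, represented on one period. -/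
def weightMeasure (G : ℝ → ℝ) : Measure ℝ :=
  (volume.restrict (Ioc 0 (2 * π))).withDensity fun t => ENNReal.ofReal (G t)

/-- `(V i)`, `i ≥ 1`, is an orthonormal (Hilbert) basis of `L²(ℝ / 2πℤ, G dt)` consisting of
eigenfunctions, and `(lam i)`, `i ≥ 1`, is the nondecreasing sequence of the associated
eigenvalues. The entries of index `0` play no role. -/
structure IsEigenbasis (K G Q : ℝ → ℝ) (lam : ℕ → ℝ) (V : ℕ → ℝ → ℝ) : Prop where
  solution : ∀ i, 1 ≤ i → IsSolution K G Q (lam i) (V i)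
  mono : ∀ i, 1 ≤ i → lam i ≤ lam (i + 1)
  basis : ∃ b : HilbertBasis ℕ ℝ (Lp ℝ 2 (weightMeasure G)),
    ∀ i, (b i : ℝ → ℝ) =ᵐ[weightMeasure G] V (i + 1)

/-- The zeros in the circle, represented by `[0, 2π)`. -/
def zeroSet (f : ℝ → ℝ) : Set ℝ := {t ∈ Ico 0 (2 * π) | f t = 0}

/-- The order of vanishing of a smooth function at `t`: the least `k` with `f⁽ᵏ⁾(t) ≠ 0`
(`⊤` if there is none, `0` if `f t ≠ 0`). -/
def vanishingOrder (f : ℝ → ℝ) (t : ℝ) : ℕ∞ :=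
  ⨅ (k : ℕ) (_ : iteratedDeriv k f t ≠ 0), (k : ℕ∞)

/-- The number of zeros in the circle, counted with multiplicities (the sum of the orders of
vanishing over `[0, 2π)`). -/
def zeroCount (f : ℝ → ℝ) : ℕ∞ :=
  ⨆ (s : Finset ℝ) (_ : (s : Set ℝ) ⊆ Ico 0 (2 * π)), ∑ t ∈ s, vanishingOrder f t

/-- `f` has opposite strict signs immediately to the left and to the right of `t`. -/
def ChangesSignAt (f : ℝ → ℝ) (t : ℝ) : Prop :=
  ((∀ᶠ x in 𝓝[<] t, f x < 0) ∧ ∀ᶠ x in 𝓝[>] t, 0 < f x) ∨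
    ((∀ᶠ x in 𝓝[<] t, 0 < f x) ∧ ∀ᶠ x in 𝓝[>] t, f x < 0)

/-- The number of sign changes of a `2π`-periodic function on the circle. -/
def signChangeCount (f : ℝ → ℝ) : ℕ∞ :=
  {t ∈ Ico 0 (2 * π) | ChangesSignAt f t}.encard

end

end PeriodicSturmLiouville

namespace PeriodicSturmLiouville

noncomputable section

/-! Write `L u = G⁻¹ (-(K u')' + Q u)`. The oscillation statements rest on two mechanisms, and
existence is a separate argument.

Liouville's factorization. If an eigenfunction `φ` for `λ₁` has no zeros, then `(L - λ₁) u = -(G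
φ)⁻¹ (K φ² (u/φ)')'`. Multiplication by a nonvanishing function keeps zeros and relative signs, and
by Rolle's theorem on the circle a derivative has at least as many zeros, with multiplicity, and at
least as many cyclic sign alternations. So `L - λ₁`, which multiplies the coefficient `a_j` by `λ_j
- λ₁`, loses neither (`zeroCount_linComb_le`). Iterated forward and normalized, a combination tends
to its component for the top eigenvalue `λ_n`; its zeros are simple, hence stable, which gives the
upper bound 3(a). Iterated backward, it tends to its component for `λ_m`, which gives 3(b). These
components have as many zeros as `V_n` and `V_m`, since the number of zeros is constant along paths
of nonzero solutions of one equation.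

Counting. Courant's nodal argument (`encard_zeroSet_le`) gives at most `m` zeros for `V_m`, and a
count on the circle is even, so `V_1` has none; this does not use the factorization. Conversely a
combination of `V_1, …, V_{n+1}` can be made to vanish at `n` given points, so by 3(a) `V_{n+1}` has
at least `n` zeros. Parity then fixes every count, and equal eigenvalues would force equal counts,
which makes the asserted inequalities strict.

Existence. A periodic `u` is encoded by `g` in `L²(dt/K)`, whose constant component is `u(0)` and
whose remaining part is `K u'`. The energy becomes a bounded coercive form on this Hilbert space,
the embedding into `L²(G dt)` is compact with dense range, and the spectral theorem yields weak
eigenfunctions; testing against indicator functions shows that they are classical. -/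

/-- Smooth `2π`-periodic coefficients with positive leading coefficient and weight. -/
structure IsRegular (K G Q : ℝ → ℝ) : Prop where
  smooth_K : ContDiff ℝ ∞ K
  smooth_G : ContDiff ℝ ∞ G
  smooth_Q : ContDiff ℝ ∞ Q
  periodic_K : Function.Periodic K (2 * π)
  periodic_G : Function.Periodic G (2 * π)
  periodic_Q : Function.Periodic Q (2 * π)
  pos_K : ∀ t, 0 < K t
  pos_G : ∀ t, 0 < G t

/-! ### Periodic bounds; uniqueness and smoothness of solutions -/

theorem periodic_deriv {f : ℝ → ℝ} {c : ℝ} (hf : Function.Periodic f c) :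
    Function.Periodic (deriv f) c := fun t => by
  rw [← deriv_comp_add_const]
  congr 1
  exact funext hf

theorem exists_abs_le_of_periodic {f : ℝ → ℝ} (hf : Continuous f)
    (hp : Function.Periodic f (2 * π)) : ∃ C, 0 < C ∧ ∀ t, |f t| ≤ C := by
  obtain ⟨C, hC⟩ := (hp.isBounded_of_continuous (by positivity) hf).exists_norm_le
  exact ⟨max C 1, by positivity, fun t => (hC _ ⟨t, rfl⟩).trans (le_max_left _ _)⟩

theorem exists_pos_le_of_periodic {f : ℝ → ℝ} (hf : Continuous f)
    (hp : Function.Periodic f (2 * π)) (hpos : ∀ t, 0 < f t) : ∃ c, 0 < c ∧ ∀ t, c ≤ f t := by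
  obtain ⟨C, hC, h⟩ := exists_abs_le_of_periodic (hf.inv₀ fun t => (hpos t).ne')
    (f := fun t => (f t)⁻¹) (fun t => by simp [hp t])
  refine ⟨C⁻¹, inv_pos.2 hC, fun t => ?_⟩
  have := (le_abs_self _).trans (h t)
  exact inv_le_of_inv_le₀ (hpos t) this

variable {K G Q : ℝ → ℝ} {μ : ℝ} {u v : ℝ → ℝ}

namespace IsSolution

theorem differentiable (hu : IsSolution K G Q μ u) : Differentiable ℝ u :=
  hu.1.differentiable (by simp)

theorem continuous (hu : IsSolution K G Q μ u) : Continuous u := hu.1.continuous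

theorem hasDerivAt (hu : IsSolution K G Q μ u) (t : ℝ) : HasDerivAt u (deriv u t) t :=
  (hu.differentiable t).hasDerivAt

theorem hasDerivAt_flux (h : IsRegular K G Q) (hu : IsSolution K G Q μ u) (t : ℝ) :
    HasDerivAt (fun s => K s * deriv u s) ((Q t - μ * G t) * u t) t := by
  have h1 := (differentiableAt_flux h.smooth_K hu.1 t).hasDerivAt
  have h2 := hu.2.2 t
  have h3 : deriv (fun s => K s * deriv u s) t = (Q t - μ * G t) * u t := by
    linear_combination -h2
  rwa [h3] at h1

theorem of_hasDerivAt_flux (hu : ContDiff ℝ 2 u) (hp : Function.Periodic u (2 * π))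
    (hd : ∀ t, HasDerivAt (fun s => K s * deriv u s) ((Q t - μ * G t) * u t) t) :
    IsSolution K G Q μ u :=
  ⟨hu, hp, fun t => by rw [(hd t).deriv]; ring⟩

/-- Uniqueness for the linear first order system satisfied by `(u, K u')`, whose coefficients are
bounded by periodicity. Working with the flux `K u'` avoids differentiating `K`. -/
theorem eq_zero (h : IsRegular K G Q) (hu : IsSolution K G Q μ u) {t₀ : ℝ} (h0 : u t₀ = 0)
    (h1 : deriv u t₀ = 0) : u = 0 := by
  obtain ⟨c, hc, hcK⟩ := exists_pos_le_of_periodic h.smooth_K.continuous h.periodic_K h.pos_K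
  obtain ⟨C, hC, hCQ⟩ := exists_abs_le_of_periodic (f := fun t => Q t - μ * G t)
    (h.smooth_Q.continuous.sub (continuous_const.mul h.smooth_G.continuous))
    (fun t => by simp [h.periodic_Q t, h.periodic_G t])
  have hM : 0 ≤ max c⁻¹ C := hC.le.trans (le_max_right _ _)
  let w : ℝ → ℝ × ℝ → ℝ × ℝ := fun t x => ((K t)⁻¹ * x.2, (Q t - μ * G t) * x.1)
  let f : ℝ → ℝ × ℝ := fun t => (u t, K t * deriv u t)
  have key : f = fun _ => 0 := by
    refine ODE_solution_unique_univ (v := w) (s := fun _ => univ) (t₀ := t₀)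
      (K := ⟨max c⁻¹ C, hM⟩) ?_ ?_ ?_ ?_
    · intro t
      refine LipschitzWith.lipschitzOnWith (LipschitzWith.of_dist_le_mul fun x y => ?_)
      simp only [w, Prod.dist_eq, Real.dist_eq, ← mul_sub, abs_mul]
      have h3 : |(K t)⁻¹| ≤ max c⁻¹ C := by
        rw [abs_of_pos (inv_pos.2 (h.pos_K t))]
        exact (inv_anti₀ hc (hcK t)).trans (le_max_left _ _)
      have h4 : |Q t - μ * G t| ≤ max c⁻¹ C := (hCQ t).trans (le_max_right _ _)
      refine max_le ?_ ?_
      · exact mul_le_mul h3 (le_max_right _ _) (abs_nonneg _) hM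
      · exact mul_le_mul h4 (le_max_left _ _) (abs_nonneg _) hM
    · intro t
      refine ⟨?_, mem_univ _⟩
      have h5 : (K t)⁻¹ * (K t * deriv u t) = deriv u t := by
        rw [inv_mul_cancel_left₀ (h.pos_K t).ne']
      have := (hu.hasDerivAt t).prodMk (hu.hasDerivAt_flux h t)
      simpa [w, f, h5] using this
    · intro t
      refine ⟨?_, mem_univ _⟩
      have : w t 0 = 0 := by simp [w]
      rw [this]
      exact hasDerivAt_const _ _
    · simp [f, h0, h1]
  funext t
  exact congrArg Prod.fst (congrFun key t)

theorem deriv_ne_zero (h : IsRegular K G Q) (hu : IsSolution K G Q μ u) (hne : u ≠ 0) {t : ℝ}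
    (ht : u t = 0) : deriv u t ≠ 0 := fun h1 => hne (hu.eq_zero h ht h1)

/-- Bootstrap: if `u` is `Cⁿ`, the equation makes the flux `K u'` of class `Cⁿ⁺¹`; division by `K`
makes `u'` of class `Cⁿ`. -/
theorem contDiff (h : IsRegular K G Q) (hu : IsSolution K G Q μ u) : ContDiff ℝ ∞ u := by
  have hfl : deriv (fun s => K s * deriv u s) = fun t => (Q t - μ * G t) * u t :=
    funext fun t => (hu.hasDerivAt_flux h t).deriv
  have hdu : deriv u = fun t => (K t)⁻¹ * (K t * deriv u t) := by
    funext t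
    rw [inv_mul_cancel_left₀ (h.pos_K t).ne']
  have key : ∀ n : ℕ, ContDiff ℝ n u := by
    intro n
    induction n with
    | zero => exact contDiff_zero.2 hu.continuous
    | succ n ih =>
      have h1 : ContDiff ℝ (n + 1) (fun s => K s * deriv u s) := by
        rw [contDiff_succ_iff_deriv]
        refine ⟨fun t => (hu.hasDerivAt_flux h t).differentiableAt, by simp, ?_⟩
        rw [hfl]
        exact ((h.smooth_Q.sub (contDiff_const.mul h.smooth_G)).of_le (by exact_mod_cast le_top)).mul ih
      push_cast
      rw [contDiff_succ_iff_deriv]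
      refine ⟨hu.differentiable, by simp, ?_⟩
      rw [hdu]
      exact ((h.smooth_K.inv fun t => (h.pos_K t).ne').of_le (by exact_mod_cast le_top)).mul
        (h1.of_le (by exact_mod_cast Nat.le_succ n))
  exact contDiff_infty.2 key

theorem sum_smul (h : IsRegular K G Q) {ι : Type*} (s : Finset ι) (V : ι → ℝ → ℝ) (c : ι → ℝ)
    (hV : ∀ i ∈ s, IsSolution K G Q μ (V i)) : IsSolution K G Q μ (∑ i ∈ s, c i • V i) :=
  (eigenspace K G Q h.smooth_K μ).sum_mem fun i hi =>
    (eigenspace K G Q h.smooth_K μ).smul_mem (c i) (hV i hi)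

end IsSolution

/-- By uniqueness, the Cauchy data `(u 0, u' 0)` determine a solution. -/
theorem rank_eigenspace_le_two (h : IsRegular K G Q) (μ : ℝ) :
    Module.rank ℝ (eigenspace K G Q h.smooth_K μ) ≤ 2 := by
  have hd : ∀ u : eigenspace K G Q h.smooth_K μ, DifferentiableAt ℝ (u : ℝ → ℝ) 0 :=
    fun u => IsSolution.differentiable u.2 0
  let φ : eigenspace K G Q h.smooth_K μ →ₗ[ℝ] (Fin 2 → ℝ) :=
    { toFun := fun u => ![(u : ℝ → ℝ) 0, deriv (u : ℝ → ℝ) 0]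
      map_add' := fun u v => by
        ext i
        fin_cases i
        · simp
        · simp [deriv_add (hd u) (hd v)]
      map_smul' := fun c u => by
        ext i
        fin_cases i
        · simp
        · simp [deriv_const_smul c (hd u)] }
  have hφ : Function.Injective φ := by
    rw [← LinearMap.ker_eq_bot, LinearMap.ker_eq_bot']
    intro u hu
    have h0 := congrFun hu 0
    have h1 := congrFun hu 1
    simp only [φ, LinearMap.coe_mk, AddHom.coe_mk] at h0 h1
    exact Subtype.ext (IsSolution.eq_zero h u.2 (by simpa using h0) (by simpa using h1))
  simpa using LinearMap.rank_le_of_injective φ hφ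

/-- Three solutions for the same eigenvalue are linearly dependent. -/
theorem exists_combination_eq_zero (h : IsRegular K G Q) {w : ℝ → ℝ} (hu : IsSolution K G Q μ u)
    (hv : IsSolution K G Q μ v) (hw : IsSolution K G Q μ w) :
    ∃ a b c : ℝ, (a ≠ 0 ∨ b ≠ 0 ∨ c ≠ 0) ∧ a • u + b • v + c • w = 0 := by
  let V : Fin 3 → eigenspace K G Q h.smooth_K μ := ![⟨u, hu⟩, ⟨v, hv⟩, ⟨w, hw⟩]
  have hV : ¬ LinearIndependent ℝ V := fun hl => by
    have := hl.cardinal_le_rank.trans (rank_eigenspace_le_two h μ)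
    simp only [Cardinal.mk_fin] at this
    exact absurd (Nat.cast_le.1 (this : ((3 : ℕ) : Cardinal) ≤ (2 : ℕ))) (by norm_num)
  rw [Fintype.not_linearIndependent_iff] at hV
  obtain ⟨g, hg, i, hi⟩ := hV
  refine ⟨g 0, g 1, g 2, ?_, ?_⟩
  · fin_cases i <;> simp_all
  · have := congrArg Subtype.val hg
    simpa [Fin.sum_univ_three, V] using this

/-! ### Orders of vanishing and the zero count -/

theorem natCast_le_vanishingOrder {f : ℝ → ℝ} {t : ℝ} {n : ℕ} :
    (n : ℕ∞) ≤ vanishingOrder f t ↔ ∀ k < n, iteratedDeriv k f t = 0 := by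
  simp only [vanishingOrder, le_iInf_iff, Nat.cast_le]
  exact ⟨fun h k hk => by_contra fun hne => hk.not_ge (h k hne),
    fun h k hk => not_lt.1 fun hlt => hk (h k hlt)⟩

theorem vanishingOrder_le {f : ℝ → ℝ} {t : ℝ} {k : ℕ} (h : iteratedDeriv k f t ≠ 0) :
    vanishingOrder f t ≤ k := iInf₂_le k h

theorem vanishingOrder_eq_zero {f : ℝ → ℝ} {t : ℝ} (h : f t ≠ 0) : vanishingOrder f t = 0 := by
  simpa using vanishingOrder_le (k := 0) (by simpa using h)

theorem vanishingOrder_le_one {f : ℝ → ℝ} {t : ℝ} (h : deriv f t ≠ 0) :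
    vanishingOrder f t ≤ 1 := by
  simpa using vanishingOrder_le (k := 1) (by simpa [iteratedDeriv_one] using h)

theorem one_le_vanishingOrder {f : ℝ → ℝ} {t : ℝ} (h : f t = 0) : 1 ≤ vanishingOrder f t := by
  have := (natCast_le_vanishingOrder (f := f) (t := t) (n := 1)).2 fun k hk => by
    obtain rfl : k = 0 := by omega
    simpa using h
  simpa using this

theorem vanishingOrder_le_deriv_add_one (f : ℝ → ℝ) (t : ℝ) :
    vanishingOrder f t ≤ vanishingOrder (deriv f) t + 1 := by
  refine ENat.forall_natCast_le_iff_le.1 fun n hn => ?_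
  rw [natCast_le_vanishingOrder] at hn
  cases n with
  | zero => simp
  | succ n =>
    push_cast
    gcongr
    refine natCast_le_vanishingOrder.2 fun k hk => ?_
    rw [← iteratedDeriv_succ']
    exact hn _ (by omega)

/-- Leibniz' rule. The inequality holds for every smooth factor; where the factor has an inverse, it
can be applied in both directions. -/
theorem vanishingOrder_le_mul {f g : ℝ → ℝ} (hf : ContDiff ℝ ∞ f) (hg : ContDiff ℝ ∞ g) (t : ℝ) :
    vanishingOrder f t ≤ vanishingOrder (fun s => g s * f s) t := by
  refine ENat.forall_natCast_le_iff_le.1 fun n hn => ?_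
  rw [natCast_le_vanishingOrder] at hn ⊢
  intro k hk
  have h := iteratedDeriv_mul (n := k) (x := t)
    ((hg.of_le (by exact_mod_cast le_top)).contDiffAt) ((hf.of_le (by exact_mod_cast le_top)).contDiffAt)
  change iteratedDeriv k (g * f) t = 0
  rw [h]
  refine Finset.sum_eq_zero fun i _ => ?_
  rw [hn (k - i) (by omega), mul_zero]

theorem periodic_vanishingOrder {f : ℝ → ℝ} {c : ℝ} (hf : Function.Periodic f c) :
    Function.Periodic (vanishingOrder f) c := fun t => by
  have : ∀ k, iteratedDeriv k f (t + c) = iteratedDeriv k f t := fun k => by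
    induction k generalizing f with
    | zero => simpa using hf t
    | succ k ih => rw [iteratedDeriv_succ']; exact ih (periodic_deriv hf)
  simp only [vanishingOrder, this]

theorem zeroCount_mono {f g : ℝ → ℝ} (h : ∀ t, vanishingOrder f t ≤ vanishingOrder g t) :
    zeroCount f ≤ zeroCount g :=
  iSup₂_mono fun _ _ => Finset.sum_le_sum fun t _ => h t

theorem zeroCount_le_mul {f g : ℝ → ℝ} (hf : ContDiff ℝ ∞ f) (hg : ContDiff ℝ ∞ g) :
    zeroCount f ≤ zeroCount (fun s => g s * f s) :=
  zeroCount_mono (vanishingOrder_le_mul hf hg)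

theorem toIcoMod_injOn (x y : ℝ) :
    InjOn (toIcoMod two_pi_pos x) (Ico y (y + 2 * π)) := by
  intro a ha b hb hab
  have h := (toIcoMod_eq_toIcoMod two_pi_pos).1 hab
  obtain ⟨n, hn⟩ := h
  have h1 : n < 1 := by
    by_contra! h1
    have : (1 : ℝ) ≤ n := by exact_mod_cast h1
    simp only [zsmul_eq_mul] at hn
    nlinarith [ha.1, ha.2, hb.1, hb.2, two_pi_pos]
  have h2 : -1 < n := by
    by_contra! h1
    have : (n : ℝ) ≤ -1 := by exact_mod_cast h1
    simp only [zsmul_eq_mul] at hn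
    nlinarith [ha.1, ha.2, hb.1, hb.2, two_pi_pos]
  obtain rfl : n = 0 := by omega
  simp at hn
  linarith

theorem map_toIcoMod {α : Type*} {f : ℝ → α} (hf : Function.Periodic f (2 * π)) (x t : ℝ) :
    f (toIcoMod two_pi_pos x t) = f t := by
  rw [toIcoMod]
  exact hf.sub_zsmul_eq _

theorem toIcoMod_mem_Ico_zero (t : ℝ) : toIcoMod two_pi_pos 0 t ∈ Ico 0 (2 * π) := by
  simpa using toIcoMod_mem_Ico two_pi_pos 0 t

/-- Rolle's theorem produces zeros in a period that starts at a zero of `f` and not at `0`; this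
lets any period window serve for counting. -/
theorem sum_vanishingOrder_le_zeroCount {f : ℝ → ℝ} (hf : Function.Periodic f (2 * π)) {x : ℝ}
    {s : Finset ℝ} (hs : (s : Set ℝ) ⊆ Ico x (x + 2 * π)) :
    ∑ t ∈ s, vanishingOrder f t ≤ zeroCount f := by
  have hinj : InjOn (toIcoMod two_pi_pos 0) (s : Set ℝ) := (toIcoMod_injOn 0 x).mono hs
  calc ∑ t ∈ s, vanishingOrder f t
      = ∑ t ∈ s, vanishingOrder f (toIcoMod two_pi_pos 0 t) :=
        Finset.sum_congr rfl fun t _ => (map_toIcoMod (periodic_vanishingOrder hf) 0 t).symm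
    _ = ∑ t ∈ s.image (toIcoMod two_pi_pos 0), vanishingOrder f t :=
        (Finset.sum_image hinj).symm
    _ ≤ zeroCount f := by
        refine le_iSup₂_of_le (s.image (toIcoMod two_pi_pos 0)) ?_ le_rfl
        intro t ht
        rw [Finset.mem_coe, Finset.mem_image] at ht
        obtain ⟨r, -, rfl⟩ := ht
        exact toIcoMod_mem_Ico_zero r

/-- Between `n + 1` zeros of `f` there are `n` further zeros of `deriv f`. -/
theorem exists_zeros_deriv {f : ℝ → ℝ} (hf : Differentiable ℝ f) (x : ℝ) (s : Finset ℝ)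
    (hx : f x = 0) (hs : ∀ t ∈ s, x < t ∧ f t = 0) (hne : s.Nonempty) :
    ∃ T : Finset ℝ, T.card = s.card ∧ (∀ t ∈ T, deriv f t = 0 ∧ x < t ∧ t ∉ s) ∧
      ∀ t ∈ T, t < s.max' hne := by
  induction s using Finset.induction_on_max with
  | empty => exact absurd hne (by simp)
  | insert a s ha ih =>
    have haf := hs a (Finset.mem_insert_self _ _)
    have has : a ∉ s := fun h => lt_irrefl _ (ha a h)
    have hmax : (insert a s).max' hne = a := by
      refine le_antisymm (Finset.max'_le _ _ _ fun y hy => ?_)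
        (Finset.le_max' _ _ (Finset.mem_insert_self _ _))
      rcases Finset.mem_insert.1 hy with rfl | hy
      · exact le_rfl
      · exact (ha y hy).le
    rw [hmax]
    rcases s.eq_empty_or_nonempty with rfl | hs'
    · obtain ⟨c, hc, hc0⟩ := exists_deriv_eq_zero haf.1 hf.continuous.continuousOn
        (hx.trans haf.2.symm)
      exact ⟨{c}, by simp, by simp [hc0, hc.1, hc.2.ne], by simp [hc.2]⟩
    · obtain ⟨T, hT, hT1, hT2⟩ := ih (fun t ht => hs t (Finset.mem_insert_of_mem ht)) hs'
      set b := s.max' hs' with hb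
      have hbs : b ∈ s := Finset.max'_mem _ _
      obtain ⟨c, hc, hc0⟩ := exists_deriv_eq_zero (ha b hbs) hf.continuous.continuousOn
        ((hs b (Finset.mem_insert_of_mem hbs)).2.trans haf.2.symm)
      have hcT : c ∉ T := fun h => (hc.1.trans (hT2 c h)).false
      have hcs : c ∉ s := fun h => (hc.1.trans_le (Finset.le_max' _ _ h)).false
      refine ⟨insert c T, by simp [hcT, has, hT], fun t ht => ?_, fun t ht => ?_⟩
      · rcases Finset.mem_insert.1 ht with rfl | ht
        · exact ⟨hc0, ((hs b (Finset.mem_insert_of_mem hbs)).1).trans hc.1, by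
            simp [hcs, hc.2.ne]⟩
        · obtain ⟨h1, h2, h3⟩ := hT1 t ht
          exact ⟨h1, h2, by simp [h3, ((hT2 t ht).trans (ha b hbs)).ne]⟩
      · rcases Finset.mem_insert.1 ht with rfl | ht
        · exact hc.2
        · exact (hT2 t ht).trans (ha b hbs)

/-- Rolle's theorem on the circle, with multiplicities. -/
theorem zeroCount_le_deriv {f : ℝ → ℝ} (hf : Differentiable ℝ f)
    (hp : Function.Periodic f (2 * π)) : zeroCount f ≤ zeroCount (deriv f) := by
  refine iSup₂_le fun s₀ hs₀ => ?_
  set s := s₀.filter fun t => f t = 0 with hs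
  have hsum : ∑ t ∈ s₀, vanishingOrder f t = ∑ t ∈ s, vanishingOrder f t := by
    rw [hs, Finset.sum_filter_of_ne]
    intro t _ ht
    by_contra h
    exact ht (vanishingOrder_eq_zero h)
  rw [hsum]
  rcases s.eq_empty_or_nonempty with h | hne
  · simp [h]
  set x := s.min' hne with hx
  have hxs : x ∈ s := Finset.min'_mem _ _
  have hsI : ∀ t ∈ s, t ∈ Ico 0 (2 * π) ∧ f t = 0 := fun t ht =>
    ⟨hs₀ (Finset.mem_of_mem_filter t ht), (Finset.mem_filter.1 ht).2⟩
  have hlt : ∀ t ∈ s, t < x + 2 * π := fun t ht => by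
    linarith [(hsI t ht).1.2, (hsI x hxs).1.1]
  -- Starting at the smallest zero `x`, its translate `x + 2π` closes the circle: the `s.card` zeros
  -- to the right of `x` bound `s.card` gaps.
  set S := insert (x + 2 * π) (s.erase x) with hS
  have hxS : x + 2 * π ∉ s.erase x := fun h => (hlt _ (Finset.mem_of_mem_erase h)).false
  have hSne : S.Nonempty := Finset.insert_nonempty _ _
  have hcard : S.card = s.card := by
    rw [hS, Finset.card_insert_of_notMem hxS, Finset.card_erase_of_mem hxs]
    have := Finset.card_pos.2 hne
    omega
  have hmax : S.max' hSne ≤ x + 2 * π := Finset.max'_le _ _ _ fun y hy => by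
    rcases Finset.mem_insert.1 hy with rfl | hy
    · exact le_rfl
    · exact (hlt y (Finset.mem_of_mem_erase hy)).le
  obtain ⟨T, hT, hT1, hT2⟩ := exists_zeros_deriv hf x S (hsI x hxs).2 (fun t ht => by
    rcases Finset.mem_insert.1 ht with rfl | ht
    · exact ⟨by linarith [two_pi_pos], (hp x).trans (hsI x hxs).2⟩
    · refine ⟨lt_of_le_of_ne (Finset.min'_le _ _ (Finset.mem_of_mem_erase ht)) ?_,
        (hsI t (Finset.mem_of_mem_erase ht)).2⟩
      exact (Finset.ne_of_mem_erase ht).symm) hSne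
  have hdisj : Disjoint s T := by
    rw [Finset.disjoint_right]
    intro t ht hts
    obtain ⟨-, h2, h3⟩ := hT1 t ht
    exact h3 (Finset.mem_insert_of_mem (Finset.mem_erase.2 ⟨h2.ne', hts⟩))
  -- Each zero of `f` loses at most one order under differentiation, and each gap contributes one
  -- new zero of the derivative, so the losses are compensated.
  calc ∑ t ∈ s, vanishingOrder f t
      ≤ ∑ t ∈ s, (vanishingOrder (deriv f) t + 1) :=
        Finset.sum_le_sum fun t _ => vanishingOrder_le_deriv_add_one f t
    _ = ∑ t ∈ s, vanishingOrder (deriv f) t + T.card := by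
        rw [Finset.sum_add_distrib, hT, hcard]
        simp
    _ ≤ ∑ t ∈ s, vanishingOrder (deriv f) t + ∑ t ∈ T, vanishingOrder (deriv f) t := by
        gcongr
        rw [Finset.card_eq_sum_ones]
        push_cast
        exact Finset.sum_le_sum fun t ht => one_le_vanishingOrder (hT1 t ht).1
    _ = ∑ t ∈ s ∪ T, vanishingOrder (deriv f) t := (Finset.sum_union hdisj).symm
    _ ≤ zeroCount (deriv f) := by
        refine sum_vanishingOrder_le_zeroCount (periodic_deriv hp) (x := x) fun t ht => ?_
        rcases Finset.mem_union.1 (Finset.mem_coe.1 ht) with ht | ht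
        · exact ⟨Finset.min'_le _ _ ht, hlt t ht⟩
        · exact ⟨(hT1 t ht).2.1.le, (hT2 t ht).trans_le hmax⟩

theorem zeroSet_encard_le_zeroCount (f : ℝ → ℝ) : (zeroSet f).encard ≤ zeroCount f := by
  refine ENat.forall_natCast_le_iff_le.1 fun n hn => ?_
  obtain ⟨s, hs, hsn⟩ := Set.exists_subset_encard_eq hn
  obtain ⟨s, rfl⟩ := (Set.finite_of_encard_eq_coe hsn).exists_finset_coe
  rw [Set.encard_coe_eq_coe_finsetCard, Nat.cast_inj] at hsn
  refine le_iSup₂_of_le s (fun t ht => (hs ht).1) ?_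
  rw [← hsn, Finset.card_eq_sum_ones]
  push_cast
  exact Finset.sum_le_sum fun t ht => one_le_vanishingOrder (hs ht).2

/-- All zeros are simple. -/
def HasSimpleZeros (f : ℝ → ℝ) : Prop := ∀ t, f t = 0 → deriv f t ≠ 0

theorem zeroCount_eq_encard {f : ℝ → ℝ} (hf : HasSimpleZeros f) :
    zeroCount f = (zeroSet f).encard := by
  refine le_antisymm (iSup₂_le fun s hs => ?_) (zeroSet_encard_le_zeroCount f)
  calc ∑ t ∈ s, vanishingOrder f t = ∑ t ∈ s.filter fun t => f t = 0, vanishingOrder f t := by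
        rw [Finset.sum_filter_of_ne]
        intro t _ ht
        by_contra h
        exact ht (vanishingOrder_eq_zero h)
    _ ≤ ∑ t ∈ s.filter fun t => f t = 0, 1 := Finset.sum_le_sum fun t ht =>
        vanishingOrder_le_one (hf t (Finset.mem_filter.1 ht).2)
    _ = ((s.filter fun t => f t = 0 : Finset ℝ) : Set ℝ).encard := by
        rw [Set.encard_coe_eq_coe_finsetCard, Finset.card_eq_sum_ones]
        push_cast
        rfl
    _ ≤ (zeroSet f).encard := Set.encard_le_encard fun t ht => by
        rw [Finset.mem_coe, Finset.mem_filter] at ht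
        exact ⟨hs ht.1, ht.2⟩

/-- Infinitely many zeros would accumulate at a point of the closed period, and the accumulation
point would be a zero with vanishing derivative. -/
theorem HasSimpleZeros.finite_zeroSet {f : ℝ → ℝ} (hf : HasSimpleZeros f)
    (hd : Differentiable ℝ f) : (zeroSet f).Finite := by
  by_contra hinf
  obtain ⟨x, -, hx⟩ := Set.Infinite.exists_accPt_of_subset_isCompact (K := Icc 0 (2 * π)) hinf
    isCompact_Icc fun t ht => Ico_subset_Icc_self ht.1
  rw [accPt_iff_frequently_nhdsNE] at hx
  have hx0 : f x = 0 := by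
    by_contra h
    have h1 : ∀ᶠ y in 𝓝[≠] x, f y ≠ 0 :=
      (hd.continuous.continuousAt.eventually_ne h).filter_mono nhdsWithin_le_nhds
    obtain ⟨y, hy, hy'⟩ := (hx.and_eventually h1).exists
    exact hy' hy.2
  obtain ⟨y, hy, hy'⟩ :=
    (hx.and_eventually ((hd x).hasDerivAt.eventually_ne (c := 0) (hf x hx0))).exists
  exact hy' hy.2

/-! ### Sign alternation on the circle -/

/-- There are `n` cyclically ordered points of the circle at which `f` has alternating signs. -/
def Alternates (f : ℝ → ℝ) (n : ℕ) : Prop :=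
  ∃ t : ℕ → ℝ, (∀ i < n, t i < t (i + 1)) ∧ t n = t 0 + 2 * π ∧
    ∀ i < n, f (t i) * f (t (i + 1)) < 0

theorem mul_neg_of_mul_pos {a b x y : ℝ} (ha : 0 < a * x) (hb : 0 < b * y) (h : x * y < 0) :
    a * b < 0 := by
  by_contra! hab
  nlinarith [mul_pos ha hb, mul_nonneg hab (neg_nonneg.2 h.le)]

theorem Alternates.mul {f g : ℝ → ℝ} {n : ℕ} (hf : Alternates f n)
    (hg : ∀ s t, 0 < g s * g t) : Alternates (fun t => g t * f t) n := by
  obtain ⟨t, h1, h2, h3⟩ := hf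
  refine ⟨t, h1, h2, fun i hi => ?_⟩
  have := mul_neg_of_pos_of_neg (hg (t i) (t (i + 1))) (h3 i hi)
  linarith

/-- By the mean value theorem the slope between two consecutive points has the sign of the second
value, so the intermediate points again alternate. -/
theorem Alternates.deriv {f : ℝ → ℝ} {n : ℕ} (hf : Alternates f n) (hd : Differentiable ℝ f)
    (hp : Function.Periodic f (2 * π)) : Alternates (deriv f) n := by
  obtain ⟨t, h1, h2, h3⟩ := hf
  have key : ∀ i, ∃ c, i < n → c ∈ Ioo (t i) (t (i + 1)) ∧ 0 < _root_.deriv f c * f (t (i + 1)) := by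
    intro i
    by_cases hi : i < n
    · obtain ⟨c, hc, hc'⟩ := exists_deriv_eq_slope f (h1 i hi) hd.continuous.continuousOn
        hd.differentiableOn
      refine ⟨c, fun _ => ⟨hc, ?_⟩⟩
      rw [hc', div_mul_eq_mul_div]
      refine div_pos ?_ (sub_pos.2 (h1 i hi))
      nlinarith [h3 i hi, mul_self_nonneg (f (t (i + 1)))]
    · exact ⟨0, fun h => absurd h hi⟩
  choose c hc using key
  rcases Nat.eq_zero_or_pos n with rfl | hn
  · simp [two_pi_pos.ne'] at h2
  have hper := periodic_deriv hp
  -- The last point is the translate of the first intermediate point, as the cyclic condition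
  -- demands.
  refine ⟨fun i => if i < n then c i else c 0 + 2 * π, fun i hi => ?_, by simp [hn],
    fun i hi => ?_⟩
  · rcases lt_or_ge (i + 1) n with h | h
    · simp only [hi, h, if_true]
      exact (hc i hi).1.2.trans (hc _ h).1.1
    · obtain rfl : i + 1 = n := by omega
      simp only [hi, lt_irrefl, if_true, if_false]
      linarith [(hc i hi).1.2, (hc 0 hn).1.1]
  · rcases lt_or_ge (i + 1) n with h | h
    · simp only [hi, h, if_true]
      exact mul_neg_of_mul_pos (hc i hi).2 (hc _ h).2 (h3 _ h)
    · obtain rfl : i + 1 = n := by omega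
      simp only [hi, lt_irrefl, if_true, if_false, hper (c 0)]
      refine mul_neg_of_mul_pos (hc i hi).2 (hc 0 hn).2 ?_
      rw [h2, hp]
      exact h3 0 hn

theorem Alternates.eventually {α : Type*} {l : Filter α} {F : α → ℝ → ℝ} {f : ℝ → ℝ} {n : ℕ}
    (hf : Alternates f n) (hF : ∀ t, Tendsto (fun a => F a t) l (𝓝 (f t))) :
    ∀ᶠ a in l, Alternates (F a) n := by
  obtain ⟨t, h1, h2, h3⟩ := hf
  have : ∀ᶠ a in l, ∀ i ∈ Finset.range n, F a (t i) * F a (t (i + 1)) < 0 := by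
    rw [Filter.eventually_all_finset]
    intro i hi
    exact ((hF _).mul (hF _)).eventually_lt_const (h3 i (Finset.mem_range.1 hi))
  filter_upwards [this] with a ha
  exact ⟨t, h1, h2, fun i hi => ha i (Finset.mem_range.2 hi)⟩

/-- After `n` sign reversals periodicity returns to the initial value. The even clause is a weak
inequality so that the induction starts without knowing `f (t 0) ≠ 0`. -/
theorem Alternates.even {f : ℝ → ℝ} {n : ℕ} (hf : Alternates f n)
    (hp : Function.Periodic f (2 * π)) : Even n := by
  obtain ⟨t, -, h2, h3⟩ := hf
  have key : ∀ i ≤ n, (Even i → 0 ≤ f (t 0) * f (t i)) ∧ (¬ Even i → f (t 0) * f (t i) < 0) := by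
    intro i
    induction i with
    | zero => intro _; simp [mul_self_nonneg]
    | succ i ih =>
      intro hi
      obtain ⟨ha, hb⟩ := ih (by omega)
      have h := h3 i hi
      have h0 : f (t 0) ≠ 0 := fun h0 => by
        have := h3 0 (by omega)
        simp [h0] at this
      have h4 : 0 < f (t 0) * f (t 0) := mul_self_pos.2 h0
      rw [Nat.even_add_one, not_not]
      constructor
      · intro he
        by_contra! hneg
        nlinarith [hb he, mul_pos_of_neg_of_neg (hb he) hneg]
      · intro he
        by_contra! hneg
        nlinarith [mul_nonneg (ha he) hneg]
  by_contra h
  have := (key n le_rfl).2 h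
  rw [h2, hp] at this
  exact absurd this (mul_self_nonneg _).not_gt

theorem ChangesSignAt.neg {f : ℝ → ℝ} {t : ℝ} (h : ChangesSignAt (fun x => -f x) t) :
    ChangesSignAt f t := by
  simpa [ChangesSignAt, or_comm] using h

/-- The last point `p` approached by negative values works: `f` is nonnegative to its right, and
finiteness of the zeros isolates `p`, so both one-sided signs are strict. -/
theorem exists_changesSignAt_of_neg_of_pos {f : ℝ → ℝ} (hf : Continuous f) {a b : ℝ} (hab : a < b)
    (ha : f a < 0) (hb : 0 < f b) (hfin : {t ∈ Icc a b | f t = 0}.Finite) :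
    ∃ p ∈ Ioo a b, ChangesSignAt f p := by
  set A := {x ∈ Icc a b | f x < 0} with hA
  have haA : a ∈ A := ⟨left_mem_Icc.2 hab.le, ha⟩
  have hbdd : BddAbove A := ⟨b, fun x hx => hx.1.2⟩
  set p := sSup A with hp
  have hap : a ≤ p := le_csSup hbdd haA
  have hpb : p ≤ b := csSup_le ⟨a, haA⟩ fun x hx => hx.1.2
  have hfp : f p ≤ 0 := by
    have h1 : p ∈ closure A := csSup_mem_closure ⟨a, haA⟩ hbdd
    have h2 : closure A ⊆ {x | f x ≤ 0} :=
      closure_minimal (fun x hx => hx.2.le) (isClosed_le hf continuous_const)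
    exact h2 h1
  have hpb' : p < b := lt_of_le_of_ne hpb fun h => by rw [h] at hfp; linarith
  have hright : ∀ x ∈ Ioc p b, 0 ≤ f x := fun x hx => by
    by_contra! h
    exact (le_csSup hbdd (show x ∈ A from ⟨⟨hap.trans hx.1.le, hx.2⟩, h⟩)).not_gt hx.1
  have hfp0 : f p = 0 := by
    refine le_antisymm hfp ?_
    have h1 : Tendsto f (𝓝[>] p) (𝓝 (f p)) := hf.continuousAt.tendsto.mono_left nhdsWithin_le_nhds
    refine ge_of_tendsto h1 ?_
    filter_upwards [Ioc_mem_nhdsGT hpb'] with x hx using hright x hx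
  have hap' : a < p := lt_of_le_of_ne hap fun h => by rw [← h] at hfp0; linarith
  have hZ : ∀ᶠ x in 𝓝[≠] p, f x ≠ 0 := by
    have h1 : ({t ∈ Icc a b | f t = 0} \ {p})ᶜ ∈ 𝓝 p :=
      (hfin.subset sdiff_subset).isClosed.isOpen_compl.mem_nhds (by simp)
    filter_upwards [nhdsWithin_le_nhds h1, self_mem_nhdsWithin,
      nhdsWithin_le_nhds (Icc_mem_nhds hap' hpb')] with x hx hxp hxI h0
    exact hx ⟨⟨hxI, h0⟩, hxp⟩
  refine ⟨p, ⟨hap', hpb'⟩, Or.inl ⟨?_, ?_⟩⟩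
  · have h1 : ∀ᶠ x in 𝓝[<] p, f x ≠ 0 :=
      hZ.filter_mono (nhdsWithin_mono _ fun x hx => ne_of_lt hx)
    obtain ⟨l, hl, hl'⟩ := (mem_nhdsLT_iff_exists_Ioo_subset' hap').1 h1
    have hmax : max l a < p := max_lt hl hap'
    filter_upwards [Ioo_mem_nhdsLT hmax] with x hx
    -- A point `y` between `x` and `p` with `f y < 0`; a nonnegative value at `x` would create a
    -- zero in the punctured neighbourhood that has none.
    obtain ⟨y, hy, hxy⟩ := exists_lt_of_lt_csSup ⟨a, haA⟩ (hx.2 : x < sSup A)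
    have hyp : y < p := lt_of_le_of_ne (le_csSup hbdd hy) fun h => by
      rw [h] at hy
      exact hy.2.ne hfp0
    by_contra! hfx
    obtain ⟨z, hz, hz0⟩ := intermediate_value_Icc' hxy.le hf.continuousOn
      (show (0 : ℝ) ∈ Icc (f y) (f x) from ⟨hy.2.le, hfx⟩)
    exact hl' (show z ∈ Ioo l p from ⟨((le_max_left _ _).trans_lt hx.1).trans_le hz.1,
      hz.2.trans_lt hyp⟩) hz0
  · have h1 : ∀ᶠ x in 𝓝[>] p, f x ≠ 0 :=
      hZ.filter_mono (nhdsWithin_mono _ fun x hx => ne_of_gt hx)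
    filter_upwards [h1, Ioc_mem_nhdsGT hpb'] with x hx hxI
    exact lt_of_le_of_ne (hright x hxI) hx.symm

theorem exists_changesSignAt {f : ℝ → ℝ} (hf : Continuous f) {a b : ℝ} (hab : a < b)
    (h : f a * f b < 0) (hfin : {t ∈ Icc a b | f t = 0}.Finite) :
    ∃ p ∈ Ioo a b, ChangesSignAt f p := by
  rcases mul_neg_iff.1 h with ⟨h1, h2⟩ | ⟨h1, h2⟩
  · obtain ⟨p, hp, hp'⟩ := exists_changesSignAt_of_neg_of_pos (f := fun x => -f x) hf.neg hab
      (by simpa using h1) (by simpa using h2) (by simpa using hfin)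
    exact ⟨p, hp, hp'.neg⟩
  · exact exists_changesSignAt_of_neg_of_pos hf hab h1 h2 hfin

theorem changesSignAt_add_period {f : ℝ → ℝ} {c : ℝ} (hf : Function.Periodic f c) (t : ℝ) :
    ChangesSignAt f (t + c) ↔ ChangesSignAt f t := by
  have h1 : ∀ P : ℝ → Prop, (∀ᶠ x in 𝓝[<] (t + c), P (f x)) ↔ ∀ᶠ x in 𝓝[<] t, P (f x) := by
    intro P
    have : Filter.map (fun x => x + c) (𝓝[<] t) = 𝓝[<] (t + c) := by
      simp
    rw [← this, eventually_map]
    simp only [hf _]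
  have h2 : ∀ P : ℝ → Prop, (∀ᶠ x in 𝓝[>] (t + c), P (f x)) ↔ ∀ᶠ x in 𝓝[>] t, P (f x) := by
    intro P
    have : Filter.map (fun x => x + c) (𝓝[>] t) = 𝓝[>] (t + c) := by
      simp
    rw [← this, eventually_map]
    simp only [hf _]
  simp only [ChangesSignAt, h1 (· < 0), h1 (0 < ·), h2 (· < 0), h2 (0 < ·)]

/-- Each of the `n` gaps contains a sign change. The gaps lie disjointly in one period, so these
points stay distinct modulo `2π`. -/
theorem Alternates.le_signChangeCount {f : ℝ → ℝ} {n : ℕ} (h : Alternates f n) (hf : Continuous f)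
    (hp : Function.Periodic f (2 * π)) (hfin : (zeroSet f).Finite) : n ≤ signChangeCount f := by
  obtain ⟨t, h1, h2, h3⟩ := h
  have hmono : ∀ j ≤ n, ∀ i ≤ j, t i ≤ t j := by
    intro j
    induction j with
    | zero => intro _ i hi; rw [Nat.le_zero.1 hi]
    | succ j ih =>
      intro hj i hi
      rcases Nat.lt_or_ge i (j + 1) with h | h
      · exact (ih (by omega) i (by omega)).trans (h1 j hj).le
      · rw [show i = j + 1 by omega]
  have hfin' : ∀ i < n, {x ∈ Icc (t i) (t (i + 1)) | f x = 0}.Finite := by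
    intro i hi
    have hsub : {x ∈ Ico (t 0) (t 0 + 2 * π) | f x = 0}.Finite := by
      refine Set.Finite.of_finite_image (f := toIcoMod two_pi_pos 0) (hfin.subset ?_)
        ((toIcoMod_injOn 0 (t 0)).mono fun x hx => hx.1)
      rintro - ⟨x, hx, rfl⟩
      exact ⟨toIcoMod_mem_Ico_zero x, by rw [map_toIcoMod hp]; exact hx.2⟩
    refine (hsub.union (finite_singleton (t 0 + 2 * π))).subset ?_
    rintro x ⟨hx, hx0⟩
    have hx1 : x ≤ t 0 + 2 * π := by rw [← h2]; exact hx.2.trans (hmono n le_rfl _ hi)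
    rcases hx1.lt_or_eq with h | h
    · exact Or.inl ⟨⟨(hmono i hi.le 0 (Nat.zero_le _)).trans hx.1, h⟩, hx0⟩
    · exact Or.inr h
  have key : ∀ i, ∃ p, i < n → p ∈ Ioo (t i) (t (i + 1)) ∧ ChangesSignAt f p := by
    intro i
    by_cases hi : i < n
    · obtain ⟨p, hp⟩ := exists_changesSignAt hf (h1 i hi) (h3 i hi) (hfin' i hi)
      exact ⟨p, fun _ => hp⟩
    · exact ⟨0, fun h => absurd h hi⟩
  choose p hpp using key
  have hlt : ∀ i j, i < j → j < n → p i < p j := fun i j hij hj =>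
    ((hpp i (hij.trans hj)).1.2.trans_le (hmono j hj.le (i + 1) hij)).trans (hpp j hj).1.1
  have hinj : InjOn p (Finset.range n : Set ℕ) := by
    intro i hi j hj hij
    simp only [Finset.coe_range, mem_Iio] at hi hj
    rcases lt_trichotomy i j with h | h | h
    · exact absurd hij (hlt i j h hj).ne
    · exact h
    · exact absurd hij (hlt j i h hi).ne'
  have hinj2 : InjOn (fun i => toIcoMod two_pi_pos 0 (p i)) (Finset.range n : Set ℕ) := by
    refine (toIcoMod_injOn 0 (t 0)).comp hinj fun i hi => ?_
    simp only [Finset.coe_range, mem_Iio] at hi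
    refine ⟨(hmono i hi.le 0 (Nat.zero_le _)).trans (hpp i hi).1.1.le, ?_⟩
    rw [← h2]
    exact (hpp i hi).1.2.trans_le (hmono n le_rfl _ hi)
  calc (n : ℕ∞) = (((Finset.range n).image fun i => toIcoMod two_pi_pos 0 (p i) :
        Finset ℝ) : Set ℝ).encard := by
        rw [Set.encard_coe_eq_coe_finsetCard, Finset.card_image_of_injOn hinj2, Finset.card_range]
    _ ≤ signChangeCount f := Set.encard_le_encard fun x hx => by
        simp only [Finset.coe_image, mem_image, Finset.coe_range, mem_Iio] at hx
        obtain ⟨i, hi, rfl⟩ := hx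
        refine ⟨toIcoMod_mem_Ico_zero _, ?_⟩
        have : Function.Periodic (fun t => ChangesSignAt f t) (2 * π) := fun t =>
          propext (changesSignAt_add_period hp t)
        exact (map_toIcoMod this 0 (p i)).symm ▸ (hpp i hi).2

theorem signChangeCount_le_encard {f : ℝ → ℝ} (hf : Continuous f) :
    signChangeCount f ≤ (zeroSet f).encard := by
  refine Set.encard_le_encard fun t ht => ⟨ht.1, ?_⟩
  have h1 : Tendsto f (𝓝[<] t) (𝓝 (f t)) := hf.continuousAt.tendsto.mono_left nhdsWithin_le_nhds
  have h2 : Tendsto f (𝓝[>] t) (𝓝 (f t)) := hf.continuousAt.tendsto.mono_left nhdsWithin_le_nhds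
  rcases ht.2 with ⟨h3, h4⟩ | ⟨h3, h4⟩
  · exact le_antisymm (le_of_tendsto h1 (h3.mono fun x hx => hx.le))
      (ge_of_tendsto h2 (h4.mono fun x hx => hx.le))
  · exact le_antisymm (le_of_tendsto h2 (h4.mono fun x hx => hx.le))
      (ge_of_tendsto h1 (h3.mono fun x hx => hx.le))

theorem eventually_mul_deriv {f : ℝ → ℝ} {a d : ℝ} (hd : HasDerivAt f d a) (h0 : f a = 0)
    (hne : d ≠ 0) : (∀ᶠ x in 𝓝[>] a, 0 < f x * d) ∧ ∀ᶠ x in 𝓝[<] a, f x * d < 0 := by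
  have h1 : ∀ᶠ x in 𝓝[≠] a, 0 < slope f a x * d :=
    ((hasDerivAt_iff_tendsto_slope.1 hd).mul_const d).eventually_const_lt (mul_self_pos.2 hne)
  have h2 : ∀ x, x ≠ a → f x * d = (x - a) * (slope f a x * d) := fun x hx => by
    rw [slope_def_field, h0]
    field_simp [sub_ne_zero.2 hx]
    ring
  constructor
  · filter_upwards [h1.filter_mono (nhdsWithin_mono _ fun x hx => ne_of_gt hx),
      self_mem_nhdsWithin] with x hx hxa
    rw [h2 x (ne_of_gt hxa)]
    exact mul_pos (sub_pos.2 hxa) hx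
  · filter_upwards [h1.filter_mono (nhdsWithin_mono _ fun x hx => ne_of_lt hx),
      self_mem_nhdsWithin] with x hx hxa
    rw [h2 x (ne_of_lt hxa)]
    exact mul_neg_of_neg_of_pos (sub_neg.2 hxa) hx

theorem mul_pos_of_no_zero {f : ℝ → ℝ} (hf : Continuous f) {a b x y : ℝ}
    (hno : ∀ z ∈ Ioo a b, f z ≠ 0) (hx : x ∈ Ioo a b) (hy : y ∈ Ioo a b) : 0 < f x * f y := by
  by_contra! h
  obtain ⟨z, hz, hz0⟩ : ∃ z ∈ uIcc x y, f z = 0 := by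
    have := intermediate_value_uIcc (hf.continuousOn (s := uIcc x y))
    refine this ?_
    rw [mem_uIcc]
    rcases mul_nonpos_iff.1 h with h | h
    · exact Or.inr ⟨h.2, h.1⟩
    · exact Or.inl ⟨h.1, h.2⟩
  exact hno z (ordConnected_Ioo.uIcc_subset hx hy hz) hz0

/-- The derivatives at two consecutive simple zeros have opposite signs. -/
theorem deriv_mul_deriv_neg {f : ℝ → ℝ} (hf : Differentiable ℝ f) (hs : HasSimpleZeros f) {a b : ℝ}
    (hab : a < b) (ha : f a = 0) (hb : f b = 0) (hno : ∀ z ∈ Ioo a b, f z ≠ 0) :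
    deriv f a * deriv f b < 0 := by
  obtain ⟨x, hx, hxI⟩ := ((eventually_mul_deriv (hf a).hasDerivAt ha (hs a ha)).1.and
    (Ioo_mem_nhdsGT hab)).exists
  obtain ⟨y, hy, hyI⟩ := ((eventually_mul_deriv (hf b).hasDerivAt hb (hs b hb)).2.and
    (Ioo_mem_nhdsLT hab)).exists
  have hxy := mul_pos_of_no_zero hf.continuous hno hxI hyI
  refine mul_neg_of_mul_pos (x := f x) (y := -f y) ?_ ?_ ?_ <;> linarith

/-- At consecutive simple zeros the derivatives have opposite signs, and just to the right of a zero
`f` has the sign of its derivative. Shifting all zeros by one small `δ` gives the alternating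
points. -/
theorem HasSimpleZeros.alternates {f : ℝ → ℝ} (hs : HasSimpleZeros f) (hf : Differentiable ℝ f)
    (hp : Function.Periodic f (2 * π)) {n : ℕ} (hn : (zeroSet f).encard = n) (hpos : 0 < n) :
    Alternates f n := by
  obtain ⟨S, hS⟩ := (Set.finite_of_encard_eq_coe hn).exists_finset_coe
  have hcard : S.card = n := by
    rw [← hS, Set.encard_coe_eq_coe_finsetCard] at hn
    exact_mod_cast hn
  have hmemS : ∀ x, x ∈ S ↔ x ∈ Ico 0 (2 * π) ∧ f x = 0 := fun x => by
    rw [← Finset.mem_coe, hS]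
    rfl
  set z := S.orderEmbOfFin hcard with hz
  have hzS : ∀ i, z i ∈ S := fun i => S.orderEmbOfFin_mem hcard i
  have hz' : ∀ x ∈ S, ∃ i, z i = x := fun x hx => by
    have : x ∈ Set.range z := by rw [hz, Finset.range_orderEmbOfFin]; exact hx
    exact this
  -- The zeros in increasing order, closed up by the translate of the first one.
  let Z : ℕ → ℝ := fun i => if h : i < n then z ⟨i, h⟩ else z ⟨0, hpos⟩ + 2 * π
  have hZlt : ∀ i (h : i < n), Z i = z ⟨i, h⟩ := fun i h => by simp [Z, h]
  have hZn : Z n = z ⟨0, hpos⟩ + 2 * π := by simp [Z]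
  have hZ0 : ∀ i ≤ n, f (Z i) = 0 := fun i hi => by
    rcases hi.lt_or_eq with h | rfl
    · rw [hZlt i h]
      exact ((hmemS _).1 (hzS _)).2
    · rw [hZn, hp]
      exact ((hmemS _).1 (hzS _)).2
  have hstep : ∀ i < n, Z i < Z (i + 1) ∧ ∀ y ∈ Ioo (Z i) (Z (i + 1)), f y ≠ 0 := by
    intro i hi
    rcases lt_or_ge (i + 1) n with h | h
    · rw [hZlt i hi, hZlt _ h]
      refine ⟨z.strictMono (by simp), fun y hy hy0 => ?_⟩
      obtain ⟨j, rfl⟩ := hz' y ((hmemS y).2 ⟨⟨((hmemS _).1 (hzS _)).1.1.trans hy.1.le,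
        hy.2.trans ((hmemS _).1 (hzS _)).1.2⟩, hy0⟩)
      have h1 := z.lt_iff_lt.1 hy.1
      have h2 := z.lt_iff_lt.1 hy.2
      simp only [Fin.lt_def] at h1 h2
      omega
    · obtain rfl : i + 1 = n := by omega
      rw [hZlt i hi, hZn]
      have hb := ((hmemS _).1 (hzS ⟨i, hi⟩)).1
      have hb0 := ((hmemS _).1 (hzS ⟨0, hpos⟩)).1
      refine ⟨by linarith [hb.2, hb0.1], fun y hy hy0 => ?_⟩
      rcases lt_or_ge y (2 * π) with hy2 | hy2
      · obtain ⟨j, rfl⟩ := hz' y ((hmemS y).2 ⟨⟨hb.1.trans hy.1.le, hy2⟩, hy0⟩)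
        have h1 := z.lt_iff_lt.1 hy.1
        simp only [Fin.lt_def] at h1
        omega
      · obtain ⟨j, hj⟩ := hz' (y - 2 * π) ((hmemS _).2
          ⟨⟨by linarith, by linarith [hy.2, hb0.2]⟩, by rw [hp.sub_eq]; exact hy0⟩)
        have h1 : z j < z ⟨0, hpos⟩ := by rw [hj]; linarith [hy.2]
        have := z.lt_iff_lt.1 h1
        simp at this
  have hδ : ∀ᶠ δ in 𝓝[>] (0 : ℝ), ∀ i ∈ Finset.range (n + 1),
      0 < f (Z i + δ) * _root_.deriv f (Z i) := by
    rw [Filter.eventually_all_finset]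
    intro i hi
    have h0 := hZ0 i (by simpa [Nat.lt_succ_iff] using hi)
    have h1 := (eventually_mul_deriv (hf (Z i)).hasDerivAt h0 (hs _ h0)).1
    have h2 : Tendsto (fun δ => Z i + δ) (𝓝[>] 0) (𝓝[>] (Z i)) := by
      refine tendsto_nhdsWithin_iff.2 ⟨?_, ?_⟩
      · have : Tendsto (fun δ => Z i + δ) (𝓝 0) (𝓝 (Z i + 0)) := tendsto_const_nhds.add tendsto_id
        rw [add_zero] at this
        exact this.mono_left nhdsWithin_le_nhds
      · filter_upwards [self_mem_nhdsWithin] with δ hδ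
        simpa using hδ
    exact h2.eventually h1
  obtain ⟨δ, hδ⟩ := hδ.exists
  refine ⟨fun i => Z i + δ, fun i hi => by linarith [(hstep i hi).1], ?_, fun i hi => ?_⟩
  · simp only [hZn, hZlt 0 hpos]
    ring
  · exact mul_neg_of_mul_pos (hδ i (by simp; omega)) (hδ (i + 1) (by simp; omega))
      (deriv_mul_deriv_neg hf hs (hstep i hi).1 (hZ0 i hi.le) (hZ0 (i + 1) hi) (hstep i hi).2)

/-! ### Stability of simple zeros -/

/-- A function that is `C¹`-close to `f` has each zero near a zero of `f`, where both slopes are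
bounded away from zero. Its zeros are thus simple and separated, and they inject into those of `f`.
-/
theorem exists_stability {f : ℝ → ℝ} (hs : HasSimpleZeros f) (hf2 : ContDiff ℝ ∞ f)
    (hp : Function.Periodic f (2 * π)) :
    ∃ ε, 0 < ε ∧ ∀ g : ℝ → ℝ, Differentiable ℝ g → Function.Periodic g (2 * π) →
      (∀ t, |f t - g t| < ε) → (∀ t, |deriv f t - deriv g t| < ε) →
      HasSimpleZeros g ∧ (zeroSet g).encard ≤ (zeroSet f).encard := by
  have hf : Differentiable ℝ f := hf2.differentiable (by simp)
  have hf1 : ContDiff ℝ ∞ (deriv f) := (contDiff_infty_iff_deriv.1 hf2).2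
  have hf' : Continuous (deriv f) := hf1.continuous
  obtain ⟨m, hm, hmf⟩ := exists_pos_le_of_periodic (f := fun t => max |f t| |deriv f t|)
    (hf.continuous.abs.max hf'.abs) (fun t => by simp [hp t, periodic_deriv hp t]) fun t => by
      by_cases h : f t = 0
      · exact lt_max_of_lt_right (abs_pos.2 (hs t h))
      · exact lt_max_of_lt_left (abs_pos.2 h)
  have huc : UniformContinuous (deriv f) := by
    obtain ⟨C, hC, hb⟩ := exists_abs_le_of_periodic (hf1.continuous_deriv (by simp))
      (periodic_deriv (periodic_deriv hp))
    exact (lipschitzWith_of_nnnorm_deriv_le (C := ⟨C, hC.le⟩) (hf1.differentiable (by simp))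
      fun t => hb t).uniformContinuous
  obtain ⟨δ, hδ, hδf⟩ := Metric.uniformContinuous_iff.1 huc (m / 2) (by positivity)
  simp only [Real.dist_eq] at hδf
  -- With `m ≤ max |f| |f'|`, closeness `m / 4` forces `|f'| ≥ m` at a zero of `g` and keeps `g'`
  -- nonzero within `δ`. The bound `δ * m / 4` is what a slope at least `m / 2` overcomes over the
  -- distance `δ / 2`.
  refine ⟨min (m / 4) (δ * m / 4), by positivity, fun g hg hgp h0 h1 => ?_⟩
  have h0a : ∀ t, |f t - g t| < m / 4 := fun t => (h0 t).trans_le (min_le_left _ _)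
  have h0b : ∀ t, |f t - g t| < δ * m / 4 := fun t => (h0 t).trans_le (min_le_right _ _)
  have h1a : ∀ t, |deriv f t - deriv g t| < m / 4 := fun t => (h1 t).trans_le (min_le_left _ _)
  have hbig : ∀ t, g t = 0 → m ≤ |deriv f t| := fun t ht => by
    have h2 := h0a t
    rw [ht, sub_zero] at h2
    rcases le_max_iff.1 (hmf t) with h | h
    · linarith
    · exact h
  have hder : ∀ t, g t = 0 → ∀ s, |s - t| < δ → deriv g s ≠ 0 := fun t ht s hst h => by
    have h2 := hδf hst
    have h3 := h1a s
    rw [h, sub_zero] at h3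
    have h4 := abs_sub_abs_le_abs_sub (deriv f t) (deriv f s)
    rw [abs_sub_comm] at h4
    linarith [hbig t ht]
  have hsg : HasSimpleZeros g := fun t ht => hder t ht t (by simpa using hδ)
  have hsep : ∀ t₁ t₂, g t₁ = 0 → g t₂ = 0 → t₁ < t₂ → δ ≤ t₂ - t₁ := fun t₁ t₂ ht₁ ht₂ hlt => by
    by_contra! h
    obtain ⟨c, hc, hc0⟩ := exists_deriv_eq_zero hlt hg.continuous.continuousOn (ht₁.trans ht₂.symm)
    refine hder t₁ ht₁ c ?_ hc0
    rw [abs_of_pos (sub_pos.2 hc.1)]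
    linarith [hc.2]
  have hslope : ∀ t, g t = 0 → ∀ c, |c - t| < δ → δ * m / 4 * |deriv f t| ≤
      δ / 2 * (deriv f c * deriv f t) := fun t ht c hc => by
    have h2 := hδf hc
    have h3 : deriv f t * deriv f t - deriv f c * deriv f t ≤ m / 2 * |deriv f t| := by
      rw [← sub_mul]
      refine (le_abs_self _).trans ?_
      rw [abs_mul, abs_sub_comm]
      exact mul_le_mul_of_nonneg_right h2.le (abs_nonneg _)
    have h4 := mul_le_mul_of_nonneg_right (hbig t ht) (abs_nonneg (deriv f t))
    rw [abs_mul_abs_self] at h4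
    nlinarith
  -- Near a zero `t` of `g`, the product `f * f' t` changes from negative to positive on `[t - δ /
  -- 2, t + δ / 2]`.
  have hnear : ∀ t, ∃ p, g t = 0 → f p = 0 ∧ |p - t| < δ / 2 := fun t => by
    by_cases ht : g t = 0
    swap
    · exact ⟨0, fun h => absurd h ht⟩
    have hft : |f t * deriv f t| < δ * m / 4 * |deriv f t| := by
      have h2 := h0b t
      rw [ht, sub_zero] at h2
      rw [abs_mul]
      exact mul_lt_mul_of_pos_right h2 (hm.trans_le (hbig t ht))
    rw [abs_lt] at hft
    obtain ⟨c, hc, hc'⟩ := exists_deriv_eq_slope f (show t < t + δ / 2 by linarith)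
      hf.continuous.continuousOn hf.differentiableOn
    obtain ⟨d, hd, hd'⟩ := exists_deriv_eq_slope f (show t - δ / 2 < t by linarith)
      hf.continuous.continuousOn hf.differentiableOn
    have h5 := hslope t ht c (by rw [abs_of_pos (sub_pos.2 hc.1)]; linarith [hc.2])
    have h6 := hslope t ht d (by rw [abs_of_neg (sub_neg.2 hd.2)]; linarith [hd.1])
    rw [eq_div_iff (by linarith), add_sub_cancel_left] at hc'
    rw [eq_div_iff (by linarith), sub_sub_cancel] at hd'
    have h7 : 0 < f (t + δ / 2) * deriv f t := by
      have : f (t + δ / 2) = f t + deriv f c * (δ / 2) := by linarith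
      rw [this]
      linarith
    have h8 : f (t - δ / 2) * deriv f t < 0 := by
      have : f (t - δ / 2) = f t - deriv f d * (δ / 2) := by linarith
      rw [this]
      linarith
    obtain ⟨p, hpI, hp0⟩ := intermediate_value_Ioo (show t - δ / 2 ≤ t + δ / 2 by linarith)
      (hf.continuous.mul_const (deriv f t)).continuousOn (mem_Ioo.2 ⟨h8, h7⟩)
    refine ⟨p, fun _ => ⟨?_, by rw [abs_lt]; constructor <;> linarith [hpI.1, hpI.2]⟩⟩
    refine (mul_eq_zero.1 hp0).resolve_right fun h => ?_
    rw [h] at h7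
    simp at h7
  choose p hpz using hnear
  refine ⟨hsg, Set.encard_le_encard_of_injOn (f := fun t => toIcoMod two_pi_pos 0 (p t)) ?_ ?_⟩
  · exact fun t ht => ⟨toIcoMod_mem_Ico_zero _, by rw [map_toIcoMod hp]; exact (hpz t ht.2).1⟩
  -- Zeros of `g` attached to the same zero of `f` modulo `2π` are less than `δ` apart up to a
  -- period, hence equal by separation.
  · intro t₁ ht₁ t₂ ht₂ h
    obtain ⟨n, hn⟩ := (toIcoMod_eq_toIcoMod two_pi_pos).1 h
    have hg2 : g (t₂ - n • (2 * π)) = 0 := by rw [hgp.sub_zsmul_eq]; exact ht₂.2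
    have habs : |t₁ - (t₂ - n • (2 * π))| < δ := by
      have h1 := (hpz t₁ ht₁.2).2
      have h2 := (hpz t₂ ht₂.2).2
      rw [abs_lt] at *
      constructor <;> linarith
    have heq : t₁ = t₂ - n • (2 * π) := by
      rcases lt_trichotomy t₁ (t₂ - n • (2 * π)) with hlt | heq | hlt
      · have := hsep _ _ ht₁.2 hg2 hlt
        rw [abs_sub_comm, abs_of_pos (by linarith)] at habs
        linarith
      · exact heq
      · have := hsep _ _ hg2 ht₁.2 hlt
        rw [abs_of_pos (by linarith)] at habs
        linarith
    refine toIcoMod_injOn 0 0 (by simpa using ht₁.1) (by simpa using ht₂.1) ?_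
    rw [heq, toIcoMod_sub_zsmul]

/-! ### Linear combinations and their zeros under perturbation of the coefficients -/

/-- The linear combination `∑ j ∈ s, a j * V j`. -/
def linComb (s : Finset ℕ) (V : ℕ → ℝ → ℝ) (a : ℕ → ℝ) : ℝ → ℝ := fun t => ∑ j ∈ s, a j * V j t

theorem linComb_eq_sum_smul (s : Finset ℕ) (V : ℕ → ℝ → ℝ) (a : ℕ → ℝ) :
    linComb s V a = ∑ j ∈ s, a j • V j := by
  funext t
  simp [linComb]

theorem tendstoUniformly_linComb {α : Type*} {l : Filter α} {s : Finset ℕ} {V : ℕ → ℝ → ℝ}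
    {c : α → ℕ → ℝ} {c₀ : ℕ → ℝ} (hV : ∀ j ∈ s, ∃ C, ∀ t, |V j t| ≤ C)
    (hc : ∀ j ∈ s, Tendsto (fun a => c a j) l (𝓝 (c₀ j))) :
    TendstoUniformly (fun a => linComb s V (c a)) (linComb s V c₀) l := by
  choose! C hC using hV
  have hlim : Tendsto (fun a => ∑ j ∈ s, |c₀ j - c a j| * C j) l (𝓝 0) := by
    have : Tendsto (fun a => ∑ j ∈ s, |c₀ j - c a j| * C j) l
        (𝓝 (∑ j ∈ s, |c₀ j - c₀ j| * C j)) :=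
      tendsto_finsetSum _ fun j hj => ((tendsto_const_nhds.sub (hc j hj)).abs.mul_const _)
    simpa using this
  rw [Metric.tendstoUniformly_iff]
  intro ε hε
  filter_upwards [hlim.eventually_lt_const hε] with a ha t
  refine lt_of_le_of_lt ?_ ha
  rw [Real.dist_eq, linComb, linComb, ← Finset.sum_sub_distrib]
  refine (Finset.abs_sum_le_sum_abs _ _).trans (Finset.sum_le_sum fun j hj => ?_)
  rw [← sub_mul, abs_mul]
  exact mul_le_mul_of_nonneg_left (hC j hj t) (abs_nonneg _)

theorem contDiff_linComb {s : Finset ℕ} {V : ℕ → ℝ → ℝ} 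
    (hV : ∀ j ∈ s, ContDiff ℝ ∞ (V j)) (a : ℕ → ℝ) : ContDiff ℝ ∞ (linComb s V a) :=
  ContDiff.sum fun j hj => contDiff_const.mul (hV j hj)

theorem deriv_linComb {s : Finset ℕ} {V : ℕ → ℝ → ℝ} 
    (hV : ∀ j ∈ s, ContDiff ℝ ∞ (V j)) (a : ℕ → ℝ) :
    deriv (linComb s V a) = linComb s (fun j => deriv (V j)) a := by
  funext t
  have : HasDerivAt (fun t => ∑ j ∈ s, a j * V j t) (∑ j ∈ s, a j * deriv (V j) t) t :=
    HasDerivAt.fun_sum fun j hj =>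
      (((hV j hj).differentiable (by simp)) t).hasDerivAt.const_mul (a j)
  exact this.deriv

theorem periodic_linComb {s : Finset ℕ} {V : ℕ → ℝ → ℝ} 
    (hp : ∀ j ∈ s, Function.Periodic (V j) (2 * π)) (a : ℕ → ℝ) : Function.Periodic (linComb s V a) (2 * π) := fun t =>
  Finset.sum_congr rfl fun j hj => by rw [hp j hj t]

/-- Convergence of the coefficients is `C¹` convergence of the combinations. Stability bounds the
number of zeros from above; the alternation of the limit persists and bounds it from below. -/
theorem eventually_zeroSet_encard_eq {s : Finset ℕ} {V : ℕ → ℝ → ℝ} 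
    (hV : ∀ j ∈ s, ContDiff ℝ ∞ (V j))
    (hp : ∀ j ∈ s, Function.Periodic (V j) (2 * π))
    {α : Type*} {l : Filter α} {c : α → ℕ → ℝ} {c₀ : ℕ → ℝ}
    (hs : HasSimpleZeros (linComb s V c₀))
    (hc : ∀ j ∈ s, Tendsto (fun a => c a j) l (𝓝 (c₀ j))) :
    ∀ᶠ a in l, HasSimpleZeros (linComb s V (c a)) ∧
      (zeroSet (linComb s V (c a))).encard = (zeroSet (linComb s V c₀)).encard := by
  have hdiff : ∀ a, Differentiable ℝ (linComb s V a) := fun a =>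
    (contDiff_linComb hV a).differentiable (by simp)
  have hper := periodic_linComb hp
  have hb0 : ∀ j ∈ s, ∃ C, ∀ t, |V j t| ≤ C := fun j hj =>
    let ⟨C, _, h⟩ := exists_abs_le_of_periodic (hV j hj).continuous (hp j hj)
    ⟨C, h⟩
  have hb1 : ∀ j ∈ s, ∃ C, ∀ t, |deriv (V j) t| ≤ C := fun j hj =>
    let ⟨C, _, h⟩ := exists_abs_le_of_periodic ((hV j hj).continuous_deriv (by simp))
      (periodic_deriv (hp j hj))
    ⟨C, h⟩
  obtain ⟨ε, hε, hstab⟩ := exists_stability hs (contDiff_linComb hV c₀) (hper c₀)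
  obtain ⟨n, hn⟩ := ENat.ne_top_iff_exists.1
    (Set.encard_ne_top_iff.2 (hs.finite_zeroSet (hdiff c₀)))
  have hu0 := tendstoUniformly_linComb hb0 hc
  have hu1 := tendstoUniformly_linComb hb1 hc
  -- The case `n = 0` is separate because `Alternates` never holds for `0` points: it would require
  -- `t 0 = t 0 + 2π`.
  have halt : ∀ᶠ a in l, n = 0 ∨ Alternates (linComb s V (c a)) n := by
    rcases Nat.eq_zero_or_pos n with h | h
    · exact Eventually.of_forall fun _ => Or.inl h
    · exact ((hs.alternates (hdiff c₀) (hper c₀) hn.symm h).eventually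
        fun t => hu0.tendsto_at t).mono fun _ => Or.inr
  filter_upwards [Metric.tendstoUniformly_iff.1 hu0 ε hε, Metric.tendstoUniformly_iff.1 hu1 ε hε,
    halt] with a h0 h1 h2
  obtain ⟨hsa, hle⟩ := hstab _ (hdiff (c a)) (hper (c a)) (fun t => by simpa [Real.dist_eq] using h0 t)
    (fun t => by
      rw [deriv_linComb hV, deriv_linComb hV]
      simpa [Real.dist_eq] using h1 t)
  refine ⟨hsa, le_antisymm hle ?_⟩
  rw [← hn]
  rcases h2 with rfl | h2
  · simp
  · exact (h2.le_signChangeCount (hdiff _).continuous (hper _)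
      (hsa.finite_zeroSet (hdiff _))).trans (signChangeCount_le_encard (hdiff _).continuous)

/-- The number of zeros is constant along a path of functions with simple zeros. -/
theorem zeroSet_encard_eq_of_path {s : Finset ℕ} {V : ℕ → ℝ → ℝ} 
    (hV : ∀ j ∈ s, ContDiff ℝ ∞ (V j))
    (hp : ∀ j ∈ s, Function.Periodic (V j) (2 * π))
    {c : ℝ → ℕ → ℝ} (hc : ∀ j ∈ s, Continuous fun x => c x j)
    (hs : ∀ x, HasSimpleZeros (linComb s V (c x))) (x y : ℝ) :
    (zeroSet (linComb s V (c x))).encard = (zeroSet (linComb s V (c y))).encard := by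
  have : IsLocallyConstant fun x => (zeroSet (linComb s V (c x))).encard := by
    rw [IsLocallyConstant.iff_eventually_eq]
    intro x
    exact (eventually_zeroSet_encard_eq hV hp (hs x) fun j hj => (hc j hj).continuousAt).mono
      fun y hy => hy.2
  exact this.apply_eq_of_preconnectedSpace x y

/-! ### Liouville's factorization -/

section Liouville

variable {φ g : ℝ → ℝ} {lam₁ : ℝ}

theorem mul_pos_of_ne_zero {f : ℝ → ℝ} (hf : Continuous f) (hne : ∀ t, f t ≠ 0) (s t : ℝ) :
    0 < f s * f t :=
  mul_pos_of_no_zero hf (a := min s t - 1) (b := max s t + 1) (fun z _ => hne z)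
    ⟨by linarith [min_le_left s t], by linarith [le_max_left s t]⟩
    ⟨by linarith [min_le_right s t], by linarith [le_max_right s t]⟩

/-- If `φ` is a nonvanishing solution for `lam₁` and `G g = -(K u')' + Q u - lam₁ G u`, then
`G φ g = -(K φ² (u / φ)')'`. -/
theorem hasDerivAt_mul_deriv_div (h : IsRegular K G Q) (hφ : IsSolution K G Q lam₁ φ)
    (hne : ∀ t, φ t ≠ 0) (hu : ContDiff ℝ ∞ u)
    (hg : ∀ t, HasDerivAt (fun s => K s * deriv u s) ((Q t - lam₁ * G t) * u t - G t * g t) t)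
    (t : ℝ) :
    HasDerivAt (fun t => (K t * φ t ^ 2) * deriv (fun s => (φ s)⁻¹ * u s) t)
      (-(G t * φ t) * g t) t := by
  have hq : (fun t => (K t * φ t ^ 2) * deriv (fun s => (φ s)⁻¹ * u s) t) =
      fun t => (K t * deriv u t) * φ t - u t * (K t * deriv φ t) := by
    funext t
    have h1 : HasDerivAt (fun s => (φ s)⁻¹ * u s)
        (-deriv φ t / φ t ^ 2 * u t + (φ t)⁻¹ * deriv u t) t :=
      ((hφ.hasDerivAt t).fun_inv (hne t)).mul ((hu.differentiable (by simp)) t).hasDerivAt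
    rw [h1.deriv]
    field_simp [hne t]
    ring
  rw [hq]
  have h2 := ((hg t).mul (hφ.hasDerivAt t)).sub
    (((hu.differentiable (by simp)) t).hasDerivAt.mul (hφ.hasDerivAt_flux h t))
  exact h2.congr_deriv (by ring)

/-- Follow `u`, `w = u / φ`, `w'`, `q = K φ² w'`, `q'`, `g`. Every arrow is a multiplication by a
nonvanishing function or a derivative, and neither loses zeros or alternations. -/
theorem zeroCount_le_of_liouville (h : IsRegular K G Q) (hφ : IsSolution K G Q lam₁ φ)
    (hne : ∀ t, φ t ≠ 0) (hu : ContDiff ℝ ∞ u) (hp : Function.Periodic u (2 * π))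
    (hg : ∀ t, HasDerivAt (fun s => K s * deriv u s) ((Q t - lam₁ * G t) * u t - G t * g t) t) :
    zeroCount u ≤ zeroCount g ∧ ∀ n, Alternates u n → Alternates g n := by
  have hφs := hφ.contDiff h
  have hφi : ContDiff ℝ ∞ fun t => (φ t)⁻¹ := hφs.inv hne
  set w : ℝ → ℝ := fun s => (φ s)⁻¹ * u s with hw
  have hws : ContDiff ℝ ∞ w := hφi.mul hu
  have hwp : Function.Periodic w (2 * π) := fun t => by simp [hw, hp t, hφ.2.1 t]
  have hws' : ContDiff ℝ ∞ (deriv w) := (contDiff_infty_iff_deriv.1 hws).2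
  set q : ℝ → ℝ := fun t => (K t * φ t ^ 2) * deriv w t with hq
  have hqs : ContDiff ℝ ∞ q := (h.smooth_K.mul (hφs.pow 2)).mul hws'
  have hqp : Function.Periodic q (2 * π) := fun t => by
    simp [hq, h.periodic_K t, hφ.2.1 t, periodic_deriv hwp t]
  have hqs' : ContDiff ℝ ∞ (deriv q) := (contDiff_infty_iff_deriv.1 hqs).2
  have hq' : ∀ t, deriv q t = -(G t * φ t) * g t := fun t =>
    (hasDerivAt_mul_deriv_div h hφ hne hu hg t).deriv
  have hGφ : ∀ t, -(G t * φ t) ≠ 0 := fun t => neg_ne_zero.2 (mul_ne_zero (h.pos_G t).ne' (hne t))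
  have hi : ContDiff ℝ ∞ fun t => (-(G t * φ t))⁻¹ := ((h.smooth_G.mul hφs).neg).inv hGφ
  have hgq : (fun t => (-(G t * φ t))⁻¹ * deriv q t) = g := by
    funext t
    rw [hq', inv_mul_cancel_left₀ (hGφ t)]
  constructor
  · calc zeroCount u ≤ zeroCount w := zeroCount_le_mul hu hφi
      _ ≤ zeroCount (deriv w) := zeroCount_le_deriv (hws.differentiable (by simp)) hwp
      _ ≤ zeroCount q := zeroCount_le_mul hws' (h.smooth_K.mul (hφs.pow 2))
      _ ≤ zeroCount (deriv q) := zeroCount_le_deriv (hqs.differentiable (by simp)) hqp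
      _ ≤ zeroCount g := by
        rw [← hgq]
        exact zeroCount_le_mul hqs' hi
  · intro n hn
    have h1 : Alternates w n := hn.mul (mul_pos_of_ne_zero hφi.continuous fun t =>
      inv_ne_zero (hne t))
    have h2 : Alternates q n := (h1.deriv (hws.differentiable (by simp)) hwp).mul
      (mul_pos_of_ne_zero (h.smooth_K.mul (hφs.pow 2)).continuous fun t =>
        mul_ne_zero (h.pos_K t).ne' (pow_ne_zero 2 (hne t)))
    rw [← hgq]
    exact (h2.deriv (hqs.differentiable (by simp)) hqp).mul
      (mul_pos_of_ne_zero hi.continuous fun t => inv_ne_zero (hGφ t))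

/-- Passing from `∑ a j V j` to `∑ a j (lam j - lam₁) ^ k V j` neither decreases the number of
zeros nor destroys sign alternations. -/
theorem zeroCount_linComb_le (h : IsRegular K G Q) (hφ : IsSolution K G Q lam₁ φ)
    (hne : ∀ t, φ t ≠ 0) {s : Finset ℕ} {V : ℕ → ℝ → ℝ} {lam : ℕ → ℝ}
    (hV : ∀ j ∈ s, IsSolution K G Q (lam j) (V j)) (a : ℕ → ℝ) (k : ℕ) :
    zeroCount (linComb s V a) ≤ zeroCount (linComb s V fun j => a j * (lam j - lam₁) ^ k) ∧
      ∀ n, Alternates (linComb s V a) n →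
        Alternates (linComb s V fun j => a j * (lam j - lam₁) ^ k) n := by
  induction k with
  | zero => simp
  | succ k ih =>
    set b : ℕ → ℝ := fun j => a j * (lam j - lam₁) ^ k with hb
    have hs : ∀ j ∈ s, ContDiff ℝ ∞ (V j) := fun j hj => (hV j hj).contDiff h
    -- One application of `L - lam₁` multiplies the `j`-th coefficient by `lam j - lam₁`.
    have key := zeroCount_le_of_liouville h hφ hne (u := linComb s V b)
      (g := linComb s V fun j => a j * (lam j - lam₁) ^ (k + 1)) (contDiff_linComb hs b)
      (periodic_linComb (fun j hj => (hV j hj).2.1) b) fun t => by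
        have h1 : (fun r => K r * deriv (linComb s V b) r) =
            fun r => ∑ j ∈ s, b j * (K r * deriv (V j) r) := by
          funext r
          rw [deriv_linComb hs, linComb, Finset.mul_sum]
          exact Finset.sum_congr rfl fun j _ => by ring
        rw [h1]
        have h2 : HasDerivAt (fun r => ∑ j ∈ s, b j * (K r * deriv (V j) r))
            (∑ j ∈ s, b j * ((Q t - lam j * G t) * V j t)) t :=
          HasDerivAt.fun_sum fun j hj => ((hV j hj).hasDerivAt_flux h t).const_mul (b j)
        convert h2 using 1
        simp only [linComb, Finset.mul_sum, ← Finset.sum_sub_distrib]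
        refine Finset.sum_congr rfl fun j _ => ?_
        simp only [hb]
        ring
    exact ⟨ih.1.trans key.1, fun n hn => key.2 n (ih.2 n hn)⟩

theorem linComb_const_mul (s : Finset ℕ) (V : ℕ → ℝ → ℝ) (a : ℕ → ℝ) (c : ℝ) :
    (linComb s V fun j => c * a j) = fun t => c * linComb s V a t := by
  funext t
  simp only [linComb, Finset.mul_sum, mul_assoc]

theorem zeroCount_linComb_le_const_mul {s : Finset ℕ} {V : ℕ → ℝ → ℝ}
    (hV : ∀ j ∈ s, ContDiff ℝ ∞ (V j)) (a : ℕ → ℝ) (c : ℝ) :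
    zeroCount (linComb s V a) ≤ zeroCount (linComb s V fun j => c * a j) := by
  rw [linComb_const_mul]
  exact zeroCount_le_mul (contDiff_linComb hV a) contDiff_const

theorem Alternates.linComb_const_mul {s : Finset ℕ} {V : ℕ → ℝ → ℝ} {a : ℕ → ℝ} {n : ℕ}
    (h : Alternates (linComb s V a) n) {c : ℝ} (hc : c ≠ 0) :
    Alternates (linComb s V fun j => c * a j) n := by
  rw [PeriodicSturmLiouville.linComb_const_mul]
  exact h.mul fun _ _ => mul_self_pos.2 hc

end Liouville

/-! ### The weighted `L²` space -/

/-- The inner product of `L²(G dt)` on one period. -/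
def wInner (G f g : ℝ → ℝ) : ℝ := ∫ t in 0..2 * π, G t * (f t * g t)

theorem ae_weightMeasure_iff (hG : Continuous G) (hpos : ∀ t, 0 < G t) {p : ℝ → Prop} :
    (∀ᵐ t ∂weightMeasure G, p t) ↔ ∀ᵐ t ∂volume.restrict (Ioc 0 (2 * π)), p t := by
  rw [weightMeasure, ae_withDensity_iff hG.measurable.ennreal_ofReal]
  simp [hpos]

theorem isFiniteMeasure_weightMeasure (hG : Continuous G) : IsFiniteMeasure (weightMeasure G) :=
  isFiniteMeasure_withDensity_ofReal
    ((intervalIntegrable_iff_integrableOn_Ioc_of_le two_pi_pos.le).1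
      (hG.intervalIntegrable 0 (2 * π))).2

theorem integral_weightMeasure (hG : Continuous G) (hpos : ∀ t, 0 < G t) (f : ℝ → ℝ) :
    ∫ t, f t ∂weightMeasure G = ∫ t in 0..2 * π, G t * f t := by
  rw [weightMeasure, integral_withDensity_eq_integral_toReal_smul hG.measurable.ennreal_ofReal
    (Eventually.of_forall fun _ => ENNReal.ofReal_lt_top),
    intervalIntegral.integral_of_le two_pi_pos.le]
  refine integral_congr_ae (Eventually.of_forall fun t => ?_)
  simp [ENNReal.toReal_ofReal (hpos t).le]

theorem inner_eq_wInner (hG : Continuous G) (hpos : ∀ t, 0 < G t)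
    {F F' : Lp ℝ 2 (weightMeasure G)} {f f' : ℝ → ℝ} (hF : F =ᵐ[weightMeasure G] f)
    (hF' : F' =ᵐ[weightMeasure G] f') : inner ℝ F F' = wInner G f f' := by
  rw [L2.inner_def, wInner, ← integral_weightMeasure hG hpos fun t => f t * f' t]
  refine integral_congr_ae ?_
  filter_upwards [hF, hF'] with t h1 h2
  rw [h1, h2]
  simp [mul_comm]

theorem memLp_weightMeasure (hG : Continuous G) {f : ℝ → ℝ} (hf : Measurable f) {C : ℝ}
    (hC : ∀ t, |f t| ≤ C) : MemLp f 2 (weightMeasure G) :=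
  have := isFiniteMeasure_weightMeasure hG
  MemLp.of_bound hf.aestronglyMeasurable C (Eventually.of_forall hC)

theorem eqOn_of_ae_eq_weightMeasure (hG : Continuous G) (hpos : ∀ t, 0 < G t) {f g : ℝ → ℝ}
    (hf : Continuous f) (hg : Continuous g) (h : f =ᵐ[weightMeasure G] g) :
    EqOn f g (Icc 0 (2 * π)) := by
  have h1 : f =ᵐ[volume.restrict (Ioc 0 (2 * π))] g := (ae_weightMeasure_iff hG hpos).1 h
  exact Measure.eqOn_Icc_of_ae_eq volume two_pi_pos.ne
    (by rwa [← restrict_Ioc_eq_restrict_Icc]) hf.continuousOn hg.continuousOn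

theorem eq_of_eqOn_period {f g : ℝ → ℝ} (hf : Function.Periodic f (2 * π))
    (hg : Function.Periodic g (2 * π)) (h : EqOn f g (Icc 0 (2 * π))) : f = g := by
  funext t
  rw [← map_toIcoMod hf 0 t, ← map_toIcoMod hg 0 t]
  exact h (Ico_subset_Icc_self (toIcoMod_mem_Ico_zero t))

namespace IsEigenbasis

variable {lam : ℕ → ℝ} {V : ℕ → ℝ → ℝ}

theorem wInner_eq (h : IsRegular K G Q) (hE : IsEigenbasis K G Q lam V) {i j : ℕ} (hi : 1 ≤ i)
    (hj : 1 ≤ j) : wInner G (V i) (V j) = if i = j then 1 else 0 := by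
  obtain ⟨b, hb⟩ := hE.basis
  obtain ⟨i, rfl⟩ := Nat.exists_eq_add_of_le' hi
  obtain ⟨j, rfl⟩ := Nat.exists_eq_add_of_le' hj
  rw [← inner_eq_wInner h.smooth_G.continuous h.pos_G (hb i) (hb j),
    orthonormal_iff_ite.1 b.orthonormal]
  simp

theorem contDiff (h : IsRegular K G Q) (hE : IsEigenbasis K G Q lam V) {s : Finset ℕ}
    (hs : ∀ j ∈ s, 1 ≤ j) : ∀ j ∈ s, ContDiff ℝ ∞ (V j) := fun j hj =>
  (hE.solution j (hs j hj)).contDiff h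

theorem periodic (hE : IsEigenbasis K G Q lam V) {s : Finset ℕ}
    (hs : ∀ j ∈ s, 1 ≤ j) : ∀ j ∈ s, Function.Periodic (V j) (2 * π) := fun j hj =>
  (hE.solution j (hs j hj)).2.1

theorem wInner_linComb (h : IsRegular K G Q) (hE : IsEigenbasis K G Q lam V) {s : Finset ℕ}
    (hs : ∀ j ∈ s, 1 ≤ j) (a : ℕ → ℝ) {i : ℕ} (hi : i ∈ s) :
    wInner G (V i) (linComb s V a) = a i := by
  have h1 : wInner G (V i) (linComb s V a) = ∑ j ∈ s, a j * wInner G (V i) (V j) := by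
    simp only [wInner, linComb, ← intervalIntegral.integral_const_mul]
    rw [← intervalIntegral.integral_finsetSum fun j hj => by
      refine Continuous.intervalIntegrable ?_ _ _
      exact continuous_const.mul (h.smooth_G.continuous.mul
        ((hE.solution i (hs i hi)).continuous.mul (hE.solution j (hs j hj)).continuous))]
    refine intervalIntegral.integral_congr fun t _ => ?_
    simp only [Finset.mul_sum]
    exact Finset.sum_congr rfl fun j _ => by ring
  rw [h1, Finset.sum_congr rfl fun j hj => by rw [hE.wInner_eq h (hs i hi) (hs j hj)]]
  simp [hi]

theorem linComb_ne_zero (h : IsRegular K G Q) (hE : IsEigenbasis K G Q lam V) {s : Finset ℕ}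
    (hs : ∀ j ∈ s, 1 ≤ j) {a : ℕ → ℝ} {i : ℕ} (hi : i ∈ s) (ha : a i ≠ 0) :
    linComb s V a ≠ 0 := fun h0 => ha <| by
  rw [← hE.wInner_linComb h hs a hi, h0]
  simp [wInner]

theorem ne_zero (h : IsRegular K G Q) (hE : IsEigenbasis K G Q lam V) {i : ℕ} (hi : 1 ≤ i) :
    V i ≠ 0 := fun h0 => by
  have := hE.wInner_eq h hi hi
  simp [h0, wInner] at this

theorem monotone (hE : IsEigenbasis K G Q lam V) {i j : ℕ} (hi : 1 ≤ i) (hij : i ≤ j) :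
    lam i ≤ lam j := by
  induction j, hij using Nat.le_induction with
  | base => exact le_rfl
  | succ j hj ih => exact ih.trans (hE.mono j (hi.trans hj))

/-- Each eigenvalue occurs at most twice. -/
theorem lt_add_two (h : IsRegular K G Q) (hE : IsEigenbasis K G Q lam V) {i : ℕ} (hi : 1 ≤ i) :
    lam i < lam (i + 2) := by
  by_contra! hle
  have h2 : lam (i + 2) = lam i := le_antisymm hle (hE.monotone hi (by omega))
  have h1 : lam (i + 1) = lam i :=
    le_antisymm ((hE.monotone (by omega) (by omega)).trans hle) (hE.monotone hi (by omega))
  have s1 := hE.solution (i + 1) (by omega)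
  have s2 := hE.solution (i + 2) (by omega)
  rw [h1] at s1
  rw [h2] at s2
  obtain ⟨a, b, c, hne, h0⟩ := exists_combination_eq_zero h (hE.solution i hi) s1 s2
  -- The dependence relation becomes a vanishing combination of orthonormal functions with a nonzero
  -- coefficient.
  let d : ℕ → ℝ := fun j => if j = i then a else if j = i + 1 then b else c
  have hd : linComb {i, i + 1, i + 2} V d = 0 := by
    rw [← h0, linComb_eq_sum_smul]
    simp [d, add_assoc]
  have hs : ∀ j ∈ ({i, i + 1, i + 2} : Finset ℕ), 1 ≤ j := by
    intro j hj
    simp only [Finset.mem_insert, Finset.mem_singleton] at hj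
    omega
  rcases hne with hne | hne | hne
  · exact hE.linComb_ne_zero h hs (i := i) (by simp) (by simpa [d] using hne) hd
  · exact hE.linComb_ne_zero h hs (i := i + 1) (by simp) (by simpa [d] using hne) hd
  · exact hE.linComb_ne_zero h hs (i := i + 2) (by simp) (by simpa [d] using hne) hd

/-- Parseval's identity. -/
theorem hasSum_wInner_sq (h : IsRegular K G Q) (hE : IsEigenbasis K G Q lam V) {f : ℝ → ℝ}
    (hf : Measurable f) {C : ℝ} (hC : ∀ t, |f t| ≤ C) :
    HasSum (fun i => wInner G f (V (i + 1)) ^ 2) (wInner G f f) := by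
  obtain ⟨b, hb⟩ := hE.basis
  have hG := h.smooth_G.continuous
  set F := (memLp_weightMeasure hG hf hC).toLp f with hF
  have hFf : F =ᵐ[weightMeasure G] f := MemLp.coeFn_toLp _
  have := b.hasSum_inner_mul_inner F F
  rw [inner_eq_wInner hG h.pos_G hFf hFf] at this
  refine this.congr_fun ?_
  intro i
  rw [real_inner_comm F (b i), inner_eq_wInner hG h.pos_G hFf (hb i), sq]

/-- A function with finitely many nonzero coefficients is the sum of its expansion. -/
theorem ae_eq_linComb (h : IsRegular K G Q) (hE : IsEigenbasis K G Q lam V) {f : ℝ → ℝ}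
    (hf : Measurable f) {C : ℝ} (hC : ∀ t, |f t| ≤ C) {s : Finset ℕ}
    (hs : ∀ j, 1 ≤ j → j ∉ s → wInner G f (V j) = 0) (hs1 : ∀ j ∈ s, 1 ≤ j) :
    f =ᵐ[weightMeasure G] linComb s V fun j => wInner G f (V j) := by
  obtain ⟨b, hb⟩ := hE.basis
  have hG := h.smooth_G.continuous
  set F := (memLp_weightMeasure hG hf hC).toLp f with hF
  have hFf : F =ᵐ[weightMeasure G] f := MemLp.coeFn_toLp _
  have hrep : ∀ i, b.repr F i = wInner G f (V (i + 1)) := fun i => by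
    rw [b.repr_apply_apply, real_inner_comm, inner_eq_wInner hG h.pos_G hFf (hb i)]
  -- The Hilbert basis is indexed from `0`, the eigenfunctions from `1`.
  set s' := s.image fun j => j - 1 with hs'
  have h1 : F = ∑ i ∈ s', b.repr F i • b i := by
    refine (b.hasSum_repr F).unique (hasSum_sum_of_ne_finset_zero fun i hi => ?_)
    rw [hrep, hs (i + 1) (by omega), zero_smul]
    intro hmem
    exact hi (Finset.mem_image.2 ⟨i + 1, hmem, by simp⟩)
  have h2 : ∀ᵐ t ∂weightMeasure G, ∀ i, b i t = V (i + 1) t := ae_all_iff.2 hb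
  have h3 := Lp.coeFn_finsetSum s' fun i => b.repr F i • b i
  have h4 : ∀ᵐ t ∂weightMeasure G, ∀ i, (b.repr F i • b i : Lp ℝ 2 (weightMeasure G)) t
      = b.repr F i * b i t := ae_all_iff.2 fun i => Lp.coeFn_smul _ _
  rw [← h1] at h3
  filter_upwards [hFf, h2, h3, h4] with t e1 e2 e3 e4
  rw [← e1, e3, Finset.sum_apply, linComb, hs', Finset.sum_image]
  · refine Finset.sum_congr rfl fun j hj => ?_
    rw [e4, hrep, e2, Nat.sub_add_cancel (hs1 j hj)]
  · intro x hx y hy hxy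
    have := hs1 x hx
    have := hs1 y hy
    simp only at hxy
    omega

end IsEigenbasis

/-! ### Courant's bound for the number of zeros -/

theorem sum_Icc_one (f : ℕ → ℝ) (n : ℕ) :
    ∑ j ∈ Finset.Icc 1 n, f j = ∑ i ∈ Finset.range n, f (i + 1) := by
  rw [← Finset.sum_image (f := f) (g := fun i => i + 1) (fun x _ y _ hxy => by simpa using hxy)]
  congr 1
  ext j
  simp only [Finset.mem_image, Finset.mem_range, Finset.mem_Icc]
  exact ⟨fun hj => ⟨j - 1, by omega, by omega⟩, fun ⟨i, hi, hij⟩ => by omega⟩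

theorem exists_ne_zero_forall_sum_eq_zero {k m : ℕ} (hkm : k < m) (M : Fin k → Fin m → ℝ) :
    ∃ c : Fin m → ℝ, c ≠ 0 ∧ ∀ j, ∑ i, c i * M j i = 0 := by
  have hlt : Module.finrank ℝ (Fin k → ℝ) < Module.finrank ℝ (Fin m → ℝ) := by simpa using hkm
  obtain ⟨c, hc, hne⟩ := (Submodule.ne_bot_iff _).1
    (LinearMap.ker_ne_bot_of_finrank_lt (f := Matrix.mulVecLin (Matrix.of M)) hlt)
  refine ⟨c, hne, fun j => ?_⟩
  have := congrFun (LinearMap.mem_ker.1 hc) j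
  simpa [Matrix.mulVec, dotProduct, mul_comm] using this

/-! ### Step functions on a partition by zeros -/

/-- The step function with value `c i` on `(z i, z (i + 1)]`. -/
def stepFun {m : ℕ} (z : Fin (m + 1) → ℝ) (c : Fin m → ℝ) (t : ℝ) : ℝ :=
  ∑ i, c i * (Ioc (z i.castSucc) (z i.succ)).indicator 1 t

section Step

variable {m : ℕ} {z : Fin (m + 1) → ℝ}

theorem stepFun_eq (hz : StrictMono z) (c : Fin m → ℝ) {i : Fin m} {t : ℝ}
    (ht : t ∈ Ioc (z i.castSucc) (z i.succ)) : stepFun z c t = c i := by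
  rw [stepFun, Finset.sum_eq_single i]
  · simp [ht]
  · intro j _ hj
    rw [indicator_of_notMem, mul_zero]
    intro htj
    rcases lt_or_gt_of_ne hj with h | h
    · have : z j.succ ≤ z i.castSucc := hz.monotone (by
        rw [Fin.le_def]; simp; exact h)
      linarith [htj.2, ht.1]
    · have : z i.succ ≤ z j.castSucc := hz.monotone (by
        rw [Fin.le_def]; simp; exact h)
      linarith [htj.1, ht.2]
  · simp

theorem stepFun_eq_zero (c : Fin m → ℝ) {t : ℝ}
    (ht : ∀ i : Fin m, t ∉ Ioc (z i.castSucc) (z i.succ)) : stepFun z c t = 0 :=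
  Finset.sum_eq_zero fun i _ => by simp [ht i]

theorem stepFun_sq (hz : StrictMono z) (c : Fin m → ℝ) (t : ℝ) :
    stepFun z c t ^ 2 = stepFun z (fun i => c i ^ 2) t := by
  by_cases h : ∃ i : Fin m, t ∈ Ioc (z i.castSucc) (z i.succ)
  · obtain ⟨i, hi⟩ := h
    rw [stepFun_eq hz c hi, stepFun_eq hz _ hi]
  · push Not at h
    rw [stepFun_eq_zero c h, stepFun_eq_zero _ h]
    simp

theorem measurable_stepFun (c : Fin m → ℝ) : Measurable (stepFun z c) :=
  Finset.measurable_sum _ fun _ _ => measurable_const.mul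
    (measurable_one.indicator measurableSet_Ioc)

theorem abs_stepFun_le (c : Fin m → ℝ) (t : ℝ) : |stepFun z c t| ≤ ∑ i, |c i| := by
  refine (Finset.abs_sum_le_sum_abs _ _).trans (Finset.sum_le_sum fun i _ => ?_)
  rw [abs_mul]
  refine mul_le_of_le_one_right (abs_nonneg _) ?_
  by_cases h : t ∈ Ioc (z i.castSucc) (z i.succ) <;> simp [h]

variable {ψ : ℝ → ℝ}

theorem intervalIntegrable_stepFun_mul (c : Fin m → ℝ) (hψ : Continuous ψ) :
    IntervalIntegrable (fun t => stepFun z c t * ψ t) volume 0 (2 * π) := by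
  have h1 : IntervalIntegrable (stepFun z c) volume 0 (2 * π) :=
    (intervalIntegrable_const (c := ∑ i, |c i|)).mono_fun
      (measurable_stepFun c).aestronglyMeasurable (Eventually.of_forall fun t => by
        exact (abs_stepFun_le c t).trans (le_abs_self _))
  exact h1.mul_continuousOn hψ.continuousOn

theorem integral_stepFun_mul (hz : StrictMono z) (hI : ∀ i, z i ∈ Icc 0 (2 * π)) (c : Fin m → ℝ)
    (hψ : Continuous ψ) : ∫ t in 0..2 * π, stepFun z c t * ψ t =
      ∑ i : Fin m, c i * ∫ t in z i.castSucc..z i.succ, ψ t := by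
  have h1 : ∀ t, stepFun z c t * ψ t =
      ∑ i : Fin m, c i * (Ioc (z i.castSucc) (z i.succ)).indicator ψ t := fun t => by
    rw [stepFun, Finset.sum_mul]
    refine Finset.sum_congr rfl fun i _ => ?_
    by_cases h : t ∈ Ioc (z i.castSucc) (z i.succ) <;> simp [h]
  simp only [h1]
  have hle : ∀ i : Fin m, z i.castSucc ≤ z i.succ := fun i => (hz i.castSucc_lt_succ).le
  rw [intervalIntegral.integral_finsetSum]
  · refine Finset.sum_congr rfl fun i _ => ?_
    rw [intervalIntegral.integral_const_mul, intervalIntegral.integral_of_le two_pi_pos.le,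
      intervalIntegral.integral_of_le (hle i), setIntegral_indicator measurableSet_Ioc,
      inter_eq_right.2 (Ioc_subset_Ioc (hI _).1 (hI _).2)]
  · intro i _
    refine IntervalIntegrable.const_mul ?_ _
    rw [intervalIntegrable_iff_integrableOn_Ioc_of_le two_pi_pos.le]
    exact ((intervalIntegrable_iff_integrableOn_Ioc_of_le two_pi_pos.le).1
      (hψ.intervalIntegrable 0 (2 * π))).indicator measurableSet_Ioc

end Step

/-! ### Energy identities and Courant's nodal argument -/

/-- Green's identity on an interval without boundary contribution. -/
theorem integral_energy (h : IsRegular K G Q) {f V : ℝ → ℝ} {ν : ℝ} (hf : ContDiff ℝ 1 f)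
    (hV : IsSolution K G Q ν V) {a b : ℝ}
    (hab : f a * (K a * deriv V a) = f b * (K b * deriv V b)) (C : ℝ) :
    ∫ t in a..b, (K t * (deriv f t * deriv V t) + (Q t + C * G t) * (f t * V t)) =
      (ν + C) * ∫ t in a..b, G t * (f t * V t) := by
  have hK := h.smooth_K.continuous
  have hG := h.smooth_G.continuous
  have hQ := h.smooth_Q.continuous
  have hf0 := hf.continuous
  have hf1 := hf.continuous_deriv le_rfl
  have hV0 := hV.continuous
  have hV1 := hV.1.continuous_deriv (by simp)
  have h1 : ∫ t in a..b, ((K t * (deriv f t * deriv V t) + (Q t + C * G t) * (f t * V t)) -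
      (ν + C) * (G t * (f t * V t))) = f b * (K b * deriv V b) - f a * (K a * deriv V a) := by
    refine intervalIntegral.integral_eq_sub_of_hasDerivAt
      (f := fun t => f t * (K t * deriv V t)) (fun t _ => ?_)
      (Continuous.intervalIntegrable (by fun_prop) _ _)
    refine ((hf.differentiable (by simp) t).hasDerivAt.mul
      (hV.hasDerivAt_flux h t)).congr_deriv ?_
    ring
  rw [intervalIntegral.integral_sub (Continuous.intervalIntegrable (by fun_prop) _ _)
    (Continuous.intervalIntegrable (by fun_prop) _ _), intervalIntegral.integral_const_mul] at h1
  linarith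

theorem IsSolution.eq_zero_of_ae (h : IsRegular K G Q) (hu : IsSolution K G Q μ u) {a b : ℝ}
    (hab : a < b) (h0 : u =ᵐ[volume.restrict (Ioo a b)] 0) : u = 0 := by
  have h1 : EqOn u 0 (Ioo a b) := Measure.eqOn_open_of_ae_eq h0 isOpen_Ioo
    hu.continuous.continuousOn continuousOn_const
  obtain ⟨t, ht⟩ := nonempty_Ioo.2 hab
  refine hu.eq_zero h (h1 ht) ?_
  have : u =ᶠ[𝓝 t] fun _ => 0 := h1.eventuallyEq_of_mem (isOpen_Ioo.mem_nhds ht)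
  rw [this.deriv_eq, deriv_const]

/-- Adding a multiple of `G` to `Q` only shifts the spectrum. A positive zeroth order coefficient
makes the energy nonnegative and defines a weight on the circle. -/
theorem exists_shift (h : IsRegular K G Q) : ∃ C, ∀ t, 0 < Q t + C * G t := by
  obtain ⟨c, hc, hcG⟩ := exists_pos_le_of_periodic h.smooth_G.continuous h.periodic_G h.pos_G
  obtain ⟨B, hB, hBQ⟩ := exists_abs_le_of_periodic h.smooth_Q.continuous h.periodic_Q
  refine ⟨(B + 1) / c, fun t => ?_⟩
  have h1 : B + 1 ≤ (B + 1) / c * G t := by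
    rw [div_mul_eq_mul_div, le_div_iff₀ hc]
    exact mul_le_mul_of_nonneg_left (hcG t) (by positivity)
  linarith [neg_le_of_abs_le (hBQ t)]

namespace IsEigenbasis

variable {lam : ℕ → ℝ} {V : ℕ → ℝ → ℝ}

/-- Bessel's inequality in the energy norm for a piecewise multiple of an eigenfunction. -/
theorem sum_energy_le (h : IsRegular K G Q) (hE : IsEigenbasis K G Q lam V)
    (hu : IsSolution K G Q μ u) {m : ℕ} {z : Fin (m + 1) → ℝ} (hz : StrictMono z)
    (hI : ∀ i, z i ∈ Icc 0 (2 * π)) (hz0 : ∀ i, u (z i) = 0) (c : Fin m → ℝ) {C : ℝ}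
    (hC : ∀ t, 0 ≤ Q t + C * G t) (n : ℕ) :
    ∑ j ∈ Finset.Icc 1 n, (lam j + C) * wInner G (fun t => stepFun z c t * u t) (V j) ^ 2 ≤
      (μ + C) * wInner G (fun t => stepFun z c t * u t) (fun t => stepFun z c t * u t) := by
  have hK := h.smooth_K.continuous
  have hG := h.smooth_G.continuous
  have hQ := h.smooth_Q.continuous
  have hu0 := hu.continuous
  have hu1 := hu.1.continuous_deriv (by simp)
  set f : ℝ → ℝ := fun t => stepFun z c t * u t with hf
  set d : ℕ → ℝ := fun j => wInner G f (V j) with hd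
  set s := Finset.Icc 1 n with hs
  have hs1 : ∀ j ∈ s, 1 ≤ j := fun j hj => (Finset.mem_Icc.1 hj).1
  set P := linComb s V d with hP
  have hsm := hE.contDiff h hs1
  have hV0 : ∀ j ∈ s, Continuous (V j) := fun j hj => (hsm j hj).continuous
  have hV1 : ∀ j ∈ s, Continuous (deriv (V j)) := fun j hj => (hsm j hj).continuous_deriv (by simp)
  have hPs : ContDiff ℝ ∞ P := contDiff_linComb hsm d
  have hP0 := hPs.continuous
  have hP1 := hPs.continuous_deriv (by simp)
  have hPp : Function.Periodic P (2 * π) := periodic_linComb (hE.periodic hs1) d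
  have hPd : deriv P = linComb s (fun j => deriv (V j)) d := deriv_linComb hsm d
  set ψ : (ℝ → ℝ) → (ℝ → ℝ) → ℝ → ℝ := fun p q t =>
    K t * (deriv p t * deriv q t) + (Q t + C * G t) * (p t * q t) with hψ
  have hψc : ∀ p q : ℝ → ℝ, Continuous p → Continuous (deriv p) → Continuous q →
      Continuous (deriv q) → Continuous (ψ p q) := fun p q _ _ _ _ => by
    simp only [hψ]
    fun_prop
  have hff : wInner G f f = ∑ i : Fin m, c i ^ 2 *
      ∫ t in z i.castSucc..z i.succ, G t * (u t * u t) := by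
    rw [← integral_stepFun_mul hz hI _ (by fun_prop), wInner]
    refine intervalIntegral.integral_congr fun t _ => ?_
    simp only [hf, ← stepFun_sq hz]
    ring
  have hfV : ∀ j ∈ s, d j = ∑ i : Fin m, c i *
      ∫ t in z i.castSucc..z i.succ, G t * (u t * V j t) := fun j hj => by
    have := hV0 j hj
    rw [← integral_stepFun_mul hz hI _ (by fun_prop)]
    simp only [hd, wInner]
    refine intervalIntegral.integral_congr fun t _ => ?_
    simp only [hf]
    ring
  -- On each piece Green's identity has no boundary term because `u` vanishes at the break points;
  -- for the projection `P` below the boundary terms cancel by periodicity.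
  have h1 : ∫ t in 0..2 * π, stepFun z (fun i => c i ^ 2) t * ψ u u t =
      (μ + C) * wInner G f f := by
    rw [integral_stepFun_mul hz hI _ (hψc u u hu0 hu1 hu0 hu1), hff, Finset.mul_sum]
    refine Finset.sum_congr rfl fun i _ => ?_
    rw [integral_energy h (hu.1.of_le (by norm_num)) hu (by simp [hz0])]
    ring
  have h2 : ∀ j ∈ s, ∫ t in 0..2 * π, stepFun z c t * ψ u (V j) t =
      (lam j + C) * d j := fun j hj => by
    rw [integral_stepFun_mul hz hI _ (hψc _ _ hu0 hu1 (hV0 j hj) (hV1 j hj)), hfV j hj,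
      Finset.mul_sum]
    refine Finset.sum_congr rfl fun i _ => ?_
    rw [integral_energy h (hu.1.of_le (by norm_num)) (hE.solution j (hs1 j hj)) (by simp [hz0])]
    ring
  have h3 : ∀ j ∈ s, ∫ t in 0..2 * π, ψ P (V j) t = (lam j + C) * d j := fun j hj => by
    have hp := (hE.solution j (hs1 j hj)).2.1
    have e1 : P (2 * π) = P 0 := by simpa using hPp 0
    have e2 : K (2 * π) = K 0 := by simpa using h.periodic_K 0
    have e3 : deriv (V j) (2 * π) = deriv (V j) 0 := by simpa using periodic_deriv hp 0
    rw [integral_energy h (hPs.of_le (by exact_mod_cast le_top)) (hE.solution j (hs1 j hj))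
      (by rw [e1, e2, e3]), ← hE.wInner_linComb h hs1 d hj, wInner]
    congr 1
    exact intervalIntegral.integral_congr fun t _ => by simp only [hP]; ring
  -- The energy of `f - P` is nonnegative, where `stepFun z c * u'` plays the role of `f'`.
  -- Expanding the squares gives Bessel's inequality.
  have h0 : 0 ≤ ∫ t in 0..2 * π, (K t * (stepFun z c t * deriv u t - deriv P t) ^ 2 +
      (Q t + C * G t) * (f t - P t) ^ 2) :=
    intervalIntegral.integral_nonneg two_pi_pos.le fun t _ =>
      add_nonneg (mul_nonneg (h.pos_K t).le (sq_nonneg _)) (mul_nonneg (hC t) (sq_nonneg _))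
  have hpt : ∀ t, K t * (stepFun z c t * deriv u t - deriv P t) ^ 2 +
      (Q t + C * G t) * (f t - P t) ^ 2 = stepFun z (fun i => c i ^ 2) t * ψ u u t -
      ∑ j ∈ s, d j * (2 * (stepFun z c t * ψ u (V j) t) - ψ P (V j) t) := fun t => by
    have e1 : ∑ j ∈ s, d j * (2 * (stepFun z c t * ψ u (V j) t) - ψ P (V j) t) =
        2 * stepFun z c t * (K t * (deriv u t * deriv P t) + (Q t + C * G t) * (u t * P t)) -
        (K t * (deriv P t * deriv P t) + (Q t + C * G t) * (P t * P t)) := by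
      have e2 : deriv P t = ∑ j ∈ s, d j * deriv (V j) t := by rw [hPd]; rfl
      have e3 : P t = ∑ j ∈ s, d j * V j t := rfl
      have e4 : ∀ x y : ℝ, ∑ j ∈ s, d j * (x * deriv (V j) t + y * V j t) =
          x * deriv P t + y * P t := fun x y => by
        rw [e2, e3, Finset.mul_sum, Finset.mul_sum, ← Finset.sum_add_distrib]
        exact Finset.sum_congr rfl fun j _ => by ring
      have := e4 (2 * stepFun z c t * K t * deriv u t - K t * deriv P t)
        (2 * stepFun z c t * (Q t + C * G t) * u t - (Q t + C * G t) * P t)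
      calc _ = _ := Finset.sum_congr rfl fun j _ => by simp only [hψ]; ring
        _ = _ := this
        _ = _ := by ring
    rw [e1, ← stepFun_sq hz]
    simp only [hf, hψ]
    ring
  have hint : ∀ j ∈ s, IntervalIntegrable
      (fun t => d j * (2 * (stepFun z c t * ψ u (V j) t) - ψ P (V j) t)) volume 0 (2 * π) :=
    fun j hj => (((intervalIntegrable_stepFun_mul c
      (hψc _ _ hu0 hu1 (hV0 j hj) (hV1 j hj))).const_mul 2).sub
      ((hψc _ _ hP0 hP1 (hV0 j hj) (hV1 j hj)).intervalIntegrable _ _)).const_mul _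
  simp only [hpt] at h0
  rw [intervalIntegral.integral_sub (intervalIntegrable_stepFun_mul _ (hψc u u hu0 hu1 hu0 hu1))
    (by simpa only [Finset.sum_fn] using IntervalIntegrable.sum s hint), h1,
    intervalIntegral.integral_finsetSum hint] at h0
  have h5 : ∀ j ∈ s, ∫ t in 0..2 * π, d j * (2 * (stepFun z c t * ψ u (V j) t) - ψ P (V j) t) =
      (lam j + C) * d j ^ 2 := fun j hj => by
    rw [intervalIntegral.integral_const_mul, intervalIntegral.integral_sub
      ((intervalIntegrable_stepFun_mul c
      (hψc _ _ hu0 hu1 (hV0 j hj) (hV1 j hj))).const_mul 2)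
      ((hψc _ _ hP0 hP1 (hV0 j hj) (hV1 j hj)).intervalIntegrable _ _),
      intervalIntegral.integral_const_mul, h2 j hj, h3 j hj]
    ring
  rw [Finset.sum_congr rfl h5] at h0
  linarith

/-- A nonzero eigenfunction for the `m`-th eigenvalue has at most `m` zeros. -/
theorem encard_zeroSet_le (h : IsRegular K G Q) (hE : IsEigenbasis K G Q lam V) {m : ℕ}
    (hm : 1 ≤ m) (hu : IsSolution K G Q (lam m) u) (hne : u ≠ 0) : (zeroSet u).encard ≤ m := by
  by_contra! hlt
  obtain ⟨S, hS, hSm⟩ := Set.exists_subset_encard_eq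
    (show ((m + 1 : ℕ) : ℕ∞) ≤ (zeroSet u).encard by
      push_cast
      exact Order.add_one_le_of_lt hlt)
  obtain ⟨S, rfl⟩ := (Set.finite_of_encard_eq_coe hSm).exists_finset_coe
  have hcard : S.card = m + 1 := by
    rw [Set.encard_coe_eq_coe_finsetCard] at hSm
    exact_mod_cast hSm
  set z := S.orderEmbOfFin hcard with hzdef
  have hzS : ∀ i, z i ∈ zeroSet u := fun i => hS (S.orderEmbOfFin_mem hcard i)
  have hz : StrictMono z := z.strictMono
  have hI : ∀ i, z i ∈ Icc 0 (2 * π) := fun i => Ico_subset_Icc_self (hzS i).1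
  have hz0 : ∀ i, u (z i) = 0 := fun i => (hzS i).2
  -- The `m + 1` zeros bound `m` pieces inside `[0, 2π)`, not counting the arc across `2π`. With `m`
  -- free multiples of `u`, the `m - 1` orthogonality conditions to `V 1, …, V (m - 1)` have a
  -- nontrivial solution.
  obtain ⟨c, hc, hcM⟩ := exists_ne_zero_forall_sum_eq_zero (show m - 1 < m by omega)
    fun (j : Fin (m - 1)) (i : Fin m) =>
      ∫ t in z i.castSucc..z i.succ, G t * (u t * V (j + 1) t)
  set f : ℝ → ℝ := fun t => stepFun z c t * u t with hf
  have hfm : Measurable f := (measurable_stepFun c).mul hu.continuous.measurable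
  obtain ⟨B, hB, hBu⟩ := exists_abs_le_of_periodic hu.continuous hu.2.1
  have hfb : ∀ t, |f t| ≤ (∑ i, |c i|) * B := fun t => by
    rw [hf, abs_mul]
    exact mul_le_mul (abs_stepFun_le c t) (hBu t) (abs_nonneg _)
      (Finset.sum_nonneg fun i _ => abs_nonneg _)
  have hlow : ∀ j, 1 ≤ j → j < m → wInner G f (V j) = 0 := fun j hj hjm => by
    have h1 := hcM ⟨j - 1, by omega⟩
    simp only [Nat.sub_add_cancel hj] at h1
    have := (hE.solution j hj).continuous
    have := hu.continuous
    have := h.smooth_G.continuous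
    rw [← integral_stepFun_mul hz hI _ (by fun_prop)] at h1
    rw [← h1, wInner]
    refine intervalIntegral.integral_congr fun t _ => ?_
    simp only [hf]
    ring
  obtain ⟨C, hC⟩ := exists_shift h
  have hpars := hE.hasSum_wInner_sq h hfm hfb
  -- The energy of `f` is exactly `(lam m + C)` times its squared norm. Comparison with Parseval's
  -- identity leaves no room for a coefficient belonging to an eigenvalue above `lam m`.
  have hhigh : ∀ j, m ≤ j → lam m < lam j → wInner G f (V j) = 0 := fun p hp hlp => by
    by_contra hd
    have hpos : 0 < (lam p - lam m) * wInner G f (V p) ^ 2 :=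
      mul_pos (sub_pos.2 hlp) (by positivity)
    have hn : ∀ n, p ≤ n → (lam m + C) * ∑ i ∈ Finset.range n, wInner G f (V (i + 1)) ^ 2 +
        (lam p - lam m) * wInner G f (V p) ^ 2 ≤ (lam m + C) * wInner G f f := fun n hpn => by
      refine le_trans ?_ (hE.sum_energy_le h hu hz hI hz0 c (fun t => (hC t).le) n)
      rw [← sum_Icc_one fun j => wInner G f (V j) ^ 2, Finset.mul_sum, ← sub_nonneg]
      have : ∀ j ∈ Finset.Icc 1 n, 0 ≤ (lam j - lam m) * wInner G f (V j) ^ 2 := fun j hj => by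
        rcases lt_or_ge j m with hjm | hjm
        · rw [hlow j (Finset.mem_Icc.1 hj).1 hjm]
          simp
        · exact mul_nonneg (sub_nonneg.2 (hE.monotone hm hjm)) (sq_nonneg _)
      have h6 := Finset.single_le_sum this (Finset.mem_Icc.2 ⟨hm.trans hp, hpn⟩)
      have h7 : ∑ j ∈ Finset.Icc 1 n, (lam j - lam m) * wInner G f (V j) ^ 2 =
          ∑ j ∈ Finset.Icc 1 n, (lam j + C) * wInner G f (V j) ^ 2 -
          ∑ j ∈ Finset.Icc 1 n, (lam m + C) * wInner G f (V j) ^ 2 := by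
        rw [← Finset.sum_sub_distrib]
        exact Finset.sum_congr rfl fun j _ => by ring
      rw [h7] at h6
      linarith
    have hlim := (hpars.tendsto_sum_nat.const_mul (lam m + C)).add_const
      ((lam p - lam m) * wInner G f (V p) ^ 2)
    have := le_of_tendsto hlim ((eventually_ge_atTop p).mono hn)
    linarith
  set s := (Finset.Icc m (m + 1)).filter fun j => lam j = lam m with hs
  have hs1 : ∀ j ∈ s, 1 ≤ j := fun j hj =>
    hm.trans (Finset.mem_Icc.1 (Finset.mem_filter.1 hj).1).1
  have hae := hE.ae_eq_linComb h hfm hfb (s := s) (fun j hj hjs => by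
    rcases lt_or_ge j m with hjm | hjm
    · exact hlow j hj hjm
    · refine hhigh j hjm (lt_of_le_of_ne (hE.monotone hm hjm) fun heq => hjs ?_)
      refine Finset.mem_filter.2 ⟨Finset.mem_Icc.2 ⟨hjm, ?_⟩, heq.symm⟩
      by_contra! hj2
      have h8 := hE.lt_add_two h hm
      have h9 := hE.monotone (show 1 ≤ m + 2 by omega) (show m + 2 ≤ j by omega)
      linarith) hs1
  -- Thus `f` agrees almost everywhere with a genuine solution `w` for `lam m`.
  set w := linComb s V fun j => wInner G f (V j) with hw
  have hwsol : IsSolution K G Q (lam m) w := by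
    rw [hw, linComb_eq_sum_smul]
    exact IsSolution.sum_smul h s V _ fun j hj => by
      have := hE.solution j (hs1 j hj)
      rwa [(Finset.mem_filter.1 hj).2] at this
  have hae' : ∀ᵐ t ∂volume.restrict (Ioc 0 (2 * π)), f t = w t :=
    (ae_weightMeasure_iff h.smooth_G.continuous h.pos_G).1 hae
  have hlast : z (Fin.last m) < 2 * π := (hzS _).1.2
  -- The function `f` vanishes on the unused arc after the last zero, so `w` vanishes by unique
  -- continuation. On a piece with `c i ≠ 0` this then forces `u` to vanish too.
  have hw0 : w = 0 := by
    refine hwsol.eq_zero_of_ae h hlast ?_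
    have h1 := ae_mono (Measure.restrict_mono (show Ioo (z (Fin.last m)) (2 * π) ⊆ Ioc 0 (2 * π)
      from fun t ht => ⟨(hI _).1.trans_lt ht.1, ht.2.le⟩) le_rfl) hae'
    filter_upwards [h1, ae_restrict_mem measurableSet_Ioo] with t ht htI
    rw [← ht, hf]
    simp only [Pi.zero_apply]
    rw [stepFun_eq_zero c fun i hi => ?_, zero_mul]
    exact absurd (htI.1.trans_le hi.2) (hz.monotone (Fin.le_last _)).not_gt
  refine hc (funext fun i => ?_)
  by_contra hci
  refine hne (hu.eq_zero_of_ae h (hz i.castSucc_lt_succ) ?_)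
  have h1 := ae_mono (Measure.restrict_mono (show Ioo (z i.castSucc) (z i.succ) ⊆ Ioc 0 (2 * π)
    from fun t ht => ⟨(hI _).1.trans_lt ht.1, ht.2.le.trans (hI _).2⟩) le_rfl) hae'
  filter_upwards [h1, ae_restrict_mem measurableSet_Ioo] with t ht htI
  rw [hw0, hf] at ht
  simp only [Pi.zero_apply] at ht
  rw [stepFun_eq hz c (Ioo_subset_Ioc_self htI)] at ht
  exact (mul_eq_zero.1 ht).resolve_left hci

end IsEigenbasis

/-! ### Counting zeros of eigenfunctions and of their combinations -/

theorem IsSolution.hasSimpleZeros (h : IsRegular K G Q) (hu : IsSolution K G Q μ u) (hne : u ≠ 0) :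
    HasSimpleZeros u := fun _ ht => hu.deriv_ne_zero h hne ht

theorem IsSolution.exists_encard_eq (h : IsRegular K G Q) (hu : IsSolution K G Q μ u)
    (hne : u ≠ 0) : ∃ n : ℕ, (zeroSet u).encard = n ∧ Even n := by
  have hs := hu.hasSimpleZeros h hne
  obtain ⟨n, hn⟩ := ENat.ne_top_iff_exists.1
    (Set.encard_ne_top_iff.2 (hs.finite_zeroSet hu.differentiable))
  refine ⟨n, hn.symm, ?_⟩
  rcases Nat.eq_zero_or_pos n with rfl | hpos
  · simp
  · exact (hs.alternates hu.differentiable hu.2.1 hn.symm hpos).even hu.2.1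

namespace IsEigenbasis

variable {lam : ℕ → ℝ} {V : ℕ → ℝ → ℝ}

theorem hasSimpleZeros (h : IsRegular K G Q) (hE : IsEigenbasis K G Q lam V) {i : ℕ} (hi : 1 ≤ i) :
    HasSimpleZeros (V i) := (hE.solution i hi).hasSimpleZeros h (hE.ne_zero h hi)

/-- Eigenfunctions for the first eigenvalue do not vanish. -/
theorem ground_ne_zero (h : IsRegular K G Q) (hE : IsEigenbasis K G Q lam V)
    (hu : IsSolution K G Q (lam 1) u) (hne : u ≠ 0) (t : ℝ) : u t ≠ 0 := by
  intro ht
  obtain ⟨n, hn, hev⟩ := hu.exists_encard_eq h hne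
  have h1 := hE.encard_zeroSet_le h le_rfl hu hne
  rw [hn] at h1
  have h2 : n ≤ 1 := by exact_mod_cast h1
  obtain rfl : n = 0 := by
    rcases hev with ⟨k, hk⟩
    omega
  have h3 : zeroSet u = ∅ := by simpa using hn
  have h4 : toIcoMod two_pi_pos 0 t ∈ zeroSet u :=
    ⟨toIcoMod_mem_Ico_zero t, by rw [map_toIcoMod hu.2.1]; exact ht⟩
  rw [h3] at h4
  exact h4

theorem isSolution_linComb (h : IsRegular K G Q) (hE : IsEigenbasis K G Q lam V) {s : Finset ℕ}
    (hs : ∀ j ∈ s, 1 ≤ j ∧ lam j = μ) (a : ℕ → ℝ) : IsSolution K G Q μ (linComb s V a) := by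
  rw [linComb_eq_sum_smul]
  refine IsSolution.sum_smul h s V a fun j hj => ?_
  have := hE.solution j (hs j hj).1
  rwa [(hs j hj).2] at this

/-- If `λ₁ = λ₂`, the combination of `V 1` and `V 2` that vanishes at `0` would be a nonzero first
eigenfunction with a zero. -/
theorem lam_one_lt (h : IsRegular K G Q) (hE : IsEigenbasis K G Q lam V) {j : ℕ} (hj : 2 ≤ j) :
    lam 1 < lam j := by
  refine lt_of_lt_of_le ?_ (hE.monotone (by norm_num) hj)
  refine lt_of_le_of_ne (hE.mono 1 le_rfl) fun heq => ?_
  have hs : ∀ j ∈ ({1, 2} : Finset ℕ), 1 ≤ j ∧ lam j = lam 1 := by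
    intro j hj
    simp only [Finset.mem_insert, Finset.mem_singleton] at hj
    rcases hj with rfl | rfl
    · exact ⟨le_rfl, rfl⟩
    · exact ⟨by norm_num, heq.symm⟩
  let a : ℕ → ℝ := fun j => if j = 1 then V 2 0 else -V 1 0
  have hsol := hE.isSolution_linComb h hs a
  have h1 : V 1 0 ≠ 0 := hE.ground_ne_zero h (hE.solution 1 le_rfl) (hE.ne_zero h le_rfl) 0
  have hne : linComb {1, 2} V a ≠ 0 :=
    hE.linComb_ne_zero h (fun j hj => (hs j hj).1) (i := 2) (by simp) (by simpa [a] using h1)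
  refine hE.ground_ne_zero h hsol hne 0 ?_
  simp [linComb, a]
  ring

/-- Nonzero eigenfunctions in the span of the `V j` for one eigenvalue have equally many zeros. -/
theorem encard_zeroSet_linComb (h : IsRegular K G Q) (hE : IsEigenbasis K G Q lam V)
    {s : Finset ℕ} (hs : ∀ j ∈ s, 1 ≤ j ∧ lam j = μ) {a : ℕ → ℝ} {p : ℕ} (hp : p ∈ s)
    (ha : a p ≠ 0) : (zeroSet (linComb s V a)).encard = (zeroSet (V p)).encard := by
  have hs1 : ∀ j ∈ s, 1 ≤ j := fun j hj => (hs j hj).1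
  -- Scaling all coefficients except the `p`-th by `x` joins `a p • V p` to the given combination.
  -- The `p`-th coefficient keeps each member nonzero, so its zeros are simple.
  let c : ℝ → ℕ → ℝ := fun x j => if j = p then a p else x * a j
  have key := zeroSet_encard_eq_of_path (hE.contDiff h hs1) (hE.periodic hs1) (c := c)
    (fun j _ => by
      by_cases hj : j = p
      · simpa [c, hj] using continuous_const
      · simpa [c, hj] using continuous_mul_const (a j))
    (fun x => (hE.isSolution_linComb h hs (c x)).hasSimpleZeros h
      (hE.linComb_ne_zero h hs1 hp (by simpa [c] using ha))) 1 0
  have h1 : c 1 = a := by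
    funext j
    by_cases hj : j = p <;> simp [c, hj]
  have h0 : linComb s V (c 0) = fun t => a p * V p t := by
    funext t
    rw [linComb, Finset.sum_eq_single p]
    · simp [c]
    · intro j _ hj
      simp [c, hj]
    · exact fun hps => absurd hp hps
  rw [h1, h0] at key
  rw [key]
  congr 1
  ext t
  simp [zeroSet, ha]

/-- Apply `L - λ₁` many times and divide by `(λ_n - λ₁)^k`. Coefficients below `λ_n` die out, and
the limit is a nonzero eigenfunction for `λ_n` with simple zeros, whose number is already attained
for some finite `k`. -/
theorem zeroCount_linComb_le_encard (h : IsRegular K G Q) (hE : IsEigenbasis K G Q lam V)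
    {m n : ℕ} (hm : 1 ≤ m) (hmn : m ≤ n) {a : ℕ → ℝ} (ha : a n ≠ 0) :
    zeroCount (linComb (Finset.Icc m n) V a) ≤ (zeroSet (V n)).encard := by
  set s := Finset.Icc m n with hs
  have hs1 : ∀ j ∈ s, 1 ≤ j := fun j hj => hm.trans (Finset.mem_Icc.1 hj).1
  have hns : n ∈ s := Finset.mem_Icc.2 ⟨hmn, le_rfl⟩
  -- For `n = 1` the normalizing factor would vanish, but then the combination is a multiple of `V
  -- 1`.
  rcases (hm.trans hmn).eq_or_lt with rfl | hn
  · have h1 : ∀ j ∈ s, 1 ≤ j ∧ lam j = lam 1 := fun j hj => by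
      have := Finset.mem_Icc.1 hj
      obtain rfl : j = 1 := by omega
      exact ⟨le_rfl, rfl⟩
    rw [zeroCount_eq_encard ((hE.isSolution_linComb h h1 a).hasSimpleZeros h
      (hE.linComb_ne_zero h hs1 hns ha)), hE.encard_zeroSet_linComb h h1 hns ha]
  have hpos : 0 < lam n - lam 1 := sub_pos.2 (hE.lam_one_lt h hn)
  set r := (lam n - lam 1)⁻¹ with hr
  let c₀ : ℕ → ℝ := fun j => if lam j = lam n then a j else 0
  let c : ℕ → ℕ → ℝ := fun k j => r ^ k * (a j * (lam j - lam 1) ^ k)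
  have hlim : ∀ j ∈ s, Tendsto (fun k => c k j) atTop (𝓝 (c₀ j)) := fun j hj => by
    have e : (fun k => c k j) = fun k => a j * (r * (lam j - lam 1)) ^ k := by
      funext k
      simp only [c, mul_pow]
      ring
    rw [e]
    by_cases hj2 : lam j = lam n
    · have : r * (lam j - lam 1) = 1 := by rw [hj2, hr, inv_mul_cancel₀ hpos.ne']
      simp only [this, c₀, if_pos hj2, one_pow, mul_one]
      exact tendsto_const_nhds
    · have h1 : 0 ≤ r * (lam j - lam 1) :=
        mul_nonneg (inv_pos.2 hpos).le (sub_nonneg.2 (hE.monotone le_rfl (hs1 j hj)))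
      have h2 : r * (lam j - lam 1) < 1 := by
        rw [hr, inv_mul_lt_one₀ hpos]
        have := lt_of_le_of_ne (hE.monotone (hs1 j hj) (Finset.mem_Icc.1 hj).2) hj2
        linarith
      simpa [c₀, hj2] using (tendsto_pow_atTop_nhds_zero_of_lt_one h1 h2).const_mul (a j)
  have hfil : linComb s V c₀ = linComb (s.filter fun j => lam j = lam n) V a := by
    funext t
    simp only [linComb, Finset.sum_filter, c₀]
    exact Finset.sum_congr rfl fun j _ => by split_ifs <;> simp
  have hs2 : ∀ j ∈ s.filter fun j => lam j = lam n, 1 ≤ j ∧ lam j = lam n := fun j hj =>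
    ⟨hs1 j (Finset.mem_filter.1 hj).1, (Finset.mem_filter.1 hj).2⟩
  have hns2 : n ∈ s.filter fun j => lam j = lam n := Finset.mem_filter.2 ⟨hns, rfl⟩
  have hsimple : HasSimpleZeros (linComb s V c₀) := by
    rw [hfil]
    exact (hE.isSolution_linComb h hs2 a).hasSimpleZeros h
      (hE.linComb_ne_zero h (fun j hj => (hs2 j hj).1) hns2 ha)
  have hsm := hE.contDiff h hs1
  obtain ⟨k, hk, hk'⟩ := (eventually_zeroSet_encard_eq hsm (hE.periodic hs1) hsimple hlim).exists
  calc zeroCount (linComb s V a)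
      ≤ zeroCount (linComb s V fun j => a j * (lam j - lam 1) ^ k) :=
        (zeroCount_linComb_le h (hE.solution 1 le_rfl) (hE.ground_ne_zero h (hE.solution 1 le_rfl)
          (hE.ne_zero h le_rfl)) (fun j hj => hE.solution j (hs1 j hj)) a k).1
    _ ≤ zeroCount (linComb s V (c k)) := zeroCount_linComb_le_const_mul hsm _ _
    _ = (zeroSet (V n)).encard := by
        rw [zeroCount_eq_encard hk, hk', hfil, hE.encard_zeroSet_linComb h hs2 hns2 ha]

/-- Run the iteration backward: dividing coefficients by powers of `λ_j - λ₁` makes the part for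
`λ_m` dominate. Its alternations pass to a late backward iterate and return to the original
combination by forward iteration. -/
theorem encard_le_signChangeCount (h : IsRegular K G Q) (hE : IsEigenbasis K G Q lam V)
    {m n : ℕ} (hm : 1 ≤ m) (hmn : m ≤ n) {a : ℕ → ℝ} (ham : a m ≠ 0) (han : a n ≠ 0) :
    (zeroSet (V m)).encard ≤ signChangeCount (linComb (Finset.Icc m n) V a) := by
  obtain ⟨N, hN, -⟩ := (hE.solution m hm).exists_encard_eq h (hE.ne_zero h hm)
  rw [hN]
  -- If `V m` has no zeros nothing is claimed; otherwise `m ≥ 2`, so every `lam j - lam 1` in the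
  -- sum is invertible.
  rcases Nat.eq_zero_or_pos N with rfl | hNpos
  · simp
  have hm2 : 2 ≤ m := by
    by_contra! hlt
    obtain rfl : m = 1 := by omega
    have : zeroSet (V 1) = ∅ := Set.eq_empty_of_forall_notMem fun t ht =>
      hE.ground_ne_zero h (hE.solution 1 le_rfl) (hE.ne_zero h le_rfl) t ht.2
    rw [this, Set.encard_empty] at hN
    have : N = 0 := by exact_mod_cast hN.symm
    omega
  set s := Finset.Icc m n with hs
  have hsm : ∀ j ∈ s, m ≤ j := fun j hj => (Finset.mem_Icc.1 hj).1
  have hs1 : ∀ j ∈ s, 1 ≤ j := fun j hj => hm.trans (hsm j hj)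
  have hms : m ∈ s := Finset.mem_Icc.2 ⟨le_rfl, hmn⟩
  have hjpos : ∀ j ∈ s, 0 < lam j - lam 1 := fun j hj =>
    sub_pos.2 (hE.lam_one_lt h (hm2.trans (hsm j hj)))
  set r := lam m - lam 1 with hr
  have hrpos : 0 < r := hjpos m hms
  let c₀ : ℕ → ℝ := fun j => if lam j = lam m then a j else 0
  let c : ℕ → ℕ → ℝ := fun k j => a j * (r / (lam j - lam 1)) ^ k
  have hlim : ∀ j ∈ s, Tendsto (fun k => c k j) atTop (𝓝 (c₀ j)) := fun j hj => by
    by_cases hj2 : lam j = lam m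
    · have : r / (lam j - lam 1) = 1 := by rw [hj2, div_self hrpos.ne']
      simp only [c, this, c₀, if_pos hj2, one_pow, mul_one]
      exact tendsto_const_nhds
    · have h1 : 0 ≤ r / (lam j - lam 1) := (div_pos hrpos (hjpos j hj)).le
      have h2 : r / (lam j - lam 1) < 1 := by
        rw [div_lt_one (hjpos j hj)]
        have := lt_of_le_of_ne (hE.monotone hm (hsm j hj)) (Ne.symm hj2)
        linarith
      simpa [c, c₀, hj2] using (tendsto_pow_atTop_nhds_zero_of_lt_one h1 h2).const_mul (a j)
  have hfil : linComb s V c₀ = linComb (s.filter fun j => lam j = lam m) V a := by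
    funext t
    simp only [linComb, Finset.sum_filter, c₀]
    exact Finset.sum_congr rfl fun j _ => by split_ifs <;> simp
  have hs2 : ∀ j ∈ s.filter fun j => lam j = lam m, 1 ≤ j ∧ lam j = lam m := fun j hj =>
    ⟨hs1 j (Finset.mem_filter.1 hj).1, (Finset.mem_filter.1 hj).2⟩
  have hms2 : m ∈ s.filter fun j => lam j = lam m := Finset.mem_filter.2 ⟨hms, rfl⟩
  have hsol : IsSolution K G Q (lam m) (linComb s V c₀) := by
    rw [hfil]
    exact hE.isSolution_linComb h hs2 a
  have halt : Alternates (linComb s V c₀) N := by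
    refine HasSimpleZeros.alternates (hsol.hasSimpleZeros h ?_) hsol.differentiable hsol.2.1 ?_ hNpos
    · rw [hfil]
      exact hE.linComb_ne_zero h (fun j hj => (hs2 j hj).1) hms2 ham
    · rw [hfil, hE.encard_zeroSet_linComb h hs2 hms2 ham, hN]
  obtain ⟨k, hk⟩ := (halt.eventually (l := atTop) (F := fun k => linComb s V (c k)) fun t =>
    tendsto_finsetSum _ fun j hj => (hlim j hj).mul_const _).exists
  have h1 := (zeroCount_linComb_le h (hE.solution 1 le_rfl) (hE.ground_ne_zero h
    (hE.solution 1 le_rfl) (hE.ne_zero h le_rfl)) (fun j hj => hE.solution j (hs1 j hj))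
    (c k) k).2 N hk
  have h2 := h1.linComb_const_mul (c := (r ^ k)⁻¹) (inv_ne_zero (pow_ne_zero k hrpos.ne'))
  have h3 : (linComb s V fun j => (r ^ k)⁻¹ * (c k j * (lam j - lam 1) ^ k)) = linComb s V a := by
    funext t
    refine Finset.sum_congr rfl fun j hj => ?_
    have := (hjpos j hj).ne'
    simp only [c, div_pow]
    field_simp
  rw [h3] at h2
  refine h2.le_signChangeCount (contDiff_linComb (hE.contDiff h hs1) a).continuous
    (periodic_linComb (hE.periodic hs1) a) ?_
  -- Sign alternations yield sign changes only when zeros are finite in number, which the upper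
  -- bound supplies.
  refine Set.encard_ne_top_iff.1 (ne_top_of_le_ne_top ?_
    ((zeroSet_encard_le_zeroCount _).trans (hE.zeroCount_linComb_le_encard h hm hmn han)))
  exact Set.encard_ne_top_iff.2 ((hE.hasSimpleZeros h (hm.trans hmn)).finite_zeroSet
    (hE.solution n (hm.trans hmn)).differentiable)

/-! ### Exact zero counts and strict inequalities -/

/-- Both bounds applied to the sum `V m + ⋯ + V n`. -/
theorem encard_zeroSet_mono (h : IsRegular K G Q) (hE : IsEigenbasis K G Q lam V)
    {m n : ℕ} (hm : 1 ≤ m) (hmn : m ≤ n) : (zeroSet (V m)).encard ≤ (zeroSet (V n)).encard := by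
  have hs1 : ∀ j ∈ Finset.Icc m n, 1 ≤ j := fun j hj => hm.trans (Finset.mem_Icc.1 hj).1
  exact (hE.encard_le_signChangeCount h (a := fun _ => 1) hm hmn one_ne_zero one_ne_zero).trans <|
    (signChangeCount_le_encard (contDiff_linComb (hE.contDiff h hs1) _).continuous).trans <|
    (zeroSet_encard_le_zeroCount _).trans <|
    hE.zeroCount_linComb_le_encard h hm hmn one_ne_zero

/-- A nontrivial combination of `n + 1` eigenfunctions can be made to vanish at `n` given points.
Its highest eigenfunction actually present has at least `n` zeros, and counts are monotone in the
index. -/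
theorem le_encard_zeroSet (h : IsRegular K G Q) (hE : IsEigenbasis K G Q lam V) (n : ℕ) :
    n ≤ (zeroSet (V (n + 1))).encard := by
  let x : ℕ → ℝ := fun i => 2 * π * (i / (n + 1 : ℝ))
  have hx : ∀ i < n, x i ∈ Ico 0 (2 * π) := fun i hi => by
    have h1 : (i : ℝ) < n := by exact_mod_cast hi
    refine ⟨by positivity, ?_⟩
    have h2 : (i : ℝ) / (n + 1 : ℝ) < 1 := by
      rw [div_lt_one (by positivity)]
      linarith
    simpa [x] using mul_lt_mul_of_pos_left h2 two_pi_pos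
  have hxinj : Function.Injective x := fun i j hij => by
    have h1 := mul_left_cancel₀ two_pi_pos.ne' hij
    rw [div_left_inj' (by positivity)] at h1
    exact_mod_cast h1
  obtain ⟨c, hc, hc0⟩ := exists_ne_zero_forall_sum_eq_zero (Nat.lt_succ_self n)
    fun (i : Fin n) (j : Fin (n + 1)) => V (j + 1) (x i)
  obtain ⟨j₀, hj₀⟩ := Function.ne_iff.1 hc
  -- The index is shifted by one; the value at `0` is irrelevant, since only indices from `1` on are
  -- summed.
  let a : ℕ → ℝ := fun j => if hj : j - 1 < n + 1 then c ⟨j - 1, hj⟩ else 0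
  set T := (Finset.Icc 1 (n + 1)).filter fun j => a j ≠ 0 with hT
  have hTne : T.Nonempty := ⟨j₀ + 1, Finset.mem_filter.2
    ⟨Finset.mem_Icc.2 ⟨by omega, by have := j₀.2; omega⟩, by
      have := j₀.2
      simpa [a, Nat.lt_succ_iff.1 this] using hj₀⟩⟩
  set p := T.max' hTne with hp
  obtain ⟨hpI, hap⟩ := Finset.mem_filter.1 (T.max'_mem hTne)
  have hpI := Finset.mem_Icc.1 hpI
  have hsum : ∀ t, linComb (Finset.Icc 1 p) V a t = ∑ j : Fin (n + 1), c j * V (j + 1) t := by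
    intro t
    have h1 : linComb (Finset.Icc 1 p) V a t = linComb (Finset.Icc 1 (n + 1)) V a t := by
      refine Finset.sum_subset (Finset.Icc_subset_Icc le_rfl hpI.2) fun j hj hjp => ?_
      have : a j = 0 := by
        by_contra h0
        exact hjp (Finset.mem_Icc.2 ⟨(Finset.mem_Icc.1 hj).1,
          T.le_max' j (Finset.mem_filter.2 ⟨hj, h0⟩)⟩)
      rw [this, zero_mul]
    rw [h1, linComb, sum_Icc_one, ← Fin.sum_univ_eq_sum_range fun i => a (i + 1) * V (i + 1) t]
    refine Finset.sum_congr rfl fun j _ => ?_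
    have := j.2
    simp only [a, Nat.add_sub_cancel, this, dif_pos]
  have hz : ∀ i < n, linComb (Finset.Icc 1 p) V a (x i) = 0 := fun i hi => by
    rw [hsum]
    exact hc0 ⟨i, hi⟩
  calc (n : ℕ∞) = (((Finset.range n).image x : Finset ℝ) : Set ℝ).encard := by
        rw [Set.encard_coe_eq_coe_finsetCard, Finset.card_image_of_injective _ hxinj,
          Finset.card_range]
    _ ≤ (zeroSet (linComb (Finset.Icc 1 p) V a)).encard := Set.encard_le_encard fun t ht => by
        simp only [Finset.coe_image, mem_image, Finset.coe_range, mem_Iio] at ht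
        obtain ⟨i, hi, rfl⟩ := ht
        exact ⟨hx i hi, hz i hi⟩
    _ ≤ zeroCount (linComb (Finset.Icc 1 p) V a) := zeroSet_encard_le_zeroCount _
    _ ≤ (zeroSet (V p)).encard := hE.zeroCount_linComb_le_encard h le_rfl hpI.1 hap
    _ ≤ (zeroSet (V (n + 1))).encard := hE.encard_zeroSet_mono h hpI.1 hpI.2

/-- The number of zeros is even and lies between `i - 1` and `i`. -/
theorem encard_zeroSet_eq (h : IsRegular K G Q) (hE : IsEigenbasis K G Q lam V) {j i : ℕ}
    (hj : 1 ≤ j) (hi : i = 2 * j ∨ i = 2 * j + 1) : (zeroSet (V i)).encard = (2 * j : ℕ) := by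
  have hi1 : 1 ≤ i := by omega
  obtain ⟨N, hN, k, hk⟩ := (hE.solution i hi1).exists_encard_eq h (hE.ne_zero h hi1)
  have h1 := hE.encard_zeroSet_le h hi1 (hE.solution i hi1) (hE.ne_zero h hi1)
  have h2 := hE.le_encard_zeroSet h (i - 1)
  rw [Nat.sub_add_cancel hi1] at h2
  rw [hN] at h1 h2 ⊢
  have h1 : N ≤ i := by exact_mod_cast h1
  have h2 : i - 1 ≤ N := by exact_mod_cast h2
  congr 1
  omega

/-- If the two eigenvalues agreed, the sum of the two eigenfunctions would have both `2k` and `2k +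
2` zeros. -/
theorem lam_lt (h : IsRegular K G Q) (hE : IsEigenbasis K G Q lam V) {k : ℕ} (hk : 1 ≤ k) :
    lam (2 * k + 1) < lam (2 * k + 2) := by
  refine lt_of_le_of_ne (hE.mono _ (by omega)) fun heq => ?_
  have hs : ∀ j ∈ ({2 * k + 1, 2 * k + 2} : Finset ℕ), 1 ≤ j ∧ lam j = lam (2 * k + 1) := by
    intro j hj
    simp only [Finset.mem_insert, Finset.mem_singleton] at hj
    rcases hj with rfl | rfl
    · exact ⟨by omega, rfl⟩
    · exact ⟨by omega, heq.symm⟩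
  have h1 := hE.encard_zeroSet_linComb h hs (a := fun _ => 1) (p := 2 * k + 1) (by simp) one_ne_zero
  have h2 := hE.encard_zeroSet_linComb h hs (a := fun _ => 1) (p := 2 * k + 2) (by simp) one_ne_zero
  rw [h1, hE.encard_zeroSet_eq h hk (Or.inr rfl),
    hE.encard_zeroSet_eq h (show 1 ≤ k + 1 by omega) (Or.inl (by ring))] at h2
  have : 2 * k = 2 * (k + 1) := by exact_mod_cast h2
  omega

end IsEigenbasis

/-! ### Diagonalization of compact operators -/

/-- A function on an infinite type with finite sublevel sets can be enumerated in nondecreasing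
order. -/
theorem exists_equiv_nat_monotone {ι : Type*} [Infinite ι] (σ : ι → ℝ)
    (hσ : ∀ i, {j | σ j ≤ σ i}.Finite) : ∃ e : ℕ ≃ ι, Monotone (σ ∘ e) := by
  -- Order by `σ`, ties broken by a well-ordering; predecessors form finite sets, and their number
  -- is the position in the enumeration.
  let r : ι → ι → Prop := fun i j => σ i < σ j ∨ (σ i = σ j ∧ WellOrderingRel i j)
  have hirr : ∀ i, ¬ r i i := fun i hi => by
    rcases hi with h | ⟨-, h⟩
    · exact lt_irrefl _ h
    · exact irrefl_of WellOrderingRel i h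
  have htrans : ∀ i j k, r i j → r j k → r i k := fun i j k h1 h2 => by
    rcases h1 with h1 | ⟨h1, h1'⟩ <;> rcases h2 with h2 | ⟨h2, h2'⟩
    · exact Or.inl (h1.trans h2)
    · exact Or.inl (h2 ▸ h1)
    · exact Or.inl (h1 ▸ h2)
    · exact Or.inr ⟨h1.trans h2, trans_of WellOrderingRel h1' h2'⟩
  have htri : ∀ i j, i ≠ j → r i j ∨ r j i := fun i j hij => by
    rcases lt_trichotomy (σ i) (σ j) with h | h | h
    · exact Or.inl (Or.inl h)
    · rcases trichotomous_of WellOrderingRel i j with h' | h' | h'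
      · exact Or.inl (Or.inr ⟨h, h'⟩)
      · exact absurd h' hij
      · exact Or.inr (Or.inr ⟨h.symm, h'⟩)
    · exact Or.inr (Or.inl h)
  have hfin : ∀ i, {j | r j i}.Finite := fun i => (hσ i).subset fun j hj => by
    rcases hj with h | h
    · exact h.le
    · exact h.1.le
  let rank : ι → ℕ := fun i => {j | r j i}.ncard
  have hmono : ∀ i j, r i j → rank i < rank j := fun i j hij =>
    Set.ncard_lt_ncard ⟨fun k hk => htrans k i j hk hij, fun h => hirr i (h hij)⟩ (hfin j)
  have hinj : Function.Injective rank := fun i j hij => by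
    by_contra hne
    rcases htri i j hne with h | h
    · exact (hmono i j h).ne hij
    · exact (hmono j i h).ne hij.symm
  have hsurj : Function.Surjective rank := fun n => by
    -- Some position exceeds `n`. The predecessors of that element inject into the smaller numbers
    -- and are equally many, so they fill them and reach `n`.
    obtain ⟨-, ⟨i, rfl⟩, hi⟩ := (Set.infinite_range_of_injective hinj).exists_gt n
    obtain ⟨j, -, hj⟩ := Set.surj_on_of_inj_on_of_ncard_le (s := {j | r j i}) (t := Set.Iio (rank i))
      (fun j _ => rank j) (fun j hj => hmono j i hj) (fun j k _ _ h => hinj h) (by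
        rw [Set.ncard_eq_toFinset_card' (Set.Iio (rank i))]
        simp [rank]) (Set.finite_Iio _) n hi
    exact ⟨j, hj.symm⟩
  let e := Equiv.ofBijective rank ⟨hinj, hsurj⟩
  refine ⟨e.symm, fun n m hnm => ?_⟩
  by_contra! hlt
  have h1 := hmono _ _ (Or.inl hlt : r (e.symm m) (e.symm n))
  have h2 : ∀ k, rank (e.symm k) = k := fun k => e.apply_symm_apply k
  rw [h2, h2] at h1
  omega

section Compact

variable {H : Type*} [NormedAddCommGroup H] [InnerProductSpace ℝ H]

/-- An orthonormal family of eigenvectors of a compact operator has only finitely many members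
with eigenvalue at least `ε > 0`. -/
theorem finite_setOf_le_eigenvalue {ι : Type*} {R : H →L[ℝ] H} (hc : IsCompactOperator R)
    {b : ι → H} (hb : Orthonormal ℝ b) {τ : ι → ℝ} (hτ : ∀ i, R (b i) = τ i • b i) {ε : ℝ}
    (hε : 0 < ε) : {i | ε ≤ τ i}.Finite := by
  -- Pairing with `b i` shows that `‖R (b i) - R (b j)‖ ≥ τ i`, so infinitely many such images could
  -- not accumulate.
  have hsep : ∀ i j, ε ≤ τ i → i ≠ j → ε ≤ dist (R (b i)) (R (b j)) := fun i j hi hij => by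
    have h1 : inner ℝ (b i) (R (b i) - R (b j)) = τ i := by
      rw [hτ, hτ, inner_sub_right, inner_smul_right, inner_smul_right, hb.2 hij,
        real_inner_self_eq_norm_sq, hb.1 i]
      simp
    have h2 := real_inner_le_norm (b i) (R (b i) - R (b j))
    rw [h1, hb.1 i, one_mul] at h2
    rw [dist_eq_norm]
    linarith
  by_contra hinf
  obtain ⟨C, hC, hCsub⟩ := IsCompactOperator.image_closedBall_subset_compact (f := (R : H →ₗ[ℝ] H))
    hc 1
  have hinj : InjOn (fun i => R (b i)) {i | ε ≤ τ i} := fun i hi j _ hij => by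
    by_contra hne
    have := hsep i j hi hne
    rw [show R (b i) = R (b j) from hij, dist_self] at this
    linarith
  obtain ⟨x, -, hx⟩ := Set.Infinite.exists_accPt_of_subset_isCompact
    (Set.Infinite.image hinj hinf) hC (by
      rintro - ⟨i, -, rfl⟩
      exact hCsub ⟨b i, by simp [hb.1 i], rfl⟩)
  rw [accPt_iff_frequently_nhdsNE] at hx
  have hball : ∀ δ > 0, ∃ y ∈ (fun i => R (b i)) '' {i | ε ≤ τ i}, y ≠ x ∧ dist y x < δ :=
    fun δ hδ => by
      obtain ⟨y, hy, hy1, hy2⟩ := (hx.and_eventually ((eventually_mem_nhdsWithin (s := {x}ᶜ)).and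
        (eventually_nhdsWithin_of_eventually_nhds (Metric.ball_mem_nhds x hδ)))).exists
      exact ⟨y, hy, hy1, hy2⟩
  obtain ⟨-, ⟨i, hi, rfl⟩, hix, hid⟩ := hball (ε / 2) (by positivity)
  -- Choosing the second image closer to `x` than the first makes the indices distinct.
  obtain ⟨-, ⟨j, hj, rfl⟩, hjx, hjd⟩ := hball (min (ε / 2) (dist (R (b i)) x))
    (lt_min (by positivity) (dist_pos.2 hix))
  have hij : i ≠ j := by
    rintro rfl
    exact lt_irrefl _ (hjd.trans_le (min_le_right _ _))
  have h1 := hsep i j hi hij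
  have h2 := dist_triangle_right (R (b i)) (R (b j)) x
  have h3 := hjd.trans_le (min_le_left _ _)
  simp only at hid
  linarith

variable [CompleteSpace H]

/-- The spectral theorem for positive compact operators, with eigenvalues in nonincreasing
order. -/
theorem exists_hilbertBasis_eigenvectors {R : H →L[ℝ] H} (hc : IsCompactOperator R)
    (hs : (R : H →ₗ[ℝ] H).IsSymmetric) (hpos : ∀ f, f ≠ 0 → 0 < inner ℝ (R f) f)
    (hdim : ¬ FiniteDimensional ℝ H) :
    ∃ (b : HilbertBasis ℕ ℝ H) (τ : ℕ → ℝ), Antitone τ ∧ ∀ i, 0 < τ i ∧ R (b i) = τ i • b i := by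
  have hfd : ∀ μ : ℝ, FiniteDimensional ℝ (Module.End.eigenspace (R : H →ₗ[ℝ] H) μ) := fun μ => by
    rcases eq_or_ne μ 0 with rfl | hμ
    · have : Module.End.eigenspace (R : H →ₗ[ℝ] H) 0 = ⊥ := by
        rw [Submodule.eq_bot_iff]
        intro x hx
        by_contra hne
        have h1 := Module.End.mem_eigenspace_iff.1 hx
        have h2 := hpos x hne
        rw [show R x = 0 by simpa using h1] at h2
        simp at h2
      rw [this]
      infer_instance
    · exact ContinuousLinearMap.finite_dimensional_eigenspace hc μ hμ
  let ι := Σ μ : ℝ, Fin (Module.finrank ℝ (Module.End.eigenspace (R : H →ₗ[ℝ] H) μ))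
  let v : ι → H := fun i => (stdOrthonormalBasis ℝ (Module.End.eigenspace (R : H →ₗ[ℝ] H) i.1) i.2 : H)
  have hv : Orthonormal ℝ v := hs.orthogonalFamily_eigenspaces.orthonormal_sigma_orthonormal
    (v_family := fun μ => stdOrthonormalBasis ℝ (Module.End.eigenspace (R : H →ₗ[ℝ] H) μ))
    fun μ => (stdOrthonormalBasis ℝ _).orthonormal
  have hRv : ∀ i, R (v i) = i.1 • v i := fun i =>
    Module.End.mem_eigenspace_iff.1
      (stdOrthonormalBasis ℝ (Module.End.eigenspace (R : H →ₗ[ℝ] H) i.1) i.2).2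
  have hvpos : ∀ i : ι, 0 < i.1 := fun i => by
    have h1 := hpos (v i) (hv.ne_zero i)
    rwa [hRv, inner_smul_left, real_inner_self_eq_norm_sq, hv.1 i, one_pow, mul_one] at h1
  -- The eigenspaces of a compact symmetric operator span a dense subspace, and positivity has
  -- removed the kernel.
  have hspan : (Submodule.span ℝ (Set.range v))ᗮ = ⊥ := by
    rw [eq_bot_iff, ← ContinuousLinearMap.orthogonalComplement_iSup_eigenspaces_eq_bot hc hs]
    refine Submodule.orthogonal_le (iSup_le fun μ x hx => ?_)
    have h1 := (stdOrthonormalBasis ℝ (Module.End.eigenspace (R : H →ₗ[ℝ] H) μ)).sum_repr ⟨x, hx⟩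
    have h2 : ∑ i, (stdOrthonormalBasis ℝ (Module.End.eigenspace (R : H →ₗ[ℝ] H) μ)).repr ⟨x, hx⟩ i •
        v ⟨μ, i⟩ = x := by
      have := congrArg Subtype.val h1
      simpa [v] using this
    rw [← h2]
    exact Submodule.sum_mem _ fun i _ => Submodule.smul_mem _ _ (Submodule.subset_span ⟨_, rfl⟩)
  have hinf : Infinite ι := by
    rw [← not_finite_iff_infinite]
    intro hfin
    have := Fintype.ofFinite ι
    exact hdim (HilbertBasis.mkOfOrthogonalEqBot hv hspan).toOrthonormalBasis.toBasis.finiteDimensional_of_finite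
  obtain ⟨e, he⟩ := exists_equiv_nat_monotone (fun i : ι => -i.1) fun i =>
    (finite_setOf_le_eigenvalue hc hv hRv (hvpos i)).subset fun j hj => by simpa using hj
  have hve : Orthonormal ℝ (v ∘ e) := hv.comp e e.injective
  have hspan' : (Submodule.span ℝ (Set.range (v ∘ e)))ᗮ = ⊥ := by
    rwa [e.surjective.range_comp]
  refine ⟨HilbertBasis.mkOfOrthogonalEqBot hve hspan', fun n => (e n).1, fun n m hnm => ?_,
    fun n => ⟨hvpos _, ?_⟩⟩
  · have := he hnm
    simpa using this
  · rw [HilbertBasis.coe_mkOfOrthogonalEqBot]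
    exact hRv (e n)

variable {E F : Type*} [NormedAddCommGroup E] [InnerProductSpace ℝ E] [CompleteSpace E]
  [NormedAddCommGroup F] [InnerProductSpace ℝ F] [CompleteSpace F]

/-- Eigenvectors of the generalized problem `(1 - e ⊗ e + S* S) x = σ J* J x` give a Hilbert basis
`J x` of the target of `J`. -/
theorem exists_hilbertBasis_generalized (J : E →L[ℝ] H) (S : E →L[ℝ] F) {e : E} (he : ‖e‖ = 1)
    (hJc : IsCompactOperator J) (hJ : ∀ f : H, (∀ x, inner ℝ f (J x) = 0) → f = 0) (hSe : S e ≠ 0)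
    (hdim : ¬ FiniteDimensional ℝ H) :
    ∃ (b : HilbertBasis ℕ ℝ H) (x : ℕ → E) (σ : ℕ → ℝ), Monotone σ ∧ ∀ i, b i = J (x i) ∧
      ∀ y, inner ℝ (x i) y - inner ℝ e (x i) * inner ℝ e y + inner ℝ (S (x i)) (S y) =
        σ i * inner ℝ (J (x i)) (J y) := by
  let T : E →L[ℝ] E := ContinuousLinearMap.id ℝ E - (innerSL ℝ e).smulRight e +
    (ContinuousLinearMap.adjoint S).comp S
  have hT : ∀ x y, inner ℝ (T x) y =
      inner ℝ x y - inner ℝ e x * inner ℝ e y + inner ℝ (S x) (S y) := fun x y => by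
    simp [T, inner_add_left, inner_sub_left, inner_smul_left,
      ContinuousLinearMap.adjoint_inner_left]
  have hTsymm : ∀ x y, inner ℝ (T x) y = inner ℝ x (T y) := fun x y => by
    rw [real_inner_comm (T y) x, hT, hT, real_inner_comm x y, real_inner_comm (S x) (S y)]
    ring
  set M := ‖S‖ with hM
  have hβ : 0 < ‖S e‖ := norm_pos_iff.2 hSe
  set κ := 1 + 2 * (1 + M ^ 2) / ‖S e‖ ^ 2 with hκ
  have hκpos : 0 < κ := by positivity
  -- Coercivity: `T` controls the part `x₀` orthogonal to `e` and the norm of `S x`. Since `S e ≠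
  -- 0`, these two control the missing component `α` along `e`.
  have hcoer : ∀ x, ‖x‖ ^ 2 ≤ κ * inner ℝ (T x) x := fun x => by
    set α := inner ℝ e x with hα
    set x₀ := x - α • e with hx₀
    have h1 : ‖x₀‖ ^ 2 = ‖x‖ ^ 2 - α ^ 2 := by
      rw [hx₀, norm_sub_sq_real, inner_smul_right, norm_smul, he, real_inner_comm, ← hα,
        Real.norm_eq_abs, mul_one, sq_abs]
      ring
    have h2 : inner ℝ (T x) x = ‖x₀‖ ^ 2 + ‖S x‖ ^ 2 := by
      rw [hT, real_inner_self_eq_norm_sq, real_inner_self_eq_norm_sq, h1]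
      ring
    have h3 : |α| * ‖S e‖ ≤ ‖S x‖ + M * ‖x₀‖ := by
      have : α • S e = S x - S x₀ := by simp [hx₀]
      calc |α| * ‖S e‖ = ‖α • S e‖ := by rw [norm_smul, Real.norm_eq_abs]
        _ ≤ ‖S x‖ + ‖S x₀‖ := by rw [this]; exact norm_sub_le _ _
        _ ≤ _ := by gcongr; exact S.le_opNorm x₀
    have h4 : α ^ 2 * ‖S e‖ ^ 2 ≤ 2 * (1 + M ^ 2) * (‖x₀‖ ^ 2 + ‖S x‖ ^ 2) := by
      have h5 : α ^ 2 * ‖S e‖ ^ 2 ≤ (‖S x‖ + M * ‖x₀‖) ^ 2 := by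
        rw [← sq_abs α, ← mul_pow]
        exact pow_le_pow_left₀ (by positivity) h3 2
      nlinarith [sq_nonneg (‖S x‖ - M * ‖x₀‖), mul_nonneg (sq_nonneg M) (sq_nonneg ‖S x‖),
        sq_nonneg ‖x₀‖]
    have h6 : α ^ 2 ≤ 2 * (1 + M ^ 2) / ‖S e‖ ^ 2 * (‖x₀‖ ^ 2 + ‖S x‖ ^ 2) := by
      rw [div_mul_eq_mul_div, le_div_iff₀ (by positivity)]
      exact h4
    rw [h2, hκ]
    nlinarith [sq_nonneg ‖S x‖]
  have hTunit : IsUnit T := by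
    refine T.isUnit_of_forall_le_norm_inner_map (c := κ⁻¹.toNNReal)
      (Real.toNNReal_pos.2 (inv_pos.2 hκpos)) fun x => ?_
    rw [Real.coe_toNNReal _ (inv_pos.2 hκpos).le, ← div_eq_mul_inv, div_le_iff₀ hκpos]
    refine (hcoer x).trans ?_
    rw [mul_comm]
    exact mul_le_mul_of_nonneg_right (le_abs_self _) hκpos.le
  obtain ⟨T', hTT', hT'T⟩ := isUnit_iff_exists.1 hTunit
  have hTT' : ∀ x, T (T' x) = x := fun x => by
    simpa using congrArg (fun A : E →L[ℝ] E => A x) hTT'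
  -- The solution operator `J T⁻¹ J*`. It is positive because `J` has dense range, and `R b = τ b`
  -- means that `x = τ⁻¹ T⁻¹ J* b` satisfies `T x = τ⁻¹ J* J x`.
  let R : H →L[ℝ] H := J.comp (T'.comp (ContinuousLinearMap.adjoint J))
  have hRinner : ∀ f g, inner ℝ (R f) g = inner ℝ (T' (ContinuousLinearMap.adjoint J f))
      (T (T' (ContinuousLinearMap.adjoint J g))) := fun f g => by
    rw [hTT', ContinuousLinearMap.adjoint_inner_right]
    rfl
  have hRc : IsCompactOperator R :=
    hJc.comp_clm (T'.comp (ContinuousLinearMap.adjoint J))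
  have hRs : (R : H →ₗ[ℝ] H).IsSymmetric := fun f g => by
    change inner ℝ (R f) g = inner ℝ f (R g)
    rw [real_inner_comm (R g) f, hRinner, hRinner, ← hTsymm, real_inner_comm]
  have hRpos : ∀ f, f ≠ 0 → 0 < inner ℝ (R f) f := fun f hf => by
    set x := T' (ContinuousLinearMap.adjoint J f) with hx
    have hx0 : x ≠ 0 := fun h0 => hf <| hJ f fun y => by
      have h1 : ContinuousLinearMap.adjoint J f = 0 := by rw [← hTT' (ContinuousLinearMap.adjoint J f), ← hx, h0, map_zero]
      rw [← ContinuousLinearMap.adjoint_inner_left, h1, inner_zero_left]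
    have h2 := hcoer x
    rw [hRinner, ← hTsymm]
    have h3 : 0 < ‖x‖ ^ 2 := by positivity
    exact pos_of_mul_pos_right (h3.trans_le h2) hκpos.le
  obtain ⟨b, τ, hτ, hb⟩ := exists_hilbertBasis_eigenvectors hRc hRs hRpos hdim
  refine ⟨b, fun i => (τ i)⁻¹ • T' (ContinuousLinearMap.adjoint J (b i)), fun i => (τ i)⁻¹,
    fun i j hij => inv_anti₀ (hb j).1 (hτ hij), fun i => ?_⟩
  have hbi : b i = J ((τ i)⁻¹ • T' (ContinuousLinearMap.adjoint J (b i))) := by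
    have : R (b i) = J (T' (ContinuousLinearMap.adjoint J (b i))) := rfl
    rw [map_smul, ← this, (hb i).2, inv_smul_smul₀ (hb i).1.ne']
  refine ⟨hbi, fun y => ?_⟩
  rw [← hbi, ← hT, map_smul, hTT', inner_smul_left, ContinuousLinearMap.adjoint_inner_left]
  rfl

end Compact

/-! ### Existence of an eigenbasis -/

theorem exists_periodic_extension {f : ℝ → ℝ} (hf : ContinuousOn f (Icc 0 (2 * π)))
    (h0 : f 0 = f (2 * π)) : ∃ F : ℝ → ℝ, Continuous F ∧ Function.Periodic F (2 * π) ∧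
      EqOn F f (Icc 0 (2 * π)) := by
  have hp : Fact (0 < 2 * π) := ⟨two_pi_pos⟩
  have hc : Continuous (AddCircle.liftIco (2 * π) 0 f) :=
    AddCircle.liftIco_continuous (by simpa using h0) (by simpa using hf)
  have hper : Function.Periodic (fun t : ℝ => AddCircle.liftIco (2 * π) 0 f (t : AddCircle (2 * π)))
      (2 * π) := fun t => by simp
  have heq : ∀ t ∈ Ico 0 (2 * π), AddCircle.liftIco (2 * π) 0 f (t : AddCircle (2 * π)) = f t :=
    fun t ht => AddCircle.liftIco_coe_apply (by simpa using ht)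
  refine ⟨fun t => AddCircle.liftIco (2 * π) 0 f (t : AddCircle (2 * π)),
    hc.comp (AddCircle.continuous_mk' _), hper, fun t ht => ?_⟩
  rcases ht.2.lt_or_eq with h | rfl
  · exact heq t ⟨ht.1, h⟩
  · have h1 := hper 0
    simp only [zero_add] at h1
    simp only [h1]
    rw [heq 0 ⟨le_rfl, two_pi_pos⟩, h0]

/-! ### Compact operators given by a continuous curve of functionals -/

section CurveOperator

variable {E : Type*} [NormedAddCommGroup E] [InnerProductSpace ℝ E]

/-- The function `t ↦ ⟪κ t, g⟫` on one closed period. -/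
def curveFun (κ : C(Icc (0 : ℝ) (2 * π), E)) (g : E) :
    BoundedContinuousFunction (Icc (0 : ℝ) (2 * π)) ℝ :=
  BoundedContinuousFunction.mkOfCompact ⟨fun t => inner ℝ (κ t) g, by fun_prop⟩

/-- The projection of the real line onto one closed period. -/
def projPeriod : C(ℝ, Icc (0 : ℝ) (2 * π)) := ⟨projIcc 0 (2 * π) two_pi_pos.le, continuous_projIcc⟩

theorem projPeriod_of_mem {t : ℝ} (ht : t ∈ Icc 0 (2 * π)) : projPeriod t = ⟨t, ht⟩ :=
  projIcc_of_mem two_pi_pos.le ht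

theorem norm_curveFun_le (κ : C(Icc (0 : ℝ) (2 * π), E)) (g : E) : ‖curveFun κ g‖ ≤ ‖κ‖ * ‖g‖ :=
  BoundedContinuousFunction.norm_le (by positivity) |>.2 fun t =>
    (norm_inner_le_norm _ _).trans (mul_le_mul_of_nonneg_right (κ.norm_coe_le_norm t) (norm_nonneg _))

/-- The operator `g ↦ (t ↦ ⟪κ t, g⟫)` into `L²`. -/
def curveOp (κ : C(Icc (0 : ℝ) (2 * π), E)) (ν : Measure ℝ) [IsFiniteMeasure ν] :
    E →L[ℝ] Lp ℝ 2 ν :=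
  LinearMap.mkContinuous
    { toFun := fun g => BoundedContinuousFunction.toLp 2 ν ℝ ((curveFun κ g).compContinuous projPeriod)
      map_add' := fun g g' => by
        rw [← map_add]
        congr 1
        ext t
        simp [curveFun, inner_add_right]
      map_smul' := fun c g => by
        rw [RingHom.id_apply, ← map_smul]
        congr 1
        ext t
        simp [curveFun, inner_smul_right] }
    (‖BoundedContinuousFunction.toLp (E := ℝ) 2 ν ℝ‖ * ‖κ‖) fun g => by
      rw [mul_assoc]
      refine ((BoundedContinuousFunction.toLp (E := ℝ) 2 ν ℝ).le_opNorm _).trans ?_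
      gcongr
      refine le_trans ?_ (norm_curveFun_le κ g)
      exact (BoundedContinuousFunction.norm_le (norm_nonneg _)).2 fun t =>
        (curveFun κ g).norm_coe_le_norm _

variable (κ : C(Icc (0 : ℝ) (2 * π), E)) (ν : Measure ℝ) [IsFiniteMeasure ν]

theorem curveOp_ae_eq (g : E) : curveOp κ ν g =ᵐ[ν] fun t => inner ℝ (κ (projPeriod t)) g :=
  BoundedContinuousFunction.coeFn_toLp 2 ν ℝ _

/-- Arzelà–Ascoli: on the unit ball the functions `t ↦ ⟪κ t, g⟫` are bounded by `‖κ‖` and share the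
modulus of continuity of `κ`. -/
theorem isCompactOperator_curveOp : IsCompactOperator (curveOp κ ν) := by
  have hA : IsCompact (closure (curveFun κ '' Metric.closedBall 0 1)) := by
    refine BoundedContinuousFunction.arzela_ascoli (Metric.closedBall 0 ‖κ‖)
      (isCompact_closedBall _ _) _ ?_ ?_
    · rintro - t ⟨g, hg, rfl⟩
      rw [mem_closedBall_zero_iff] at hg ⊢
      exact ((curveFun κ g).norm_coe_le_norm t).trans ((norm_curveFun_le κ g).trans
        (mul_le_of_le_one_right (norm_nonneg _) hg))
    · intro t
      rw [Metric.equicontinuousAt_iff]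
      intro ε hε
      obtain ⟨δ, hδ, h⟩ := Metric.continuousAt_iff.1 (κ.continuous.continuousAt (x := t)) ε hε
      refine ⟨δ, hδ, fun s hs => ?_⟩
      rintro ⟨-, g, hg, rfl⟩
      rw [mem_closedBall_zero_iff] at hg
      rw [dist_comm, Real.dist_eq]
      change |inner ℝ (κ s) g - inner ℝ (κ t) g| < ε
      rw [← inner_sub_left]
      refine (abs_real_inner_le_norm _ _).trans_lt (lt_of_le_of_lt ?_ (h hs))
      rw [dist_eq_norm]
      exact mul_le_of_le_one_right (norm_nonneg _) hg
  refine (isCompactOperator_iff_image_closedBall_subset_compact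
    (curveOp κ ν : E →ₗ[ℝ] Lp ℝ 2 ν) one_pos).2 ⟨_, hA.image
    ((BoundedContinuousFunction.toLp (E := ℝ) 2 ν ℝ).continuous.comp
      (BoundedContinuousFunction.continuous_compContinuous projPeriod)), ?_⟩
  rintro - ⟨g, hg, rfl⟩
  exact ⟨curveFun κ g, subset_closure ⟨g, hg, rfl⟩, rfl⟩

end CurveOperator

/-- Polynomials embed, since one vanishing almost everywhere on the period has infinitely many
roots. -/
theorem not_finiteDimensional_Lp (hG : Continuous G) (hpos : ∀ t, 0 < G t) :
    ¬ FiniteDimensional ℝ (Lp ℝ 2 (weightMeasure G)) := by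
  intro hfin
  have := isFiniteMeasure_weightMeasure hG
  let T : Polynomial ℝ →ₗ[ℝ] Lp ℝ 2 (weightMeasure G) :=
    { toFun := fun p => BoundedContinuousFunction.toLp 2 (weightMeasure G) ℝ
        ((BoundedContinuousFunction.mkOfCompact
          ⟨fun t : Icc (0 : ℝ) (2 * π) => p.eval (t : ℝ), by fun_prop⟩).compContinuous projPeriod)
      map_add' := fun p q => by
        rw [← map_add]
        congr 1
        ext t
        simp
      map_smul' := fun c p => by
        rw [RingHom.id_apply, ← map_smul]
        congr 1
        ext t
        simp }
  have hT : Function.Injective T := by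
    rw [← LinearMap.ker_eq_bot, LinearMap.ker_eq_bot']
    intro p hp
    have h1 : T p =ᵐ[weightMeasure G] fun t => p.eval ((projPeriod t : Icc (0 : ℝ) (2 * π)) : ℝ) :=
      BoundedContinuousFunction.coeFn_toLp 2 (weightMeasure G) ℝ _
    rw [hp] at h1
    have h2 : (fun t => p.eval ((projPeriod t : Icc (0 : ℝ) (2 * π)) : ℝ)) =ᵐ[weightMeasure G]
        fun _ => 0 := h1.symm.trans (Lp.coeFn_zero _ _ _)
    have h3 := eqOn_of_ae_eq_weightMeasure hG hpos (by fun_prop) continuous_const h2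
    refine Polynomial.eq_zero_of_infinite_isRoot p ((Icc_infinite two_pi_pos).mono fun t ht => ?_)
    have h4 := h3 ht
    simp only [projPeriod_of_mem ht] at h4
    exact h4
  exact Polynomial.not_finite (R := ℝ) (Module.Finite.of_injective T hT)

/-! ### The Hilbert space of fluxes and its evaluation functionals -/

section Green

/-- The indicator function of `(0, t]` in `L²(k dt)`. -/
def charLp {k : ℝ → ℝ} (hk : Continuous k) (t : ℝ) : Lp ℝ 2 (weightMeasure k) :=
  have := isFiniteMeasure_weightMeasure hk
  indicatorConstLp 2 (measurableSet_Ioc (a := 0) (b := t)) (measure_ne_top _ _) (1 : ℝ)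

variable {k : ℝ → ℝ}

theorem charLp_ae_eq (hk : Continuous k) (t : ℝ) :
    charLp hk t =ᵐ[weightMeasure k] (Ioc 0 t).indicator fun _ => 1 :=
  have := isFiniteMeasure_weightMeasure hk
  indicatorConstLp_coeFn (hs := measurableSet_Ioc) (hμs := measure_ne_top _ _)

theorem wInner_indicator {f : ℝ → ℝ} {t : ℝ} (ht : t ∈ Icc 0 (2 * π)) :
    wInner k ((Ioc 0 t).indicator fun _ => 1) f = ∫ s in 0..t, k s * f s := by
  have h1 : ∀ s, k s * ((Ioc 0 t).indicator (fun _ => (1 : ℝ)) s * f s) =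
      (Ioc 0 t).indicator (fun s => k s * f s) s := fun s => by
    by_cases h : s ∈ Ioc 0 t <;> simp [h]
  simp only [wInner, h1]
  rw [intervalIntegral.integral_of_le two_pi_pos.le, intervalIntegral.integral_of_le ht.1,
    setIntegral_indicator measurableSet_Ioc, inter_eq_right.2 (Ioc_subset_Ioc le_rfl ht.2)]

theorem inner_charLp (hk : Continuous k) (hkpos : ∀ t, 0 < k t) {F : Lp ℝ 2 (weightMeasure k)}
    {f : ℝ → ℝ} (hF : F =ᵐ[weightMeasure k] f) {t : ℝ} (ht : t ∈ Icc 0 (2 * π)) :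
    inner ℝ (charLp hk t) F = ∫ s in 0..t, k s * f s := by
  rw [inner_eq_wInner hk hkpos (charLp_ae_eq hk t) hF, wInner_indicator ht]

theorem inner_charLp_charLp (hk : Continuous k) (hkpos : ∀ t, 0 < k t) {s t : ℝ}
    (hs : s ∈ Icc 0 (2 * π)) (ht : t ∈ Icc 0 (2 * π)) :
    inner ℝ (charLp hk s) (charLp hk t) = ∫ r in 0..min s t, k r := by
  wlog hst : s ≤ t generalizing s t
  · rw [real_inner_comm, min_comm]
    exact this ht hs (le_of_not_ge hst)
  rw [inner_charLp hk hkpos (charLp_ae_eq hk t) hs, min_eq_left hst]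
  refine intervalIntegral.integral_congr_ae (Eventually.of_forall fun r hr => ?_)
  rw [uIoc_of_le hs.1] at hr
  rw [indicator_of_mem (show r ∈ Ioc 0 t from ⟨hr.1, hr.2.trans hst⟩), mul_one]

theorem continuous_primitive (hk : Continuous k) : Continuous fun t => ∫ s in 0..t, k s :=
  intervalIntegral.continuous_primitive (fun _ _ => hk.intervalIntegrable _ _) 0

/-- The squared distance between two indicators is expressed through the continuous primitive of
`k`. -/
theorem continuous_charLp (hk : Continuous k) (hkpos : ∀ t, 0 < k t) :
    Continuous fun t : Icc (0 : ℝ) (2 * π) => charLp hk t := by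
  refine continuous_iff_continuousAt.2 fun t => ?_
  rw [ContinuousAt, tendsto_iff_norm_sub_tendsto_zero]
  have h1 : ∀ s : Icc (0 : ℝ) (2 * π), ‖charLp hk s - charLp hk t‖ =
      √((∫ r in 0..(s : ℝ), k r) - 2 * (∫ r in 0..min (s : ℝ) t, k r) + ∫ r in 0..(t : ℝ), k r) :=
    fun s => by
      rw [← Real.sqrt_sq (norm_nonneg _), norm_sub_sq_real, ← real_inner_self_eq_norm_sq,
        ← real_inner_self_eq_norm_sq, inner_charLp_charLp hk hkpos s.2 t.2,
        inner_charLp_charLp hk hkpos s.2 s.2, inner_charLp_charLp hk hkpos t.2 t.2, min_self,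
        min_self]
  simp only [h1]
  have hN := continuous_primitive hk
  have h2 : Continuous fun s : Icc (0 : ℝ) (2 * π) =>
      √((∫ r in 0..(s : ℝ), k r) - 2 * (∫ r in 0..min (s : ℝ) t, k r) + ∫ r in 0..(t : ℝ), k r) :=
    (((hN.comp continuous_subtype_val).sub (continuous_const.mul
      (hN.comp (continuous_subtype_val.min continuous_const)))).add continuous_const).sqrt
  convert h2.tendsto t using 2
  rw [min_self, eq_comm, Real.sqrt_eq_zero']
  linarith

/-- The total mass of `k` over one period. -/
def totalMass (k : ℝ → ℝ) : ℝ := ∫ s in 0..2 * π, k s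

theorem totalMass_pos (hk : Continuous k) (hkpos : ∀ t, 0 < k t) : 0 < totalMass k :=
  intervalIntegral.intervalIntegral_pos_of_pos (hk.intervalIntegrable _ _) hkpos two_pi_pos

/-- The normalized constant function in `L²(k dt)`. -/
def unitLp (hk : Continuous k) : Lp ℝ 2 (weightMeasure k) :=
  (√(totalMass k))⁻¹ • charLp hk (2 * π)

theorem two_pi_mem : 2 * π ∈ Icc 0 (2 * π) := ⟨two_pi_pos.le, le_rfl⟩

theorem norm_unitLp (hk : Continuous k) (hkpos : ∀ t, 0 < k t) : ‖unitLp hk‖ = 1 := by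
  have h := totalMass_pos hk hkpos
  have h1 : ‖charLp hk (2 * π)‖ = √(totalMass k) := by
    rw [← Real.sqrt_sq (norm_nonneg _), ← real_inner_self_eq_norm_sq,
      inner_charLp_charLp hk hkpos two_pi_mem two_pi_mem, min_self, totalMass]
  rw [unitLp, norm_smul, h1, norm_inv, Real.norm_of_nonneg (Real.sqrt_nonneg _)]
  exact inv_mul_cancel₀ (Real.sqrt_pos.2 h).ne'

theorem inner_unitLp_charLp (hk : Continuous k) (hkpos : ∀ t, 0 < k t) {t : ℝ}
    (ht : t ∈ Icc 0 (2 * π)) :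
    inner ℝ (unitLp hk) (charLp hk t) = (√(totalMass k))⁻¹ * ∫ s in 0..t, k s := by
  rw [unitLp, real_inner_smul_left, inner_charLp_charLp hk hkpos two_pi_mem ht, min_eq_right ht.2]

/-- The curve representing the evaluation functionals on the space of absolutely continuous
`2π`-periodic functions `u` with `u' / k ∈ L²(k dt)`. -/
def evalCurve (hk : Continuous k) (hkpos : ∀ t, 0 < k t) :
    C(Icc (0 : ℝ) (2 * π), Lp ℝ 2 (weightMeasure k)) where
  toFun t := unitLp hk + charLp hk t -
    ((√(totalMass k))⁻¹ * ∫ s in 0..(t : ℝ), k s) • unitLp hk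
  continuous_toFun := by
    have h1 := continuous_charLp hk hkpos
    have h2 := (continuous_primitive hk).comp (continuous_subtype_val (p := (· ∈ Icc 0 (2 * π))))
    exact (continuous_const.add h1).sub ((continuous_const.mul h2).smul continuous_const)

/-- With `e = unitLp hk`, the function `u t` so represented has `u 0 = ⟪e, g⟫` and `u' / k = g - ⟪e,
g⟫ e`. Removing the constant component makes `u` periodic, and for `k = 1 / K` the integral of `K
u'²` is `‖g‖² - ⟪e, g⟫²`. -/
theorem inner_evalCurve (hk : Continuous k) (hkpos : ∀ t, 0 < k t) {t : ℝ}
    (ht : t ∈ Icc 0 (2 * π)) (g : Lp ℝ 2 (weightMeasure k)) :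
    inner ℝ (evalCurve hk hkpos (projPeriod t)) g = inner ℝ (unitLp hk) g *
      (1 - (√(totalMass k))⁻¹ * ∫ s in 0..t, k s) + inner ℝ (charLp hk t) g := by
  rw [projPeriod_of_mem ht]
  change inner ℝ (unitLp hk + charLp hk t - _) g = _
  rw [inner_sub_left, inner_add_left, real_inner_smul_left]
  ring

theorem inner_evalCurve_unitLp (hk : Continuous k) (hkpos : ∀ t, 0 < k t) {t : ℝ}
    (ht : t ∈ Icc 0 (2 * π)) :
    inner ℝ (evalCurve hk hkpos (projPeriod t)) (unitLp hk) = 1 := by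
  rw [inner_evalCurve hk hkpos ht, real_inner_self_eq_norm_sq, norm_unitLp hk hkpos,
    real_inner_comm, inner_unitLp_charLp hk hkpos ht]
  ring

theorem inner_evalCurve_charLp (hk : Continuous k) (hkpos : ∀ t, 0 < k t) {s t : ℝ}
    (hs : s ∈ Icc 0 (2 * π)) (ht : t ∈ Icc 0 (2 * π)) :
    inner ℝ (evalCurve hk hkpos (projPeriod t)) (charLp hk s) =
      (√(totalMass k))⁻¹ * (∫ r in 0..s, k r) - (totalMass k)⁻¹ * (∫ r in 0..s, k r) *
        (∫ r in 0..t, k r) + ∫ r in 0..min t s, k r := by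
  have h1 : (√(totalMass k))⁻¹ * (√(totalMass k))⁻¹ = (totalMass k)⁻¹ := by
    rw [← mul_inv, Real.mul_self_sqrt (totalMass_pos hk hkpos).le]
  rw [inner_evalCurve hk hkpos ht, inner_unitLp_charLp hk hkpos hs,
    inner_charLp_charLp hk hkpos ht hs, ← h1]
  ring

theorem inner_evalCurve_zero (hk : Continuous k) (hkpos : ∀ t, 0 < k t)
    (g : Lp ℝ 2 (weightMeasure k)) :
    inner ℝ (evalCurve hk hkpos (projPeriod 0)) g = inner ℝ (unitLp hk) g := by
  have h0 : inner ℝ (charLp hk 0) g = 0 := by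
    rw [inner_charLp hk hkpos (f := g) (ae_eq_refl _) ⟨le_rfl, two_pi_pos.le⟩,
      intervalIntegral.integral_same]
  rw [inner_evalCurve hk hkpos ⟨le_rfl, two_pi_pos.le⟩, h0, intervalIntegral.integral_same]
  ring

theorem inner_evalCurve_two_pi (hk : Continuous k) (hkpos : ∀ t, 0 < k t)
    (g : Lp ℝ 2 (weightMeasure k)) :
    inner ℝ (evalCurve hk hkpos (projPeriod (2 * π))) g = inner ℝ (unitLp hk) g := by
  have h := Real.sqrt_pos.2 (totalMass_pos hk hkpos)
  have h1 : ∫ s in 0..2 * π, k s = √(totalMass k) * √(totalMass k) := by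
    rw [Real.mul_self_sqrt (totalMass_pos hk hkpos).le, totalMass]
  rw [inner_evalCurve hk hkpos two_pi_mem, h1, unitLp, real_inner_smul_left]
  field_simp
  ring

/-- The range of the embedding into `L²(G dt)` is dense. -/
theorem eq_zero_of_forall_inner_curveOp_eq_zero {K : ℝ → ℝ} (hK : ContDiff ℝ ∞ K)
    (hk : Continuous fun t => (K t)⁻¹) (hKpos : ∀ t, 0 < K t) (hkpos : ∀ t, 0 < (K t)⁻¹)
    {G : ℝ → ℝ} (hG : Continuous G) (hGpos : ∀ t, 0 < G t) [IsFiniteMeasure (weightMeasure G)]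
    (f : Lp ℝ 2 (weightMeasure G))
    (hf : ∀ x, inner ℝ f (curveOp (evalCurve hk hkpos) (weightMeasure G) x) = 0) : f = 0 := by
  have hmem : ∀ᵐ t ∂weightMeasure G, t ∈ Ioo 0 (2 * π) :=
    (ae_weightMeasure_iff hG hGpos).2 (by
      rw [← Measure.restrict_congr_set Ioo_ae_eq_Ioc]
      exact ae_restrict_mem measurableSet_Ioo)
  have key : ∀ᵐ t ∂weightMeasure G, t ∈ Ioo 0 (2 * π) → f t = 0 := by
    refine isOpen_Ioo.ae_eq_zero_of_integral_contDiff_smul_eq_zero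
      (((Lp.memLp f).integrable (by norm_num)).locallyIntegrable.locallyIntegrableOn _)
      fun g hg hgc hgs => ?_
    have hg0 : ∀ t, t ∉ Ioo 0 (2 * π) → g t = 0 := fun t ht =>
      image_eq_zero_of_notMem_tsupport fun h => ht (hgs h)
    have hd : Continuous (deriv g) := hg.continuous_deriv (by simp)
    obtain ⟨C, hC⟩ := (hgc.deriv.mul_left (f := K)).exists_bound_of_continuous
      (hK.continuous.mul hd)
    -- The test function `g` is the image of its own flux `K g'`, which has no constant component
    -- because `g` vanishes at both ends.
    have hm : MemLp (fun t => K t * deriv g t) 2 (weightMeasure fun t => (K t)⁻¹) :=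
      memLp_weightMeasure hk (hK.continuous.mul hd).measurable hC
    have h1 : ∀ t ∈ Icc 0 (2 * π), inner ℝ (charLp hk t) hm.toLp = g t := fun t ht => by
      rw [inner_charLp hk hkpos hm.coeFn_toLp ht]
      have h2 : ∀ s, (K s)⁻¹ * (K s * deriv g s) = deriv g s := fun s => by
        rw [inv_mul_cancel_left₀ (hKpos s).ne']
      simp only [h2]
      rw [intervalIntegral.integral_deriv_eq_sub (fun s _ => (hg.differentiable (by simp)) s)
        (hd.intervalIntegrable _ _), hg0 0 (by simp), sub_zero]
    have h3 : inner ℝ (unitLp hk) hm.toLp = 0 := by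
      rw [unitLp, real_inner_smul_left, h1 _ two_pi_mem, hg0 _ (by simp), mul_zero]
    have h4 : curveOp (evalCurve hk hkpos) (weightMeasure G) hm.toLp =ᵐ[weightMeasure G] g := by
      filter_upwards [curveOp_ae_eq (evalCurve hk hkpos) (weightMeasure G) hm.toLp, hmem] with t ht h5
      rw [ht, inner_evalCurve hk hkpos (Ioo_subset_Icc_self h5), h3,
        h1 t (Ioo_subset_Icc_self h5)]
      ring
    rw [← hf hm.toLp, L2.inner_def]
    refine integral_congr_ae ?_
    filter_upwards [h4] with t ht
    rw [ht]
    simp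
  refine Lp.ext ?_
  filter_upwards [key, hmem, Lp.coeFn_zero ℝ 2 (weightMeasure G)] with t h1 h2 h3
  rw [h1 h2, h3, Pi.zero_apply]

end Green

/-! ### From the weak to the classical equation -/

/-- A continuous periodic solution of the integrated equation is a classical solution. -/
theorem isSolution_of_integral_equation (h : IsRegular K G Q) (hu : Continuous u)
    (hp : Function.Periodic u (2 * π)) {α d : ℝ}
    (h0 : ∫ t in 0..2 * π, (Q t - μ * G t) * u t = 0)
    (hint : ∀ s ∈ Icc 0 (2 * π), u s = α + d * (∫ t in 0..s, (K t)⁻¹) -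
      (∫ t in 0..s, (Q t - μ * G t) * u t * ∫ r in 0..t, (K r)⁻¹) +
      (∫ t in 0..s, (K t)⁻¹) * ∫ t in 0..s, (Q t - μ * G t) * u t) :
    IsSolution K G Q μ u := by
  have hk : Continuous fun t => (K t)⁻¹ := h.smooth_K.continuous.inv₀ fun t => (h.pos_K t).ne'
  have hr : Continuous fun t => (Q t - μ * G t) * u t :=
    (h.smooth_Q.continuous.sub (continuous_const.mul h.smooth_G.continuous)).mul hu
  have hrp : Function.Periodic (fun t => (Q t - μ * G t) * u t) (2 * π) := fun t => by
    simp only [h.periodic_Q t, h.periodic_G t, hp t]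
  set r : ℝ → ℝ := fun t => (Q t - μ * G t) * u t with hrdef
  set N : ℝ → ℝ := fun s => ∫ t in 0..s, (K t)⁻¹ with hNdef
  set R : ℝ → ℝ := fun s => ∫ t in 0..s, r t with hRdef
  have hNd : ∀ t, HasDerivAt N (K t)⁻¹ t := fun t => hk.integral_hasStrictDerivAt 0 t |>.hasDerivAt
  have hRd : ∀ t, HasDerivAt R (r t) t := fun t => hr.integral_hasStrictDerivAt 0 t |>.hasDerivAt
  -- The vanishing mean of `r` makes the primitive periodic, and with it the flux `d + R`.
  have hRp : Function.Periodic R (2 * π) := fun t => by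
    simp only [hRdef]
    rw [← intervalIntegral.integral_add_adjacent_intervals (b := t) (hr.intervalIntegrable _ _)
      (hr.intervalIntegrable _ _), hrp.intervalIntegral_add_eq t 0, zero_add, h0, add_zero]
  have hNc : Continuous N := continuous_primitive hk
  set w : ℝ → ℝ := fun s => α + d * N s - (∫ t in 0..s, r t * N t) + N s * R s with hwdef
  have hwd : ∀ t, HasDerivAt w ((K t)⁻¹ * (d + R t)) t := fun t => by
    have h1 := (hr.mul hNc).integral_hasStrictDerivAt 0 t |>.hasDerivAt
    have h2 := ((((hNd t).const_mul d).const_add α).sub h1).add ((hNd t).mul (hRd t))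
    refine h2.congr_deriv ?_
    simp only [Pi.mul_apply]
    ring
  have huw : EqOn u w (Icc 0 (2 * π)) := hint
  -- The integral formula is known only on one period. Its right side `w` has periodic derivative
  -- and equal values at `0` and `2π`, hence is periodic and equals `u` everywhere.
  have hwp : Function.Periodic w (2 * π) := by
    have h1 : ∀ t, HasDerivAt (fun s => w (s + 2 * π) - w s) 0 t := fun t => by
      refine (((hwd (t + 2 * π)).comp_add_const t (2 * π)).sub (hwd t)).congr_deriv ?_
      rw [h.periodic_K t, hRp t, sub_self]
    intro t
    have h2 := is_const_of_deriv_eq_zero (fun t => (h1 t).differentiableAt)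
      (fun t => (h1 t).deriv) t 0
    simp only [zero_add] at h2
    rw [← huw two_pi_mem, ← huw ⟨le_rfl, two_pi_pos.le⟩, ← hp 0, zero_add, sub_self] at h2
    exact sub_eq_zero.1 h2
  have heq : u = w := eq_of_eqOn_period hp hwp huw
  have hud : ∀ t, HasDerivAt u ((K t)⁻¹ * (d + R t)) t := by rwa [heq]
  have hdu : deriv u = fun t => (K t)⁻¹ * (d + R t) := funext fun t => (hud t).deriv
  have hR1 : ContDiff ℝ 1 R := contDiff_one_iff_deriv.2
    ⟨fun t => (hRd t).differentiableAt, by rwa [funext fun t => (hRd t).deriv]⟩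
  refine IsSolution.of_hasDerivAt_flux ?_ hp fun t => ?_
  · rw [← one_add_one_eq_two, contDiff_succ_iff_deriv]
    refine ⟨fun t => (hud t).differentiableAt, by simp, ?_⟩
    rw [hdu]
    exact ((h.smooth_K.of_le (by simp)).inv fun t => (h.pos_K t).ne').mul
      (contDiff_const.add hR1)
  · refine ((hRd t).const_add d).congr_of_eventuallyEq (Eventually.of_forall fun s => ?_)
    simp only [hdu]
    exact mul_inv_cancel_left₀ (h.pos_K s).ne' _

/-- Split the integral at `s`; the vanishing mean turns the integral of `r` beyond `s` into minus
the one before it. -/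
theorem integral_mul_primitive_min {r k : ℝ → ℝ} (hr : Continuous r) (hk : Continuous k) {s : ℝ}
    (hs : s ∈ Icc 0 (2 * π)) (h0 : ∫ t in 0..2 * π, r t = 0) :
    ∫ t in 0..2 * π, r t * ∫ x in 0..min t s, k x =
      (∫ t in 0..s, r t * ∫ x in 0..t, k x) - (∫ x in 0..s, k x) * ∫ t in 0..s, r t := by
  have hN := continuous_primitive hk
  have hc : Continuous fun t => r t * ∫ x in 0..min t s, k x :=
    hr.mul (hN.comp (continuous_id.min continuous_const))
  have h1 := intervalIntegral.integral_add_adjacent_intervals (hr.intervalIntegrable (μ := volume) 0 s)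
    (hr.intervalIntegrable s (2 * π))
  have h2 : ∫ t in 0..s, r t * ∫ x in 0..min t s, k x = ∫ t in 0..s, r t * ∫ x in 0..t, k x :=
    intervalIntegral.integral_congr fun t ht => by
      rw [uIcc_of_le hs.1] at ht
      simp only [min_eq_left ht.2]
  have h3 : ∫ t in s..2 * π, r t * ∫ x in 0..min t s, k x =
      (∫ t in s..2 * π, r t) * ∫ x in 0..s, k x := by
    rw [← intervalIntegral.integral_mul_const]
    refine intervalIntegral.integral_congr fun t ht => ?_
    rw [uIcc_of_le hs.2] at ht
    simp only [min_eq_right ht.1]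
  rw [← intervalIntegral.integral_add_adjacent_intervals (hc.intervalIntegrable 0 s)
    (hc.intervalIntegrable s (2 * π)), h2, h3]
  rw [h0] at h1
  linear_combination (∫ x in 0..s, k x) * h1

/-- A vector satisfying the weak form of the eigenvalue equation is represented by a classical
solution. -/
theorem exists_isSolution_of_weak (h : IsRegular K G Q) (hk : Continuous fun t => (K t)⁻¹)
    (hkpos : ∀ t, 0 < (K t)⁻¹) {C σ : ℝ} (hC : ∀ t, 0 < Q t + C * G t)
    [IsFiniteMeasure (weightMeasure G)] [IsFiniteMeasure (weightMeasure fun t => Q t + C * G t)]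
    (x : Lp ℝ 2 (weightMeasure fun t => (K t)⁻¹))
    (hx : ∀ y, inner ℝ x y - inner ℝ (unitLp hk) x * inner ℝ (unitLp hk) y +
      inner ℝ (curveOp (evalCurve hk hkpos) (weightMeasure fun t => Q t + C * G t) x)
        (curveOp (evalCurve hk hkpos) (weightMeasure fun t => Q t + C * G t) y) =
      σ * inner ℝ (curveOp (evalCurve hk hkpos) (weightMeasure G) x)
        (curveOp (evalCurve hk hkpos) (weightMeasure G) y)) :
    ∃ u, IsSolution K G Q (σ - C) u ∧
      curveOp (evalCurve hk hkpos) (weightMeasure G) x =ᵐ[weightMeasure G] u := by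
  have hG := h.smooth_G.continuous
  have hq : Continuous fun t => Q t + C * G t := h.smooth_Q.continuous.add (continuous_const.mul hG)
  set ev : Lp ℝ 2 (weightMeasure fun t => (K t)⁻¹) → ℝ → ℝ :=
    fun y t => inner ℝ (evalCurve hk hkpos (projPeriod t)) y with hev
  have hevc : ∀ y, Continuous (ev y) := fun y => by fun_prop
  obtain ⟨u, huc, hup, hu⟩ := exists_periodic_extension (hevc x).continuousOn
    ((inner_evalCurve_zero hk hkpos x).trans (inner_evalCurve_two_pi hk hkpos x).symm)
  have hmem : ∀ᵐ t ∂weightMeasure G, t ∈ Icc 0 (2 * π) :=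
    (ae_weightMeasure_iff hG h.pos_G).2 ((ae_restrict_mem measurableSet_Ioc).mono
      fun t ht => Ioc_subset_Icc_self ht)
  have hmem' : ∀ᵐ t ∂weightMeasure fun t => Q t + C * G t, t ∈ Icc 0 (2 * π) :=
    (ae_weightMeasure_iff hq hC).2 ((ae_restrict_mem measurableSet_Ioc).mono
      fun t ht => Ioc_subset_Icc_self ht)
  have hJx : curveOp (evalCurve hk hkpos) (weightMeasure G) x =ᵐ[weightMeasure G] u := by
    filter_upwards [curveOp_ae_eq (evalCurve hk hkpos) (weightMeasure G) x, hmem] with t h1 h2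
    rw [h1, hu h2]
  have hSx : curveOp (evalCurve hk hkpos) (weightMeasure fun t => Q t + C * G t) x
      =ᵐ[weightMeasure fun t => Q t + C * G t] u := by
    filter_upwards [curveOp_ae_eq (evalCurve hk hkpos) (weightMeasure fun t => Q t + C * G t) x,
      hmem'] with t h1 h2
    rw [h1, hu h2]
  set r : ℝ → ℝ := fun t => (Q t - (σ - C) * G t) * u t with hrdef
  have hr : Continuous r :=
    (h.smooth_Q.continuous.sub (continuous_const.mul h.smooth_G.continuous)).mul huc
  have hweak : ∀ y, inner ℝ x y - inner ℝ (unitLp hk) x * inner ℝ (unitLp hk) y +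
      ∫ t in 0..2 * π, r t * ev y t = 0 := fun y => by
    have h1 := hx y
    rw [inner_eq_wInner hq hC hSx (curveOp_ae_eq _ _ y),
      inner_eq_wInner hG h.pos_G hJx (curveOp_ae_eq _ _ y)] at h1
    have h2 : ∫ t in 0..2 * π, r t * ev y t =
        wInner (fun t => Q t + C * G t) u (ev y) - σ * wInner G u (ev y) := by
      have hi1 : IntervalIntegrable (fun t => (Q t + C * G t) * (u t * ev y t)) volume 0 (2 * π) :=
        (hq.mul (huc.mul (hevc y))).intervalIntegrable _ _
      have hi2 : IntervalIntegrable (fun t => σ * (G t * (u t * ev y t))) volume 0 (2 * π) :=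
        (continuous_const.mul (hG.mul (huc.mul (hevc y)))).intervalIntegrable _ _
      simp only [wInner, ← intervalIntegral.integral_const_mul]
      rw [← intervalIntegral.integral_sub hi1 hi2]
      refine intervalIntegral.integral_congr fun t _ => ?_
      simp only [hrdef]
      ring
    rw [h2]
    linear_combination h1
  -- Testing with the unit constant, which represents the function `1`, cancels the first two terms
  -- and leaves the mean of `r`.
  have h0 : ∫ t in 0..2 * π, r t = 0 := by
    have h1 := hweak (unitLp hk)
    have h2 : ∫ t in 0..2 * π, r t * ev (unitLp hk) t = ∫ t in 0..2 * π, r t :=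
      intervalIntegral.integral_congr fun t ht => by
        rw [uIcc_of_le two_pi_pos.le] at ht
        simp only [hev, inner_evalCurve_unitLp hk hkpos ht, mul_one]
    rw [h2, real_inner_self_eq_norm_sq, norm_unitLp hk hkpos, real_inner_comm] at h1
    linear_combination h1
  refine ⟨u, isSolution_of_integral_equation h huc hup
    (α := inner ℝ (unitLp hk) x) (d := (totalMass fun t => (K t)⁻¹)⁻¹ *
      ∫ t in 0..2 * π, r t * ∫ z in 0..t, (K z)⁻¹) h0 fun s hs => ?_, hJx⟩
  have hN := continuous_primitive hk
  -- Testing with the indicator of `(0, s]` gives the value of `u` at `s`; the constant `d` is the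
  -- coefficient of the primitive of `1 / K` that results.
  have h1 := hweak (charLp hk s)
  have h2 : ∫ t in 0..2 * π, r t * ev (charLp hk s) t =
      (√(totalMass fun t => (K t)⁻¹))⁻¹ * (∫ z in 0..s, (K z)⁻¹) * (∫ t in 0..2 * π, r t) -
      (totalMass fun t => (K t)⁻¹)⁻¹ * (∫ z in 0..s, (K z)⁻¹) *
        (∫ t in 0..2 * π, r t * ∫ z in 0..t, (K z)⁻¹) +
      ∫ t in 0..2 * π, r t * ∫ z in 0..min t s, (K z)⁻¹ := by
    have hlin : ∀ a b : ℝ, a * (∫ t in 0..2 * π, r t) -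
        b * (∫ t in 0..2 * π, r t * ∫ z in 0..t, (K z)⁻¹) +
        ∫ t in 0..2 * π, r t * ∫ z in 0..min t s, (K z)⁻¹ = ∫ t in 0..2 * π, (a * r t -
          b * (r t * ∫ z in 0..t, (K z)⁻¹) + r t * ∫ z in 0..min t s, (K z)⁻¹) := fun a b => by
      have hi1 : Continuous fun t => b * (r t * ∫ z in 0..t, (K z)⁻¹) :=
        continuous_const.mul (hr.mul hN)
      have hi2 : Continuous fun t => r t * ∫ z in 0..min t s, (K z)⁻¹ :=
        hr.mul (hN.comp (continuous_id.min continuous_const))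
      have hi3 : Continuous fun t => a * r t := continuous_const.mul hr
      have hi4 : Continuous fun t => a * r t - b * (r t * ∫ z in 0..t, (K z)⁻¹) := hi3.sub hi1
      rw [intervalIntegral.integral_add (hi4.intervalIntegrable _ _)
        (hi2.intervalIntegrable _ _), intervalIntegral.integral_sub (hi3.intervalIntegrable _ _)
        (hi1.intervalIntegrable _ _), intervalIntegral.integral_const_mul,
        intervalIntegral.integral_const_mul]
    rw [hlin]
    refine intervalIntegral.integral_congr fun t ht => ?_
    rw [uIcc_of_le two_pi_pos.le] at ht
    simp only [hev, inner_evalCurve_charLp hk hkpos hs ht]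
    ring
  rw [h2, h0, integral_mul_primitive_min hr hk hs h0, inner_unitLp_charLp hk hkpos hs,
    real_inner_comm] at h1
  refine ((hu hs).trans (inner_evalCurve hk hkpos hs x)).trans ?_
  linear_combination h1

/-- There is an orthonormal basis of eigenfunctions. -/
theorem exists_isEigenbasis (h : IsRegular K G Q) :
    ∃ (lam : ℕ → ℝ) (V : ℕ → ℝ → ℝ), IsEigenbasis K G Q lam V := by
  have hk : Continuous fun t => (K t)⁻¹ := h.smooth_K.continuous.inv₀ fun t => (h.pos_K t).ne'
  have hkpos : ∀ t, 0 < (K t)⁻¹ := fun t => inv_pos.2 (h.pos_K t)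
  have hG := h.smooth_G.continuous
  obtain ⟨C, hC⟩ := exists_shift h
  have hq : Continuous fun t => Q t + C * G t := h.smooth_Q.continuous.add (continuous_const.mul hG)
  have := isFiniteMeasure_weightMeasure hG
  have := isFiniteMeasure_weightMeasure hq
  have hS : curveOp (evalCurve hk hkpos) (weightMeasure fun t => Q t + C * G t) (unitLp hk) ≠ 0 := by
    intro h0
    have h1 := curveOp_ae_eq (evalCurve hk hkpos) (weightMeasure fun t => Q t + C * G t) (unitLp hk)
    rw [h0] at h1
    have h2 := eqOn_of_ae_eq_weightMeasure hq hC (by fun_prop) continuous_const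
      (h1.symm.trans (Lp.coeFn_zero _ _ _)) two_pi_mem
    simp only [inner_evalCurve_unitLp hk hkpos two_pi_mem] at h2
    exact one_ne_zero h2
  obtain ⟨b, x, σ, hσ, hb⟩ := exists_hilbertBasis_generalized
    (curveOp (evalCurve hk hkpos) (weightMeasure G))
    (curveOp (evalCurve hk hkpos) (weightMeasure fun t => Q t + C * G t)) (norm_unitLp hk hkpos)
    (isCompactOperator_curveOp _ _)
    (eq_zero_of_forall_inner_curveOp_eq_zero h.smooth_K hk h.pos_K hkpos hG h.pos_G) hS
    (not_finiteDimensional_Lp hG h.pos_G)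
  choose w hw hbw using fun i => exists_isSolution_of_weak h hk hkpos hC (x i) (hb i).2
  -- Undo the spectral shift by `C` and pass from indices starting at `0` to indices starting at
  -- `1`.
  refine ⟨fun i => σ (i - 1) - C, fun i => w (i - 1), fun i _ => hw _, fun i _ =>
    sub_le_sub_right (hσ (by omega)) _, b, fun i => ?_⟩
  rw [(hb i).1]
  exact hbw i

end

end PeriodicSturmLiouville

open PeriodicSturmLiouville in
theorem mainTheorem4 (K G Q : ℝ → ℝ)
    (hK : ContDiff ℝ ∞ K) (hG : ContDiff ℝ ∞ G) (hQ : ContDiff ℝ ∞ Q)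
    (hKper : Function.Periodic K (2 * π)) (hGper : Function.Periodic G (2 * π))
    (hQper : Function.Periodic Q (2 * π))
    (hKpos : ∀ t, 0 < K t) (hGpos : ∀ t, 0 < G t) :
    (∃ (lam : ℕ → ℝ) (V : ℕ → ℝ → ℝ), IsEigenbasis K G Q lam V) ∧
    (∀ μ : ℝ, Module.rank ℝ (eigenspace K G Q hK μ) ≤ 2) ∧
    ∀ (lam : ℕ → ℝ) (V : ℕ → ℝ → ℝ), IsEigenbasis K G Q lam V →
      (lam 1 < lam 2 ∧
        ∀ k, 1 ≤ k → lam (2 * k) ≤ lam (2 * k + 1) ∧ lam (2 * k + 1) < lam (2 * k + 2)) ∧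
      ((∀ t, V 1 t ≠ 0) ∧
        ∀ j, 1 ≤ j → ∀ i, i = 2 * j ∨ i = 2 * j + 1 →
          (zeroSet (V i)).encard = (2 * j : ℕ) ∧ ∀ t ∈ zeroSet (V i), deriv (V i) t ≠ 0) ∧
      (∀ m n : ℕ, 1 ≤ m → m ≤ n → ∀ a : ℕ → ℝ, a m * a n ≠ 0 →
        zeroCount (fun t => ∑ j ∈ Finset.Icc m n, a j * V j t) ≤ zeroCount (V n) ∧
        signChangeCount (V m) ≤ signChangeCount (fun t => ∑ j ∈ Finset.Icc m n, a j * V j t)) := by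
  have h : IsRegular K G Q := ⟨hK, hG, hQ, hKper, hGper, hQper, hKpos, hGpos⟩
  refine ⟨exists_isEigenbasis h, rank_eigenspace_le_two h, fun lam V hE => ⟨⟨hE.lam_one_lt h le_rfl,
    fun k hk => ⟨hE.mono _ (by omega), hE.lam_lt h hk⟩⟩, ⟨hE.ground_ne_zero h
    (hE.solution 1 le_rfl) (hE.ne_zero h le_rfl), fun j hj i hi => ⟨hE.encard_zeroSet_eq h hj hi,
    fun t ht => hE.hasSimpleZeros h (by omega) t ht.2⟩⟩, fun m n hm hmn a ha => ⟨?_, ?_⟩⟩⟩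
  · rw [zeroCount_eq_encard (hE.hasSimpleZeros h (hm.trans hmn))]
    exact hE.zeroCount_linComb_le_encard h hm hmn (right_ne_zero_of_mul ha)
  -- Every sign change of `V m` is a zero, so bounding the zeros of `V m` suffices.
  · exact (signChangeCount_le_encard (hE.solution m hm).continuous).trans
      (hE.encard_le_signChangeCount h hm hmn (left_ne_zero_of_mul ha) (right_ne_zero_of_mul ha))
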